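/- Let $G$ be a finite group. "Semigroup" means commutative monoid, written additively; for a semigroup $A$ let $A\to A^+$ denote its group completion (Grothendieck group). Let $\overline{\mathcal A}_G$ be the category whose objects are finite $G$-sets and whose morphisms $X\to Y$ are isomorphism classes of spans $X\leftarrow A\to Y$ of finite $G$-sets, composed by pullback. Let $\overline{\mathcal U}_G$ be the category whose objects are finite $G$-sets and whose morphisms $X\to Y$ are isomorphism classes of bispans $X\xleftarrow{p}A\xrightarrow{q}B\xrightarrow{r}Y$ of finite $G$-sets; the composite of $(X_0\leftarrow A_0\to B_0\to X_1)$ followed by $(X_1\leftarrow A_1\to B_1\to X_2)$ is $(X_0\leftarrow A\to B\to X_2)$, where $B=\{(b_1,s)\mid s\colon q_1^{-1}\{b_1\}\to B_0,\ r_0s=p_1\}$ and $A=\{(a_0,a_1,s)\mid s\colon q_1^{-1}\{q_1(a_1)\}\to B_0,\ r_0s=p_1,\ q_0(a_0)=s(a_1)\}$ with the evident maps and $G$-actions. For $f\colon X\to Y$ the bispans $T_f=(X=X=X\xrightarrow{f}Y)$, $N_f=(X=X\xrightarrow{f}Y=Y)$ and $R_f=(Y\xleftarrow{f}X=X=X)$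 are the transfer, norm and restriction; spans $T_f$, $R_f$ are defined likewise. A Mackey functor (resp. Tambara functor) is a product-preserving functor from $\overline{\mathcal A}_G$ (resp. $\overline{\mathcal U}_G$) to sets, and morphisms are natural transformations. Products in both categories are disjoint unions, with projections the restrictions along the two inclusions. So each value $M(X)$ or $S(X)$ is a semigroup under $a+b=T_\nabla(a,b)$, $0=T_{\emptyset\to X}(*)$, and each $S(X)$ has the product $ab=N_\nabla(a,b)$, $1=N_{\emptyset\to X}(*)$, where $\nabla\colon X\amalg X\to X$ is the fold map. A Tambara functor is additively complete if every $(S(X),+)$ is a group. (1) For every Mackey functor $M$ there is a Mackey functor $M^+$ with a morphism $\eta\colon M\to M^+$ and isomorphisms $M^+(X)\cong M(X)^+$ of semigroups, for all finite $G$-sets $X$, which identify $\eta_X$ with the canonical map $M(X)\to M(X)^+$. (2) For every Tambara functor $S$ there is a Tambara functor $S^+$ with a morphism $\eta\colon S\to S^+$ of Tambara functors and isomorphisms $S^+(X)\cong S(X)^+$ of semigroups, for all finite $G$-sets $X$, which identify $\eta_X$ with the canonical map $S(X)\to S(X)^+$; in particular $S^+$ is additively complete. Moreover: (a) Let $f\colon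 X\to Y$ be a map of finite $G$-sets. Put $V(f)=\{(y,C)\mid y\in Y,\ C\subseteq f^{-1}\{y\}\}$, $V^2(f)=\{(y,C_1,C_2)\mid y\in Y,\ C_1,C_2\subseteq f^{-1}\{y\},\ C_1\cap C_2=\emptyset\}$ and $U(f)=\{(x,C)\mid x\in C\subseteq f^{-1}\{f(x)\}\}$, with the maps $p_i(y,C_1,C_2)=(y,C_i)$, $p_{12}(y,C_1,C_2)=(y,C_1\cup C_2)$, $r(x,C)=x$, $t(x,C)=(f(x),C)$, $k(y)=(y,\emptyset)$ and $j(y)=(y,f^{-1}\{y\})$. On $S(V(f))$ and $S^+(V(f))$ consider the convolution product $a\vee b=T_{p_{12}}(R_{p_1}(a)\,R_{p_2}(b))$ with unit $e=T_k(1)$, and put $\chi=N_tR_r\colon S(X)\to S(V(f))$. Then there is a unique map $\chi^+\colon S^+(X)\to S^+(V(f))$ with $\chi^+(0)=e$, $\chi^+(a+b)=\chi^+(a)\vee\chi^+(b)$, $R_k\chi^+(a)=1$ and $\chi^+\eta=\eta\chi$, and the norm map of $S^+$ is $N_f=R_j\chi^+\colon S^+(X)\to S^+(Y)$. If $|f^{-1}\{y\}|\le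 d$ for all $y\in Y$, then the map $N_f$ of abelian groups is polynomial of degree at most $d$: all its iterated differences $\delta[a_1]\cdots\delta[a_n]N_f$ with $n>d$ vanish, where $(\delta[a]h)(x)=h(a+x)-h(x)$. (b) For every additively complete Tambara functor $T$ and every morphism $\phi\colon S\to T$ of Tambara functors there is a unique morphism $\phi^+\colon S^+\to T$ of Tambara functors with $\phi^+\eta=\phi$. -/

import Mathlib

open CategoryTheory
open scoped Pointwise

universe u v

/-- A finite `G`-set. -/
structure FinGSet (G : Type u) [Group G] : Type (u + 1) where
  carrier : Type u
  [action : MulAction G carrier]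
  [finite : Finite carrier]

namespace FinGSet

variable {G : Type u} [Group G]

instance : CoeSort (FinGSet G) (Type u) := ⟨carrier⟩

attribute [instance] FinGSet.action FinGSet.finite

/-- The `G`-stable subset of `X` cut out by an invariant predicate. -/
abbrev sub (X : FinGSet G) (P : X → Prop) (h : ∀ (g : G) {x : X}, P x → P (g • x)) :
    FinGSet G :=
  ⟨(⟨{x | P x}, h⟩ : SubMulAction G X)⟩

theorem sub_prop {X : FinGSet G} {P : X → Prop} {h} (x : X.sub P h) : P x.1 := x.2

/-- The product of two finite `G`-sets. -/
abbrev prod (X Y : FinGSet G) : FinGSet G := ⟨X × Y⟩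

/-- The disjoint union of two finite `G`-sets. -/
abbrev sum (X Y : FinGSet G) : FinGSet G := ⟨X ⊕ Y⟩

/-- The `G`-set of all subsets of `X`, with `g • C = {g • x | x ∈ C}`. -/
abbrev powerset (X : FinGSet G) : FinGSet G :=
  ⟨Set X⟩

instance : MulAction G PEmpty.{u + 1} where
  smul _ x := x
  one_smul _ := rfl
  mul_smul _ _ _ := rfl

/-- The empty `G`-set. -/
abbrev empty (G : Type u) [Group G] : FinGSet G := ⟨PEmpty.{u + 1}⟩

/-- The unique map out of the empty `G`-set. -/
def fromEmpty (X : FinGSet G) : empty G →[G] X where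
  toFun x := x.elim
  map_smul' _ x := x.elim

/-- The inclusion of the first summand. -/
def inl (X Y : FinGSet G) : X →[G] sum X Y := ⟨Sum.inl, fun _ _ => rfl⟩

/-- The inclusion of the second summand. -/
def inr (X Y : FinGSet G) : Y →[G] sum X Y := ⟨Sum.inr, fun _ _ => rfl⟩

/-- The map out of a disjoint union with given components. -/
def sumElim {X Y Z : FinGSet G} (f : X →[G] Z) (h : Y →[G] Z) : sum X Y →[G] Z where
  toFun := Sum.elim f h
  map_smul' := by rintro g (x | x) <;> simp

/-- The fold map `X ⊔ X → X`. -/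
def fold (X : FinGSet G) : sum X X →[G] X := sumElim (.id G) (.id G)

@[simp] theorem inl_apply (X Y : FinGSet G) (x : X) : inl X Y x = Sum.inl x := rfl
@[simp] theorem inr_apply (X Y : FinGSet G) (x : Y) : inr X Y x = Sum.inr x := rfl
@[simp] theorem sumElim_inl {X Y Z : FinGSet G} (f : X →[G] Z) (h : Y →[G] Z) (x : X) :
    sumElim f h (Sum.inl x : X ⊕ Y) = f x := rfl
@[simp] theorem sumElim_inr {X Y Z : FinGSet G} (f : X →[G] Z) (h : Y →[G] Z) (x : Y) :
    sumElim f h (Sum.inr x : X ⊕ Y) = h x := rfl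
@[simp] theorem fold_inl (X : FinGSet G) (x : X) : fold X (Sum.inl x : X ⊕ X) = x := rfl
@[simp] theorem fold_inr (X : FinGSet G) (x : X) : fold X (Sum.inr x : X ⊕ X) = x := rfl

end FinGSet

/-! ### The category of spans -/

/-- A span `X ← A → Y` of finite `G`-sets. -/
structure GSpan {G : Type u} [Group G] (X Y : FinGSet G) : Type (u + 1) where
  A : FinGSet G
  p : A →[G] X
  q : A →[G] Y

namespace GSpan

variable {G : Type u} [Group G] {X Y Z W : FinGSet G}

/-- An isomorphism of spans: an equivariant bijection compatible with both legs. -/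
structure Iso (ω ω' : GSpan X Y) where
  α : ω.A ≃ ω'.A
  α_smul : ∀ (g : G) (a : ω.A), α (g • a) = g • α a
  p_comm : ∀ a, ω'.p (α a) = ω.p a
  q_comm : ∀ a, ω'.q (α a) = ω.q a

/-- The identity isomorphism. -/
def Iso.refl (ω : GSpan X Y) : Iso ω ω := ⟨.refl _, by simp, by simp, by simp⟩

/-- The inverse isomorphism. -/
def Iso.symm {ω ω' : GSpan X Y} (e : Iso ω ω') : Iso ω' ω where
  α := e.α.symm
  α_smul g a := by rw [Equiv.symm_apply_eq, e.α_smul]; simp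
  p_comm a := by rw [← e.p_comm]; simp
  q_comm a := by rw [← e.q_comm]; simp

/-- The composite isomorphism. -/
def Iso.trans {ω ω' ω'' : GSpan X Y} (e : Iso ω ω') (e' : Iso ω' ω'') : Iso ω ω'' where
  α := e.α.trans e'.α
  α_smul g a := by simp [e.α_smul, e'.α_smul]
  p_comm a := by simp [e.p_comm, e'.p_comm]
  q_comm a := by simp [e.q_comm, e'.q_comm]

instance setoid (X Y : FinGSet G) : Setoid (GSpan X Y) where
  r ω ω' := Nonempty (Iso ω ω')
  iseqv := ⟨fun ω => ⟨.refl ω⟩, fun ⟨e⟩ => ⟨e.symm⟩, fun ⟨e⟩ ⟨e'⟩ => ⟨e.trans e'⟩⟩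

/-- The identity span. -/
def id (X : FinGSet G) : GSpan X X := ⟨X, .id G, .id G⟩

/-- The composite `X ← A ×_Y B → Z` of `X ← A → Y` and `Y ← B → Z`. -/
def comp (ω₀ : GSpan X Y) (ω₁ : GSpan Y Z) : GSpan X Z where
  A := (ω₀.A.prod ω₁.A).sub (fun a => ω₀.q a.1 = ω₁.p a.2) (fun g _ h => by simp [h])
  p := ⟨fun a => ω₀.p a.1.1, fun g a => by simp⟩
  q := ⟨fun a => ω₁.q a.1.2, fun g a => by simp⟩

/-- Composition respects isomorphisms. -/
def Iso.comp {ω₀ ω₀' : GSpan X Y} {ω₁ ω₁' : GSpan Y Z} (e₀ : Iso ω₀ ω₀') (e₁ : Iso ω₁ ω₁') :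
    Iso (ω₀.comp ω₁) (ω₀'.comp ω₁') where
  α :=
    { toFun := fun a => ⟨(e₀.α a.1.1, e₁.α a.1.2), by
        have := FinGSet.sub_prop a
        rwa [← e₀.q_comm, ← e₁.p_comm] at this⟩
      invFun := fun a => ⟨(e₀.α.symm a.1.1, e₁.α.symm a.1.2), by
        have := FinGSet.sub_prop a
        rwa [← e₀.symm.q_comm, ← e₁.symm.p_comm] at this⟩
      left_inv := fun a => Subtype.ext (Prod.ext (by simp) (by simp))
      right_inv := fun a => Subtype.ext (Prod.ext (by simp) (by simp)) }
  α_smul g a := Subtype.ext (Prod.ext (e₀.α_smul g a.1.1) (e₁.α_smul g a.1.2))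
  p_comm a := e₀.p_comm a.1.1
  q_comm a := e₁.q_comm a.1.2

/-- Left unitality. -/
def idComp (ω : GSpan X Y) : Iso ((id X).comp ω) ω where
  α :=
    { toFun := fun a => a.1.2
      invFun := fun a => ⟨(ω.p a, a), rfl⟩
      left_inv := fun a => Subtype.ext (Prod.ext a.2.symm rfl)
      right_inv := fun _ => rfl }
  α_smul _ _ := rfl
  p_comm a := a.2.symm
  q_comm _ := rfl

/-- Right unitality. -/
def compId (ω : GSpan X Y) : Iso (ω.comp (id Y)) ω where
  α :=
    { toFun := fun a => a.1.1
      invFun := fun a => ⟨(a, ω.q a), rfl⟩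
      left_inv := fun a => Subtype.ext (Prod.ext rfl a.2)
      right_inv := fun _ => rfl }
  α_smul _ _ := rfl
  p_comm _ := rfl
  q_comm a := a.2

/-- Associativity. -/
def assoc (ω₀ : GSpan X Y) (ω₁ : GSpan Y Z) (ω₂ : GSpan Z W) :
    Iso ((ω₀.comp ω₁).comp ω₂) (ω₀.comp (ω₁.comp ω₂)) where
  α :=
    { toFun := fun a => ⟨(a.1.1.1.1, ⟨(a.1.1.1.2, a.1.2), a.2⟩), a.1.1.2⟩
      invFun := fun a => ⟨(⟨(a.1.1, a.1.2.1.1), a.2⟩, a.1.2.1.2), a.1.2.2⟩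
      left_inv := fun _ => rfl
      right_inv := fun _ => rfl }
  α_smul _ _ := rfl
  p_comm _ := rfl
  q_comm _ := rfl

end GSpan

/-- The category of finite `G`-sets and isomorphism classes of spans. -/
def SpanCat (G : Type u) [Group G] : Type (u + 1) := FinGSet G

namespace SpanCat

variable {G : Type u} [Group G]

instance : Category.{u + 1} (SpanCat G) where
  Hom X Y := Quotient (GSpan.setoid (G := G) X Y)
  id X := ⟦GSpan.id X⟧
  comp {X Y Z} f g := Quotient.map₂ (sa := GSpan.setoid (G := G) X Y)
    (sb := GSpan.setoid (G := G) Y Z) (sc := GSpan.setoid (G := G) X Z) GSpan.comp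
    (fun _ _ e _ _ e' => Nonempty.map2 GSpan.Iso.comp e e') f g
  id_comp := by rintro X Y ⟨ω⟩; exact Quotient.sound ⟨ω.idComp⟩
  comp_id := by rintro X Y ⟨ω⟩; exact Quotient.sound ⟨ω.compId⟩
  assoc := by
    rintro X Y Z W ⟨ω₀⟩ ⟨ω₁⟩ ⟨ω₂⟩
    exact Quotient.sound ⟨ω₀.assoc ω₁ ω₂⟩

/-- A finite `G`-set as an object of the category of spans. -/
abbrev of (X : FinGSet G) : SpanCat G := X

/-- The class of a span. -/
def mk {X Y : FinGSet G} (ω : GSpan X Y) : of X ⟶ of Y := Quotient.mk _ ω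

theorem mk_eq {X Y : FinGSet G} {ω ω' : GSpan X Y} (e : ω.Iso ω') : mk ω = mk ω' :=
  Quotient.sound ⟨e⟩

theorem mk_comp {X Y Z : FinGSet G} (ω₀ : GSpan X Y) (ω₁ : GSpan Y Z) :
    mk ω₀ ≫ mk ω₁ = mk (ω₀.comp ω₁) := rfl

theorem exists_mk {X Y : FinGSet G} (f : of X ⟶ of Y) : ∃ ω, f = mk ω := by
  obtain ⟨ω⟩ := f
  exact ⟨ω, rfl⟩

/-- The transfer `T_f = [X = X → Y]`. -/
def T {X Y : FinGSet G} (f : X →[G] Y) : of X ⟶ of Y := mk ⟨X, .id G, f⟩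

/-- The restriction `R_f = [Y ← X = X]`. -/
def R {X Y : FinGSet G} (f : X →[G] Y) : of Y ⟶ of X := mk ⟨X, f, .id G⟩

end SpanCat

/-! ### The category of bispans -/

/-- A bispan `X ← A → B → Y` of finite `G`-sets. -/
structure Bispan {G : Type u} [Group G] (X Y : FinGSet G) : Type (u + 1) where
  A : FinGSet G
  B : FinGSet G
  p : A →[G] X
  q : A →[G] B
  r : B →[G] Y

namespace Bispan

variable {G : Type u} [Group G] {X Y Z W : FinGSet G}

/-- An isomorphism of bispans: a pair of equivariant bijections compatible with all the maps. -/
structure Iso (ω ω' : Bispan X Y) where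
  α : ω.A ≃ ω'.A
  β : ω.B ≃ ω'.B
  α_smul : ∀ (g : G) (a : ω.A), α (g • a) = g • α a
  β_smul : ∀ (g : G) (b : ω.B), β (g • b) = g • β b
  p_comm : ∀ a, ω'.p (α a) = ω.p a
  q_comm : ∀ a, ω'.q (α a) = β (ω.q a)
  r_comm : ∀ b, ω'.r (β b) = ω.r b

/-- The identity isomorphism. -/
def Iso.refl (ω : Bispan X Y) : Iso ω ω :=
  ⟨.refl _, .refl _, by simp, by simp, by simp, by simp, by simp⟩

/-- The inverse isomorphism. -/
def Iso.symm {ω ω' : Bispan X Y} (e : Iso ω ω') : Iso ω' ω where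
  α := e.α.symm
  β := e.β.symm
  α_smul g a := by rw [Equiv.symm_apply_eq, e.α_smul]; simp
  β_smul g a := by rw [Equiv.symm_apply_eq, e.β_smul]; simp
  p_comm a := by rw [← e.p_comm]; simp
  q_comm a := by rw [Equiv.eq_symm_apply, ← e.q_comm]; simp
  r_comm a := by rw [← e.r_comm]; simp

/-- The composite isomorphism. -/
def Iso.trans {ω ω' ω'' : Bispan X Y} (e : Iso ω ω') (e' : Iso ω' ω'') : Iso ω ω'' where
  α := e.α.trans e'.α
  β := e.β.trans e'.β
  α_smul g a := by simp [e.α_smul, e'.α_smul]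
  β_smul g a := by simp [e.β_smul, e'.β_smul]
  p_comm a := by simp [e.p_comm, e'.p_comm]
  q_comm a := by simp [e.q_comm, e'.q_comm]
  r_comm a := by simp [e.r_comm, e'.r_comm]

instance setoid (X Y : FinGSet G) : Setoid (Bispan X Y) where
  r ω ω' := Nonempty (Iso ω ω')
  iseqv := ⟨fun ω => ⟨.refl ω⟩, fun ⟨e⟩ => ⟨e.symm⟩, fun ⟨e⟩ ⟨e'⟩ => ⟨e.trans e'⟩⟩

/-- The identity bispan. -/
def id (X : FinGSet G) : Bispan X X := ⟨X, X, .id G, .id G, .id G⟩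

/-- For `ω₀ = (X ← A₀ → B₀ → Y)` and `ω₁ = (Y ← A₁ → B₁ → Z)`, the set of pairs `(b, s)` where
`b ∈ B₁` and `s : q₁⁻¹{b} → B₀` is a map (not assumed equivariant) with `r₀ s = p₁`. -/
@[ext]
structure PreSection (ω₀ : Bispan X Y) (ω₁ : Bispan Y Z) : Type u where
  base : ω₁.B
  sec : {a : ω₁.A // ω₁.q a = base} → ω₀.B
  r_sec : ∀ a, ω₀.r (sec a) = ω₁.p a.1

namespace PreSection

variable {ω₀ : Bispan X Y} {ω₁ : Bispan Y Z}

theorem ext' {x y : PreSection ω₀ ω₁} (h : x.base = y.base)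
    (h' : ∀ (a : ω₁.A) (hx : ω₁.q a = x.base) (hy : ω₁.q a = y.base),
      x.sec ⟨a, hx⟩ = y.sec ⟨a, hy⟩) : x = y := by
  obtain ⟨b, s, hs⟩ := x
  obtain ⟨b', s', hs'⟩ := y
  obtain rfl : b = b' := h
  obtain rfl : s = s' := funext fun a => h' a.1 a.2 a.2
  rfl

theorem sec_congr {x y : PreSection ω₀ ω₁} (h : x = y) {a a' : ω₁.A} (ha : a = a')
    (hx : ω₁.q a = x.base) (hy : ω₁.q a' = y.base) : x.sec ⟨a, hx⟩ = y.sec ⟨a', hy⟩ := by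
  subst h; subst ha; rfl

/-- The action `g • (b, s) = (g b, g s g⁻¹)`. -/
instance : MulAction G (PreSection ω₀ ω₁) where
  smul g x :=
    { base := g • x.base
      sec := fun a => g • x.sec ⟨g⁻¹ • a.1, by rw [map_smul, a.2, inv_smul_smul]⟩
      r_sec := fun a => by rw [map_smul, x.r_sec, map_smul, smul_inv_smul] }
  one_smul x := ext' (one_smul G x.base) fun _ _ _ =>
    (one_smul G _).trans (sec_congr rfl (by simp) _ _)
  mul_smul g g' x := ext' (mul_smul g g' x.base) fun _ _ _ =>
    (mul_smul g g' _).trans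
      (congrArg (fun b => g • g' • b) (sec_congr rfl (by simp [mul_smul]) _ _))

theorem smul_base (g : G) (x : PreSection ω₀ ω₁) : (g • x).base = g • x.base := rfl

theorem smul_sec (g : G) (x : PreSection ω₀ ω₁) (a : ω₁.A) (h : ω₁.q a = (g • x).base)
    (h' : ω₁.q (g⁻¹ • a) = x.base) :
    (g • x).sec ⟨a, h⟩ = g • x.sec ⟨g⁻¹ • a, h'⟩ := rfl

theorem smul_sec_smul (g : G) (x : PreSection ω₀ ω₁) (a : ω₁.A)
    (h : ω₁.q (g • a) = (g • x).base) (h' : ω₁.q a = x.base) :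
    (g • x).sec ⟨g • a, h⟩ = g • x.sec ⟨a, h'⟩ := by
  rw [smul_sec g x _ _ (by simpa using h')]
  congr 1
  exact sec_congr rfl (by simp) _ _

instance : Finite (PreSection ω₀ ω₁) := by
  let F : PreSection ω₀ ω₁ → Σ b : ω₁.B, ({a : ω₁.A // ω₁.q a = b} → ω₀.B) :=
    fun x => ⟨x.base, x.sec⟩
  refine Finite.of_injective F ?_
  rintro ⟨b, s, hs⟩ ⟨b', s', hs'⟩ h
  simp only [F, Sigma.mk.injEq] at h
  obtain ⟨rfl, h⟩ := h
  obtain rfl := eq_of_heq h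
  rfl

end PreSection

/-- The composite of the bispans `ω₀ = (X ← A₀ → B₀ → Y)` and `ω₁ = (Y ← A₁ → B₁ → Z)`, that is
`X ← A → B → Z` with `B = {(b₁, s) | s : q₁⁻¹{b₁} → B₀, r₀ s = p₁}` and
`A = {(a₀, a₁, s) | s : q₁⁻¹{q₁ a₁} → B₀, r₀ s = p₁, q₀ a₀ = s a₁}`; a point `(a₀, a₁, s)` of `A`
is recorded here as `(a₀, a₁, (q₁ a₁, s))`. -/
def comp (ω₀ : Bispan X Y) (ω₁ : Bispan Y Z) : Bispan X Z where
  A := (ω₀.A.prod (ω₁.A.prod ⟨PreSection ω₀ ω₁⟩)).sub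
    (fun x => ∃ h : ω₁.q x.2.1 = x.2.2.base, ω₀.q x.1 = x.2.2.sec ⟨x.2.1, h⟩) (by
      rintro g ⟨a₀, a₁, x⟩ ⟨h, h'⟩
      refine ⟨(map_smul ω₁.q g a₁).trans (congrArg (g • ·) h), ?_⟩
      refine (map_smul ω₀.q g a₀).trans ((congrArg (g • ·) h').trans ?_)
      exact (PreSection.smul_sec_smul g x a₁ _ h).symm)
  B := ⟨PreSection ω₀ ω₁⟩
  p := ⟨fun x => ω₀.p x.1.1, fun g x => map_smul ω₀.p g x.1.1⟩
  q := ⟨fun x => x.1.2.2, fun _ _ => rfl⟩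
  r := ⟨fun x => ω₁.r x.base, fun g x => map_smul ω₁.r g x.base⟩

/-- The effect of isomorphisms on pairs `(b, s)`. -/
def PreSection.map {ω₀ ω₀' : Bispan X Y} {ω₁ ω₁' : Bispan Y Z} (e₀ : Iso ω₀ ω₀')
    (e₁ : Iso ω₁ ω₁') (x : PreSection ω₀ ω₁) : PreSection ω₀' ω₁' where
  base := e₁.β x.base
  sec a := e₀.β (x.sec ⟨e₁.α.symm a.1, by
    have := e₁.q_comm (e₁.α.symm a.1)
    rw [Equiv.apply_symm_apply, a.2] at this
    exact (e₁.β.injective this).symm⟩)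
  r_sec a := by rw [e₀.r_comm, x.r_sec, ← e₁.p_comm, Equiv.apply_symm_apply]

/-- Composition respects isomorphisms. -/
def Iso.comp {ω₀ ω₀' : Bispan X Y} {ω₁ ω₁' : Bispan Y Z} (e₀ : Iso ω₀ ω₀') (e₁ : Iso ω₁ ω₁') :
    Iso (ω₀.comp ω₁) (ω₀'.comp ω₁') where
  β :=
    { toFun := PreSection.map e₀ e₁
      invFun := PreSection.map e₀.symm e₁.symm
      left_inv := fun x => PreSection.ext' (e₁.β.symm_apply_apply _) fun a hx hy => by
        refine (e₀.β.symm_apply_apply _).trans ?_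
        exact PreSection.sec_congr rfl (e₁.α.symm_apply_apply _) _ _
      right_inv := fun x => PreSection.ext' (e₁.β.apply_symm_apply _) fun a hx hy => by
        refine (e₀.β.apply_symm_apply _).trans ?_
        exact PreSection.sec_congr rfl (e₁.α.apply_symm_apply _) _ _ }
  α :=
    { toFun := fun x => ⟨(e₀.α x.1.1, e₁.α x.1.2.1, PreSection.map e₀ e₁ x.1.2.2), by
        obtain ⟨h, h'⟩ := FinGSet.sub_prop x
        refine ⟨(e₁.q_comm _).trans (congrArg e₁.β h), (e₀.q_comm _).trans ?_⟩
        refine congrArg e₀.β (h'.trans (PreSection.sec_congr rfl ?_ _ _))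
        exact (e₁.α.symm_apply_apply _).symm⟩
      invFun := fun x =>
        ⟨(e₀.α.symm x.1.1, e₁.α.symm x.1.2.1, PreSection.map e₀.symm e₁.symm x.1.2.2), by
        obtain ⟨h, h'⟩ := FinGSet.sub_prop x
        refine ⟨(e₁.symm.q_comm _).trans (congrArg e₁.β.symm h), (e₀.symm.q_comm _).trans ?_⟩
        refine congrArg e₀.β.symm (h'.trans (PreSection.sec_congr rfl ?_ _ _))
        exact (e₁.α.apply_symm_apply _).symm⟩
      left_inv := fun x => by
        refine Subtype.ext (Prod.ext (e₀.α.symm_apply_apply _)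
          (Prod.ext (e₁.α.symm_apply_apply _) ?_))
        refine PreSection.ext' (e₁.β.symm_apply_apply _) fun a hx hy => ?_
        refine (e₀.β.symm_apply_apply _).trans ?_
        exact PreSection.sec_congr rfl (e₁.α.symm_apply_apply _) _ _
      right_inv := fun x => by
        refine Subtype.ext (Prod.ext (e₀.α.apply_symm_apply _)
          (Prod.ext (e₁.α.apply_symm_apply _) ?_))
        refine PreSection.ext' (e₁.β.apply_symm_apply _) fun a hx hy => ?_
        refine (e₀.β.apply_symm_apply _).trans ?_
        exact PreSection.sec_congr rfl (e₁.α.apply_symm_apply _) _ _ }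
  α_smul g x := by
    refine Subtype.ext (Prod.ext (e₀.α_smul g _) (Prod.ext (e₁.α_smul g _) ?_))
    refine PreSection.ext' (e₁.β_smul g _) fun a hx hy => ?_
    refine (e₀.β_smul g _).trans (congrArg (g • ·) (congrArg e₀.β ?_))
    exact PreSection.sec_congr rfl (e₁.symm.α_smul g⁻¹ a).symm _ _
  β_smul g x := by
    refine PreSection.ext' (e₁.β_smul g _) fun a hx hy => ?_
    refine (e₀.β_smul g _).trans (congrArg (g • ·) (congrArg e₀.β ?_))
    exact PreSection.sec_congr rfl (e₁.symm.α_smul g⁻¹ a).symm _ _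
  p_comm x := e₀.p_comm x.1.1
  q_comm _ := rfl
  r_comm x := e₁.r_comm x.base

/-- Left unitality. -/
def idComp (ω : Bispan X Y) : Iso ((id X).comp ω) ω where
  β :=
    { toFun := fun x => x.base
      invFun := fun b => ⟨b, fun a => ω.p a.1, fun _ => rfl⟩
      left_inv := fun x => PreSection.ext' rfl fun a hx _ => (x.r_sec ⟨a, hx⟩).symm
      right_inv := fun _ => rfl }
  α :=
    { toFun := fun x => x.1.2.1
      invFun := fun a => ⟨(ω.p a, a, ⟨ω.q a, fun a => ω.p a.1, fun _ => rfl⟩), rfl, rfl⟩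
      left_inv := fun x => by
        obtain ⟨h, h'⟩ := FinGSet.sub_prop x
        refine Subtype.ext (Prod.ext ?_ (Prod.ext rfl ?_))
        · exact (h'.trans (x.1.2.2.r_sec ⟨_, h⟩)).symm
        · exact PreSection.ext' h fun a _ hx => (x.1.2.2.r_sec ⟨a, hx⟩).symm
      right_inv := fun _ => rfl }
  α_smul _ _ := rfl
  β_smul _ _ := rfl
  p_comm x := by
    obtain ⟨h, h'⟩ := FinGSet.sub_prop x
    exact (h'.trans (x.1.2.2.r_sec ⟨_, h⟩)).symm
  q_comm x := (FinGSet.sub_prop x).1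
  r_comm _ := rfl

/-- Right unitality. -/
def compId (ω : Bispan X Y) : Iso (ω.comp (id Y)) ω where
  β :=
    { toFun := fun x => x.sec ⟨x.base, rfl⟩
      invFun := fun b => ⟨ω.r b, fun _ => b, fun a => a.2.symm⟩
      left_inv := fun x => PreSection.ext' (x.r_sec ⟨x.base, rfl⟩) fun a _ hy =>
        PreSection.sec_congr (x := x) (y := x) rfl (show x.base = a from hy.symm) rfl hy
      right_inv := fun _ => rfl }
  α :=
    { toFun := fun x => x.1.1
      invFun := fun a =>
        ⟨(a, ω.r (ω.q a), ⟨ω.r (ω.q a), fun _ => ω.q a, fun a => a.2.symm⟩), rfl, rfl⟩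
      left_inv := fun x => by
        obtain ⟨h, h'⟩ := FinGSet.sub_prop x
        have key : ω.r (ω.q x.1.1) = x.1.2.1 :=
          (congrArg ω.r h').trans (x.1.2.2.r_sec ⟨_, h⟩)
        refine Subtype.ext (Prod.ext rfl (Prod.ext key ?_))
        refine PreSection.ext' (key.trans h) fun a hx hy => h'.trans ?_
        exact PreSection.sec_congr rfl (h.trans hy.symm) _ _
      right_inv := fun _ => rfl }
  α_smul _ _ := rfl
  β_smul g x := (PreSection.smul_sec_smul g x x.base rfl rfl)
  p_comm _ := rfl
  q_comm x := by
    obtain ⟨h, h'⟩ := FinGSet.sub_prop x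
    exact h'.trans (PreSection.sec_congr rfl h _ _)
  r_comm x := x.r_sec ⟨x.base, rfl⟩

/-- Regrouping of the data of a triple composite. -/
def PreSection.assocFwd {ω₀ : Bispan X Y} {ω₁ : Bispan Y Z} {ω₂ : Bispan Z W}
    (x : PreSection (ω₀.comp ω₁) ω₂) : PreSection ω₀ (ω₁.comp ω₂) where
  base := ⟨x.base, fun a => (x.sec a).base, fun a => x.r_sec a⟩
  sec a := (x.sec ⟨a.1.1.2.1, by
    have h := (FinGSet.sub_prop a.1).1
    exact h.trans (congrArg PreSection.base a.2)⟩).sec ⟨a.1.1.1, by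
      obtain ⟨h, h'⟩ := FinGSet.sub_prop a.1
      exact h'.trans (PreSection.sec_congr a.2 rfl _ _)⟩
  r_sec a := (x.sec _).r_sec _

/-- Regrouping of the data of a triple composite. -/
def PreSection.assocBwd {ω₀ : Bispan X Y} {ω₁ : Bispan Y Z} {ω₂ : Bispan Z W}
    (y : PreSection ω₀ (ω₁.comp ω₂)) : PreSection (ω₀.comp ω₁) ω₂ where
  base := y.base.base
  sec a :=
    { base := y.base.sec a
      sec := fun a₁ => y.sec ⟨⟨(a₁.1, a.1, y.base), a.2, a₁.2⟩, rfl⟩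
      r_sec := fun _ => y.r_sec _ }
  r_sec a := y.base.r_sec a

theorem PreSection.assocFwd_assocBwd {ω₀ : Bispan X Y} {ω₁ : Bispan Y Z} {ω₂ : Bispan Z W}
    (y : PreSection ω₀ (ω₁.comp ω₂)) : y.assocBwd.assocFwd = y :=
  PreSection.ext' rfl fun a hx hy => by
    obtain ⟨⟨a₁, a₂, t⟩, ha⟩ := a
    obtain rfl : t = y.base := hy
    rfl

/-- Regrouping of the data of a triple composite. -/
def assocFwdA {ω₀ : Bispan X Y} {ω₁ : Bispan Y Z} {ω₂ : Bispan Z W}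
    (x : ((ω₀.comp ω₁).comp ω₂).A) : (ω₀.comp (ω₁.comp ω₂)).A :=
  ⟨(x.1.1.1.1, ⟨(x.1.1.1.2.1, x.1.2.1, x.1.2.2.assocFwd.base), by
      obtain ⟨h, h'⟩ := FinGSet.sub_prop x
      obtain ⟨k, k'⟩ := FinGSet.sub_prop x.1.1
      exact ⟨h, k.trans (congrArg PreSection.base h')⟩⟩, x.1.2.2.assocFwd), by
    obtain ⟨h, h'⟩ := FinGSet.sub_prop x
    obtain ⟨k, k'⟩ := FinGSet.sub_prop x.1.1
    exact ⟨rfl, k'.trans (PreSection.sec_congr h' rfl _ _)⟩⟩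

theorem assocFwdA_injective {ω₀ : Bispan X Y} {ω₁ : Bispan Y Z} {ω₂ : Bispan Z W} :
    Function.Injective (assocFwdA (ω₀ := ω₀) (ω₁ := ω₁) (ω₂ := ω₂)) := by
  rintro ⟨⟨⟨⟨a₀, a₁, t⟩, k⟩, a₂, x⟩, h, h'⟩ ⟨⟨⟨⟨a₀', a₁', t'⟩, k'⟩, a₂', x'⟩, l, l'⟩ e
  obtain rfl : a₀ = a₀' := congrArg (fun y => y.1.1) e
  obtain rfl : a₁ = a₁' := congrArg (fun y => y.1.2.1.1.1) e
  obtain rfl : a₂ = a₂' := congrArg (fun y => y.1.2.1.1.2.1) e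
  have e' : x.assocFwd = x'.assocFwd := congrArg (fun y => y.1.2.2) e
  obtain rfl : x = x' := congrArg PreSection.assocBwd e'
  have e₁ : t = x.sec ⟨a₂, h⟩ := h'
  have e₂ : t' = x.sec ⟨a₂, l⟩ := l'
  have e₃ : t = t' := e₁.trans e₂.symm
  subst e₃
  rfl

theorem assocFwdA_surjective {ω₀ : Bispan X Y} {ω₁ : Bispan Y Z} {ω₂ : Bispan Z W} :
    Function.Surjective (assocFwdA (ω₀ := ω₀) (ω₁ := ω₁) (ω₂ := ω₂)) := by
  rintro ⟨⟨a₀, ⟨⟨a₁, a₂, t⟩, k, k'⟩, y⟩, h, h'⟩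
  obtain rfl : t = y.base := h
  refine ⟨⟨(⟨(a₀, a₁, y.assocBwd.sec ⟨a₂, k⟩), k', h'⟩, a₂, y.assocBwd), k, rfl⟩, ?_⟩
  exact Subtype.ext (Prod.ext rfl (Prod.ext rfl y.assocFwd_assocBwd))

/-- Associativity. -/
noncomputable def assoc (ω₀ : Bispan X Y) (ω₁ : Bispan Y Z) (ω₂ : Bispan Z W) :
    Iso ((ω₀.comp ω₁).comp ω₂) (ω₀.comp (ω₁.comp ω₂)) where
  β := ⟨PreSection.assocFwd, PreSection.assocBwd, fun _ => rfl, PreSection.assocFwd_assocBwd⟩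
  α := Equiv.ofBijective assocFwdA ⟨assocFwdA_injective, assocFwdA_surjective⟩
  α_smul _ _ := rfl
  β_smul _ _ := rfl
  p_comm _ := rfl
  q_comm _ := rfl
  r_comm _ := rfl

end Bispan

/-- The category of finite `G`-sets and isomorphism classes of bispans. -/
def BispanCat (G : Type u) [Group G] : Type (u + 1) := FinGSet G

namespace BispanCat

variable {G : Type u} [Group G]

instance : Category.{u + 1} (BispanCat G) where
  Hom X Y := Quotient (Bispan.setoid (G := G) X Y)
  id X := ⟦Bispan.id X⟧
  comp {X Y Z} f g := Quotient.map₂ (sa := Bispan.setoid (G := G) X Y)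
    (sb := Bispan.setoid (G := G) Y Z) (sc := Bispan.setoid (G := G) X Z) Bispan.comp
    (fun _ _ e _ _ e' => Nonempty.map2 Bispan.Iso.comp e e') f g
  id_comp := by rintro X Y ⟨ω⟩; exact Quotient.sound ⟨ω.idComp⟩
  comp_id := by rintro X Y ⟨ω⟩; exact Quotient.sound ⟨ω.compId⟩
  assoc := by
    rintro X Y Z W ⟨ω₀⟩ ⟨ω₁⟩ ⟨ω₂⟩
    exact Quotient.sound ⟨ω₀.assoc ω₁ ω₂⟩

/-- A finite `G`-set as an object of the category of bispans. -/
abbrev of (X : FinGSet G) : BispanCat G := X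

/-- The class of a bispan. -/
def mk {X Y : FinGSet G} (ω : Bispan X Y) : of X ⟶ of Y := Quotient.mk _ ω

theorem mk_eq {X Y : FinGSet G} {ω ω' : Bispan X Y} (e : ω.Iso ω') : mk ω = mk ω' :=
  Quotient.sound ⟨e⟩

theorem mk_comp {X Y Z : FinGSet G} (ω₀ : Bispan X Y) (ω₁ : Bispan Y Z) :
    mk ω₀ ≫ mk ω₁ = mk (ω₀.comp ω₁) := rfl

theorem exists_mk {X Y : FinGSet G} (f : of X ⟶ of Y) : ∃ ω, f = mk ω := by
  obtain ⟨ω⟩ := f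
  exact ⟨ω, rfl⟩

/-- The transfer `T_f = [X = X = X → Y]`. -/
def T {X Y : FinGSet G} (f : X →[G] Y) : of X ⟶ of Y := mk ⟨X, X, .id G, .id G, f⟩

/-- The norm `N_f = [X = X → Y = Y]`. -/
def N {X Y : FinGSet G} (f : X →[G] Y) : of X ⟶ of Y := mk ⟨X, Y, .id G, f, .id G⟩

/-- The restriction `R_f = [Y ← X = X = X]`. -/
def R {X Y : FinGSet G} (f : X →[G] Y) : of Y ⟶ of X := mk ⟨X, X, f, .id G, .id G⟩

end BispanCat

/-! ### Disjoint unions are products of spans and of bispans -/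

section GenericProducts

open Limits

variable {C : Type*} [Category C]

/-- A cone over two objects with the universal property of a product. -/
noncomputable def isLimitOfExistsUnique {P X Y : C} (p : P ⟶ X) (q : P ⟶ Y)
    (h : ∀ {U : C} (f : U ⟶ X) (g : U ⟶ Y), ∃! l : U ⟶ P, l ≫ p = f ∧ l ≫ q = g) :
    IsLimit (BinaryFan.mk p q) :=
  BinaryFan.IsLimit.mk _ (fun f g => (h f g).choose) (fun f g => (h f g).choose_spec.1.1)
    (fun f g => (h f g).choose_spec.1.2)
    (fun f g m hf hg => (h f g).choose_spec.2 m ⟨hf, hg⟩)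

/-- Given a terminal object and products of pairs of objects, a functor to sets preserves finite
products if and only if it preserves these. -/
theorem preservesFiniteProducts_iff_of_isLimit {t : C} (ht : IsTerminal t) (s : C → C → C)
    (p : ∀ X Y, s X Y ⟶ X) (q : ∀ X Y, s X Y ⟶ Y)
    (h : ∀ X Y, IsLimit (BinaryFan.mk (p X Y) (q X Y))) (F : C ⥤ Type v) :
    PreservesFiniteProducts F ↔
      Nonempty (Unique (F.obj t)) ∧
        ∀ X Y, Function.Bijective fun z : F.obj (s X Y) => (F.map (p X Y) z, F.map (q X Y) z) := by
  constructor
  · intro hF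
    refine ⟨⟨Types.isTerminalEquivUnique _ (ht.isTerminalObj F)⟩, fun X Y => ?_⟩
    have l := mapIsLimitOfPreservesOfIsLimit F _ _ (h X Y)
    let e := (l.conePointUniqueUpToIso (Types.binaryProductLimit _ _)).toEquiv
    have he : (fun z : F.obj (s X Y) => (F.map (p X Y) z, F.map (q X Y) z)) = e := ?_
    · rw [he]
      exact e.bijective
    funext z
    refine Prod.ext ?_ ?_
    · exact (ConcreteCategory.congr_hom (l.conePointUniqueUpToIso_hom_comp
        (Types.binaryProductLimit _ _) ⟨WalkingPair.left⟩) z).symm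
    · exact (ConcreteCategory.congr_hom (l.conePointUniqueUpToIso_hom_comp
        (Types.binaryProductLimit _ _) ⟨WalkingPair.right⟩) z).symm
  · rintro ⟨⟨hu⟩, hb⟩
    have : HasTerminal C := ht.hasTerminal
    have : HasBinaryProducts C := by
      refine @hasBinaryProducts_of_hasLimit_pair C _ ?_
      intro X Y
      exact ⟨⟨_, h X Y⟩⟩
    have : HasFiniteProducts C := hasFiniteProducts_of_has_binary_and_terminal
    have : PreservesLimitsOfShape (Discrete.{0} PEmpty) F := by
      have : PreservesLimit (Functor.empty.{0} C) F :=
        preservesLimit_of_preserves_limit_cone ht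
          ((isLimitMapConeEmptyConeEquiv F t).symm ((Types.isTerminalEquivUnique _).symm hu))
      exact preservesLimitsOfShape_pempty_of_preservesTerminal F
    have : PreservesLimitsOfShape (Discrete WalkingPair) F := by
      refine ⟨fun {K} => ?_⟩
      have : PreservesLimit (pair (K.obj ⟨.left⟩) (K.obj ⟨.right⟩)) F := by
        refine preservesLimit_of_preserves_limit_cone (h _ _)
          ((isLimitMapConeBinaryFanEquiv F _ _).symm ?_)
        refine isLimitOfExistsUnique _ _ fun {U} f g => ?_
        let e := Equiv.ofBijective _ (hb (K.obj ⟨.left⟩) (K.obj ⟨.right⟩))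
        refine ⟨↾fun x => e.symm (f x, g x), ⟨?_, ?_⟩, ?_⟩
        · ext x
          exact congrArg Prod.fst (e.apply_symm_apply (f x, g x))
        · ext x
          exact congrArg Prod.snd (e.apply_symm_apply (f x, g x))
        · rintro l ⟨rfl, rfl⟩
          ext x
          exact (e.symm_apply_apply (l x)).symm
      exact preservesLimit_of_iso_diagram F (diagramIsoPair K).symm
    exact PreservesFiniteProducts.of_preserves_binary_and_terminal F

end GenericProducts

namespace SpanCat

open Limits FinGSet

variable {G : Type u} [Group G]

/-- The span `U ← A ⊔ A' → X ⊔ Y` obtained from `U ← A → X` and `U ← A' → Y`. -/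
def sumSpan {U X Y : FinGSet G} (ω : GSpan U X) (ω' : GSpan U Y) : GSpan U (X.sum Y) where
  A := ω.A.sum ω'.A
  p := sumElim ω.p ω'.p
  q := sumElim ((inl X Y).comp ω.q) ((inr X Y).comp ω'.q)

/-- `sumSpan` respects isomorphisms. -/
def sumSpanIso {U X Y : FinGSet G} {ω₁ ω₂ : GSpan U X} {ω₁' ω₂' : GSpan U Y}
    (e : ω₁.Iso ω₂) (e' : ω₁'.Iso ω₂') : (sumSpan ω₁ ω₁').Iso (sumSpan ω₂ ω₂') where
  α := Equiv.sumCongr e.α e'.α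
  α_smul := by
    rintro g (a | a)
    exacts [congrArg Sum.inl (e.α_smul g a), congrArg Sum.inr (e'.α_smul g a)]
  p_comm := by
    rintro (a | a)
    exacts [e.p_comm a, e'.p_comm a]
  q_comm := by
    rintro (a | a)
    exacts [congrArg Sum.inl (e.q_comm a), congrArg Sum.inr (e'.q_comm a)]

/-- The span `R_f`. -/
def spanR {X Y : FinGSet G} (f : X →[G] Y) : GSpan Y X := ⟨X, f, .id G⟩

theorem R_eq {X Y : FinGSet G} (f : X →[G] Y) : R f = mk (spanR f) := rfl

theorem exists_unique_lift {U X Y : FinGSet G} (f : of U ⟶ of X) (g : of U ⟶ of Y) :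
    ∃! l : of U ⟶ of (X.sum Y), l ≫ R (inl X Y) = f ∧ l ≫ R (inr X Y) = g := by
  obtain ⟨ω, rfl⟩ := exists_mk f
  obtain ⟨ω', rfl⟩ := exists_mk g
  refine ⟨mk (sumSpan ω ω'), ⟨?_, ?_⟩, ?_⟩
  · rw [R_eq, mk_comp]
    refine (mk_eq (GSpan.Iso.mk (Equiv.ofBijective
      (fun a => (⟨(Sum.inl a, ω.q a), rfl⟩ : ((sumSpan ω ω').comp (spanR (inl X Y))).A))
      ⟨fun a b h => ?_, ?_⟩) (fun _ _ => ?_) (fun _ => rfl) (fun _ => rfl))).symm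
    · exact Sum.inl_injective (congrArg (fun z => z.1.1) h)
    · rintro ⟨⟨a | a, x⟩, h⟩
      · obtain rfl : ω.q a = x := Sum.inl_injective h
        exact ⟨a, rfl⟩
      · exact (Sum.inr_ne_inl h).elim
    · exact Subtype.ext (Prod.ext rfl (map_smul ω.q _ _))
  · rw [R_eq, mk_comp]
    refine (mk_eq (GSpan.Iso.mk (Equiv.ofBijective
      (fun a => (⟨(Sum.inr a, ω'.q a), rfl⟩ : ((sumSpan ω ω').comp (spanR (inr X Y))).A))
      ⟨fun a b h => ?_, ?_⟩) (fun _ _ => ?_) (fun _ => rfl) (fun _ => rfl))).symm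
    · exact Sum.inr_injective (congrArg (fun z => z.1.1) h)
    · rintro ⟨⟨a | a, x⟩, h⟩
      · exact (Sum.inl_ne_inr h).elim
      · obtain rfl : ω'.q a = x := Sum.inr_injective h
        exact ⟨a, rfl⟩
    · exact Subtype.ext (Prod.ext rfl (map_smul ω'.q _ _))
  · rintro l ⟨h, h'⟩
    obtain ⟨θ, rfl⟩ := exists_mk l
    rw [R_eq, mk_comp] at h h'
    obtain ⟨e⟩ := Quotient.exact h
    obtain ⟨e'⟩ := Quotient.exact h'
    refine Eq.trans ?_ (mk_eq (sumSpanIso e e'))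
    refine (mk_eq (GSpan.Iso.mk (Equiv.ofBijective
      (fun a : (sumSpan (θ.comp (spanR (inl X Y))) (θ.comp (spanR (inr X Y)))).A =>
        Sum.elim (fun c => c.1.1) (fun c => c.1.1) a) ⟨?_, ?_⟩) ?_ ?_ ?_)).symm
    · rintro (⟨⟨a, x⟩, k⟩ | ⟨⟨a, x⟩, k⟩) (⟨⟨b, y⟩, k'⟩ | ⟨⟨b, y⟩, k'⟩) hab <;>
        obtain rfl : a = b := hab
      · obtain rfl : x = y := Sum.inl_injective (k.symm.trans k')
        rfl
      · exact (Sum.inl_ne_inr (k.symm.trans k')).elim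
      · exact (Sum.inr_ne_inl (k.symm.trans k')).elim
      · obtain rfl : x = y := Sum.inr_injective (k.symm.trans k')
        rfl
    · intro a
      rcases k : θ.q a with x | x
      · exact ⟨Sum.inl ⟨(a, x), k⟩, rfl⟩
      · exact ⟨Sum.inr ⟨(a, x), k⟩, rfl⟩
    · rintro g (a | a) <;> rfl
    · rintro (a | a) <;> rfl
    · rintro (⟨⟨a, x⟩, k⟩ | ⟨⟨a, x⟩, k⟩)
      exacts [k, k]

/-- The disjoint union `X ⊔ Y` with the restrictions along the inclusions is the product of
`X` and `Y` in the category of spans. -/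
noncomputable def isLimitSum (X Y : FinGSet G) :
    IsLimit (BinaryFan.mk (R (inl X Y)) (R (inr X Y))) :=
  isLimitOfExistsUnique _ _ fun f g => exists_unique_lift f g

/-- The empty `G`-set is terminal in the category of spans. -/
noncomputable def isTerminalEmpty : IsTerminal (of (empty G)) := by
  refine IsTerminal.ofUniqueHom (fun X => mk ⟨empty G, fromEmpty X, .id G⟩) fun X m => ?_
  obtain ⟨ω, rfl⟩ := exists_mk m
  have : IsEmpty ω.A := ⟨fun a => (ω.q a).elim⟩
  exact mk_eq ⟨Equiv.equivOfIsEmpty _ _, fun _ a => isEmptyElim a, fun a => isEmptyElim a,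
    fun a => isEmptyElim a⟩

/-- A functor on the category of spans preserves finite products if and only if it takes
the empty set to a point, and disjoint unions to products. -/
theorem preservesFiniteProducts_iff (F : SpanCat G ⥤ Type v) :
    PreservesFiniteProducts F ↔
      Nonempty (Unique (F.obj (of (empty G)))) ∧
        ∀ X Y : FinGSet G, Function.Bijective fun z : F.obj (of (X.sum Y)) =>
          (F.map (R (inl X Y)) z, F.map (R (inr X Y)) z) :=
  preservesFiniteProducts_iff_of_isLimit isTerminalEmpty (fun X Y => of (X.sum Y))
    (fun X Y => R (inl X Y)) (fun X Y => R (inr X Y)) (fun X Y => isLimitSum X Y) F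

end SpanCat

namespace BispanCat

open Limits FinGSet

variable {G : Type u} [Group G]

/-- The bispan `R_f`. -/
def bispanR {X Y : FinGSet G} (f : X →[G] Y) : Bispan Y X := ⟨X, X, f, .id G, .id G⟩

theorem R_eq {X Y : FinGSet G} (f : X →[G] Y) : R f = mk (bispanR f) := rfl

/-- The base change of a bispan `U ← A → B → Z` along a map `f : X → Z`. -/
def pullback {U X Z : FinGSet G} (ω : Bispan U Z) (f : X →[G] Z) : Bispan U X where
  A := (ω.A.prod X).sub (fun a => ω.r (ω.q a.1) = f a.2) (fun g _ h => by simp [h])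
  B := (ω.B.prod X).sub (fun a => ω.r a.1 = f a.2) (fun g _ h => by simp [h])
  p := ⟨fun a => ω.p a.1.1, fun g a => map_smul ω.p g a.1.1⟩
  q := ⟨fun a => ⟨(ω.q a.1.1, a.1.2), a.2⟩,
    fun g a => Subtype.ext (Prod.ext (map_smul ω.q g a.1.1) rfl)⟩
  r := ⟨fun a => a.1.2, fun _ _ => rfl⟩

/-- Composition with `R_f` is base change. -/
def compR {U X Z : FinGSet G} (ω : Bispan U Z) (f : X →[G] Z) :
    (ω.comp (bispanR f)).Iso (pullback ω f) where
  β :=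
    { toFun := fun x => ⟨(x.sec ⟨x.base, rfl⟩, x.base), x.r_sec ⟨x.base, rfl⟩⟩
      invFun := fun b => ⟨b.1.2, fun _ => b.1.1, fun x => by
        refine (FinGSet.sub_prop b).trans (congrArg f ?_)
        exact x.2.symm⟩
      left_inv := fun x => Bispan.PreSection.ext' rfl fun a _ hy =>
        Bispan.PreSection.sec_congr (x := x) (y := x) rfl (show x.base = a from hy.symm) rfl hy
      right_inv := fun _ => rfl }
  α :=
    { toFun := fun x => ⟨(x.1.1, x.1.2.1), by
        obtain ⟨h, h'⟩ := FinGSet.sub_prop x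
        exact (congrArg ω.r h').trans (x.1.2.2.r_sec _)⟩
      invFun := fun a => ⟨(a.1.1, a.1.2, ⟨a.1.2, fun _ => ω.q a.1.1, fun x => by
        refine (FinGSet.sub_prop a).trans (congrArg f ?_)
        exact x.2.symm⟩), rfl, rfl⟩
      left_inv := fun x => by
        obtain ⟨h, h'⟩ := FinGSet.sub_prop x
        refine Subtype.ext (Prod.ext rfl (Prod.ext rfl ?_))
        refine Bispan.PreSection.ext' h fun a hx hy => h'.trans ?_
        exact Bispan.PreSection.sec_congr rfl (h.trans hy.symm) _ _
      right_inv := fun _ => rfl }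
  α_smul _ _ := rfl
  β_smul g x := Subtype.ext (Prod.ext (Bispan.PreSection.smul_sec_smul g x x.base rfl rfl) rfl)
  p_comm _ := rfl
  q_comm x := by
    obtain ⟨h, h'⟩ := FinGSet.sub_prop x
    exact Subtype.ext (Prod.ext (h'.trans (Bispan.PreSection.sec_congr rfl h _ _)) h)
  r_comm _ := rfl

/-- The bispan `U ← A ⊔ A' → B ⊔ B' → X ⊔ Y` obtained from `U ← A → B → X` and
`U ← A' → B' → Y`. -/
def sumBispan {U X Y : FinGSet G} (ω : Bispan U X) (ω' : Bispan U Y) : Bispan U (X.sum Y) where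
  A := ω.A.sum ω'.A
  B := ω.B.sum ω'.B
  p := sumElim ω.p ω'.p
  q := sumElim ((inl _ _).comp ω.q) ((inr _ _).comp ω'.q)
  r := sumElim ((inl X Y).comp ω.r) ((inr X Y).comp ω'.r)

/-- `sumBispan` respects isomorphisms. -/
def sumBispanIso {U X Y : FinGSet G} {ω₁ ω₂ : Bispan U X} {ω₁' ω₂' : Bispan U Y}
    (e : ω₁.Iso ω₂) (e' : ω₁'.Iso ω₂') : (sumBispan ω₁ ω₁').Iso (sumBispan ω₂ ω₂') where
  α := Equiv.sumCongr e.α e'.α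
  β := Equiv.sumCongr e.β e'.β
  α_smul := by
    rintro g (a | a)
    exacts [congrArg Sum.inl (e.α_smul g a), congrArg Sum.inr (e'.α_smul g a)]
  β_smul := by
    rintro g (a | a)
    exacts [congrArg Sum.inl (e.β_smul g a), congrArg Sum.inr (e'.β_smul g a)]
  p_comm := by
    rintro (a | a)
    exacts [e.p_comm a, e'.p_comm a]
  q_comm := by
    rintro (a | a)
    exacts [congrArg Sum.inl (e.q_comm a), congrArg Sum.inr (e'.q_comm a)]
  r_comm := by
    rintro (a | a)
    exacts [congrArg Sum.inl (e.r_comm a), congrArg Sum.inr (e'.r_comm a)]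

theorem exists_unique_lift {U X Y : FinGSet G} (f : of U ⟶ of X) (g : of U ⟶ of Y) :
    ∃! l : of U ⟶ of (X.sum Y), l ≫ R (inl X Y) = f ∧ l ≫ R (inr X Y) = g := by
  obtain ⟨ω, rfl⟩ := exists_mk f
  obtain ⟨ω', rfl⟩ := exists_mk g
  refine ⟨mk (sumBispan ω ω'), ⟨?_, ?_⟩, ?_⟩
  · rw [R_eq, mk_comp, mk_eq (compR _ _)]
    refine (mk_eq (Bispan.Iso.mk
      (Equiv.ofBijective
        (fun a => (⟨(Sum.inl a, ω.r (ω.q a)), rfl⟩ : (pullback (sumBispan ω ω') (inl X Y)).A))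
        ⟨fun a b h => ?_, ?_⟩)
      (Equiv.ofBijective
        (fun a => (⟨(Sum.inl a, ω.r a), rfl⟩ : (pullback (sumBispan ω ω') (inl X Y)).B))
        ⟨fun a b h => ?_, ?_⟩)
      (fun g a => ?_) (fun g a => ?_) (fun _ => rfl) (fun _ => rfl) (fun _ => rfl))).symm
    · exact Sum.inl_injective (congrArg (fun z => z.1.1) h)
    · rintro ⟨⟨a | a, x⟩, h⟩
      · obtain rfl : ω.r (ω.q a) = x := Sum.inl_injective h
        exact ⟨a, rfl⟩
      · exact (Sum.inr_ne_inl h).elim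
    · exact Sum.inl_injective (congrArg (fun z => z.1.1) h)
    · rintro ⟨⟨a | a, x⟩, h⟩
      · obtain rfl : ω.r a = x := Sum.inl_injective h
        exact ⟨a, rfl⟩
      · exact (Sum.inr_ne_inl h).elim
    · exact Subtype.ext (Prod.ext rfl (map_smul (ω.r.comp ω.q) g a))
    · exact Subtype.ext (Prod.ext rfl (map_smul ω.r g a))
  · rw [R_eq, mk_comp, mk_eq (compR _ _)]
    refine (mk_eq (Bispan.Iso.mk
      (Equiv.ofBijective
        (fun a => (⟨(Sum.inr a, ω'.r (ω'.q a)), rfl⟩ : (pullback (sumBispan ω ω') (inr X Y)).A))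
        ⟨fun a b h => ?_, ?_⟩)
      (Equiv.ofBijective
        (fun a => (⟨(Sum.inr a, ω'.r a), rfl⟩ : (pullback (sumBispan ω ω') (inr X Y)).B))
        ⟨fun a b h => ?_, ?_⟩)
      (fun g a => ?_) (fun g a => ?_) (fun _ => rfl) (fun _ => rfl) (fun _ => rfl))).symm
    · exact Sum.inr_injective (congrArg (fun z => z.1.1) h)
    · rintro ⟨⟨a | a, x⟩, h⟩
      · exact (Sum.inl_ne_inr h).elim
      · obtain rfl : ω'.r (ω'.q a) = x := Sum.inr_injective h
        exact ⟨a, rfl⟩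
    · exact Sum.inr_injective (congrArg (fun z => z.1.1) h)
    · rintro ⟨⟨a | a, x⟩, h⟩
      · exact (Sum.inl_ne_inr h).elim
      · obtain rfl : ω'.r a = x := Sum.inr_injective h
        exact ⟨a, rfl⟩
    · exact Subtype.ext (Prod.ext rfl (map_smul (ω'.r.comp ω'.q) g a))
    · exact Subtype.ext (Prod.ext rfl (map_smul ω'.r g a))
  · rintro l ⟨h, h'⟩
    obtain ⟨θ, rfl⟩ := exists_mk l
    rw [R_eq, mk_comp, mk_eq (compR _ _)] at h h'
    obtain ⟨e⟩ := Quotient.exact h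
    obtain ⟨e'⟩ := Quotient.exact h'
    refine Eq.trans ?_ (mk_eq (sumBispanIso e e'))
    refine (mk_eq (Bispan.Iso.mk
      (Equiv.ofBijective
        (fun a : (sumBispan (pullback θ (inl X Y)) (pullback θ (inr X Y))).A =>
          Sum.elim (fun c => c.1.1) (fun c => c.1.1) a) ⟨?_, ?_⟩)
      (Equiv.ofBijective
        (fun a : (sumBispan (pullback θ (inl X Y)) (pullback θ (inr X Y))).B =>
          Sum.elim (fun c => c.1.1) (fun c => c.1.1) a) ⟨?_, ?_⟩) ?_ ?_ ?_ ?_ ?_)).symm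
    · rintro (⟨⟨a, x⟩, k⟩ | ⟨⟨a, x⟩, k⟩) (⟨⟨b, y⟩, k'⟩ | ⟨⟨b, y⟩, k'⟩) hab <;>
        obtain rfl : a = b := hab
      · obtain rfl : x = y := Sum.inl_injective (k.symm.trans k')
        rfl
      · exact (Sum.inl_ne_inr (k.symm.trans k')).elim
      · exact (Sum.inr_ne_inl (k.symm.trans k')).elim
      · obtain rfl : x = y := Sum.inr_injective (k.symm.trans k')
        rfl
    · intro a
      rcases k : θ.r (θ.q a) with x | x
      · exact ⟨Sum.inl ⟨(a, x), k⟩, rfl⟩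
      · exact ⟨Sum.inr ⟨(a, x), k⟩, rfl⟩
    · rintro (⟨⟨a, x⟩, k⟩ | ⟨⟨a, x⟩, k⟩) (⟨⟨b, y⟩, k'⟩ | ⟨⟨b, y⟩, k'⟩) hab <;>
        obtain rfl : a = b := hab
      · obtain rfl : x = y := Sum.inl_injective (k.symm.trans k')
        rfl
      · exact (Sum.inl_ne_inr (k.symm.trans k')).elim
      · exact (Sum.inr_ne_inl (k.symm.trans k')).elim
      · obtain rfl : x = y := Sum.inr_injective (k.symm.trans k')
        rfl
    · intro a
      rcases k : θ.r a with x | x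
      · exact ⟨Sum.inl ⟨(a, x), k⟩, rfl⟩
      · exact ⟨Sum.inr ⟨(a, x), k⟩, rfl⟩
    · rintro g (a | a) <;> rfl
    · rintro g (a | a) <;> rfl
    · rintro (a | a) <;> rfl
    · rintro (a | a) <;> rfl
    · rintro (⟨⟨a, x⟩, k⟩ | ⟨⟨a, x⟩, k⟩)
      exacts [k, k]

/-- The disjoint union `X ⊔ Y` with the restrictions along the inclusions is the product of
`X` and `Y` in the category of bispans. -/
noncomputable def isLimitSum (X Y : FinGSet G) :
    IsLimit (BinaryFan.mk (R (inl X Y)) (R (inr X Y))) :=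
  isLimitOfExistsUnique _ _ fun f g => exists_unique_lift f g

/-- The empty `G`-set is terminal in the category of bispans. -/
noncomputable def isTerminalEmpty : IsTerminal (of (empty G)) := by
  refine IsTerminal.ofUniqueHom
    (fun X => mk ⟨empty G, empty G, fromEmpty X, .id G, .id G⟩) fun X m => ?_
  obtain ⟨ω, rfl⟩ := exists_mk m
  have : IsEmpty ω.B := ⟨fun a => (ω.r a).elim⟩
  have : IsEmpty ω.A := ⟨fun a => isEmptyElim (ω.q a)⟩
  exact mk_eq ⟨Equiv.equivOfIsEmpty _ _, Equiv.equivOfIsEmpty _ _, fun _ a => isEmptyElim a,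
    fun _ a => isEmptyElim a, fun a => isEmptyElim a, fun a => isEmptyElim a,
    fun a => isEmptyElim a⟩

/-- A functor on the category of bispans preserves finite products if and only if it takes
the empty set to a point, and disjoint unions to products. -/
theorem preservesFiniteProducts_iff (F : BispanCat G ⥤ Type v) :
    PreservesFiniteProducts F ↔
      Nonempty (Unique (F.obj (of (empty G)))) ∧
        ∀ X Y : FinGSet G, Function.Bijective fun z : F.obj (of (X.sum Y)) =>
          (F.map (R (inl X Y)) z, F.map (R (inr X Y)) z) :=
  preservesFiniteProducts_iff_of_isLimit isTerminalEmpty (fun X Y => of (X.sum Y))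
    (fun X Y => R (inl X Y)) (fun X Y => R (inr X Y)) (fun X Y => isLimitSum X Y) F

end BispanCat

/-! ### Relations between transfers and restrictions -/

namespace SpanCat

open FinGSet

variable {G : Type u} [Group G] {X Y Z W : FinGSet G}

theorem T_id : T (.id G : X →[G] X) = 𝟙 (of X) := rfl

theorem R_id : R (.id G : X →[G] X) = 𝟙 (of X) := rfl

/-- The span `T_f`. -/
def spanT (f : X →[G] Y) : GSpan X Y := ⟨X, .id G, f⟩

theorem mk_eq_R_T (ω : GSpan X Y) : mk ω = R ω.p ≫ T ω.q := by
  refine mk_eq (ω' := (spanR ω.p).comp (spanT ω.q)) ⟨⟨fun a => ⟨(a, a), rfl⟩, fun a => a.1.1, fun _ => rfl, fun a => ?_⟩,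
    fun _ _ => rfl, fun _ => rfl, fun _ => rfl⟩
  exact Subtype.ext (Prod.ext rfl a.2)

theorem T_comp (f : X →[G] Y) (h : Y →[G] Z) : T f ≫ T h = T (h.comp f) := by
  refine (mk_eq (ω := spanT (h.comp f)) (ω' := (spanT f).comp (spanT h)) ⟨⟨fun a => ⟨(a, f a), rfl⟩, fun a => a.1.1, fun _ => rfl, fun a => ?_⟩,
    fun _ _ => ?_, fun _ => rfl, fun _ => rfl⟩).symm
  · exact Subtype.ext (Prod.ext rfl a.2)
  · exact Subtype.ext (Prod.ext rfl (map_smul f _ _))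

theorem R_comp (f : X →[G] Y) (h : Y →[G] Z) : R h ≫ R f = R (h.comp f) := by
  refine (mk_eq (ω := spanR (h.comp f)) (ω' := (spanR h).comp (spanR f)) ⟨⟨fun a => ⟨(f a, a), rfl⟩, fun a => a.1.2, fun _ => rfl, fun a => ?_⟩,
    fun _ _ => ?_, fun _ => rfl, fun _ => rfl⟩).symm
  · exact Subtype.ext (Prod.ext (FinGSet.sub_prop a).symm rfl)
  · exact Subtype.ext (Prod.ext (map_smul f _ _) rfl)

/-- For a cartesian square with `h f = k g`, one has `R_k T_h = T_g R_f`. -/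
theorem T_R_of_cartesian (f : W →[G] X) (g : W →[G] Y) (h : X →[G] Z) (k : Y →[G] Z)
    (comm : ∀ w, h (f w) = k (g w)) (cart : ∀ x y, h x = k y → ∃! w, f w = x ∧ g w = y) :
    T h ≫ R k = R f ≫ T g := by
  rw [← mk_eq_R_T ⟨W, f, g⟩]
  refine (mk_eq (ω := ⟨W, f, g⟩) (ω' := (spanT h).comp (spanR k)) ⟨Equiv.ofBijective (fun w => ⟨(f w, g w), comm w⟩) ⟨fun w w' e => ?_, ?_⟩,
    fun _ _ => ?_, fun _ => rfl, fun _ => rfl⟩).symm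
  · have e₁ : f w = f w' := congrArg (fun z => z.1.1) e
    have e₂ : g w = g w' := congrArg (fun z => z.1.2) e
    exact (cart _ _ (comm w')).unique ⟨e₁, e₂⟩ ⟨rfl, rfl⟩
  · rintro ⟨⟨x, y⟩, hxy⟩
    obtain ⟨w, ⟨rfl, rfl⟩, -⟩ := cart x y hxy
    exact ⟨w, rfl⟩
  · exact Subtype.ext (Prod.ext (map_smul f _ _) (map_smul g _ _))

/-- For an equivariant bijection `f` with inverse `g` one has `T_f = R_g`. -/
theorem T_eq_R (f : X →[G] Y) (g : Y →[G] X) (h : ∀ x, g (f x) = x) (h' : ∀ y, f (g y) = y) :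
    T f = R g :=
  (mk_eq (ω := spanR g) (ω' := spanT f) ⟨⟨g, f, h', h⟩, map_smul g, fun _ => rfl, h'⟩).symm

end SpanCat

/-! ### The categories of spans and of bispans -/

namespace GSpan

variable {G : Type u} [Group G] {X Y Z : FinGSet G}

/-- The bispan `X ← A = A → Y` attached to a span `X ← A → Y`. -/
def toBispanT (ω : GSpan X Y) : Bispan X Y := ⟨ω.A, ω.A, ω.p, .id G, ω.q⟩

/-- The bispan `X ← A → Y = Y` attached to a span `X ← A → Y`. -/
def toBispanN (ω : GSpan X Y) : Bispan X Y := ⟨ω.A, Y, ω.p, ω.q, .id G⟩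

/-- `toBispanT` is compatible with composition. -/
def toBispanTComp (ω₀ : GSpan X Y) (ω₁ : GSpan Y Z) :
    (ω₀.comp ω₁).toBispanT.Iso (ω₀.toBispanT.comp ω₁.toBispanT) where
  β :=
    { toFun := fun a => ⟨a.1.2, fun _ => a.1.1, fun x =>
        (FinGSet.sub_prop a).trans (congrArg ω₁.p x.2.symm)⟩
      invFun := fun x => ⟨(x.sec ⟨x.base, rfl⟩, x.base), x.r_sec _⟩
      left_inv := fun _ => rfl
      right_inv := fun x => Bispan.PreSection.ext' rfl fun a _ hy =>
        Bispan.PreSection.sec_congr (x := x) (y := x) rfl (show x.base = a from hy.symm) rfl hy }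
  α :=
    { toFun := fun a => ⟨(a.1.1, a.1.2, ⟨a.1.2, fun _ => a.1.1, fun x =>
        (FinGSet.sub_prop a).trans (congrArg ω₁.p x.2.symm)⟩), rfl, rfl⟩
      invFun := fun x => ⟨(x.1.1, x.1.2.1), by
        obtain ⟨h, h'⟩ := FinGSet.sub_prop x
        exact (congrArg ω₀.q h').trans (x.1.2.2.r_sec _)⟩
      left_inv := fun _ => rfl
      right_inv := fun x => by
        obtain ⟨h, h'⟩ := FinGSet.sub_prop x
        refine Subtype.ext (Prod.ext rfl (Prod.ext rfl ?_))
        refine Bispan.PreSection.ext' h fun a hx hy => h'.trans ?_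
        exact Bispan.PreSection.sec_congr rfl (h.trans hy.symm) _ _ }
  α_smul _ _ := rfl
  β_smul _ _ := rfl
  p_comm _ := rfl
  q_comm _ := rfl
  r_comm _ := rfl

/-- `toBispanN` is compatible with composition. -/
def toBispanNComp (ω₀ : GSpan X Y) (ω₁ : GSpan Y Z) :
    (ω₀.comp ω₁).toBispanN.Iso (ω₀.toBispanN.comp ω₁.toBispanN) where
  β :=
    { toFun := fun z => ⟨z, fun x => ω₁.p x.1, fun _ => rfl⟩
      invFun := fun x => x.base
      left_inv := fun _ => rfl
      right_inv := fun x => Bispan.PreSection.ext' rfl fun a _ hy => (x.r_sec ⟨a, hy⟩).symm }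
  α :=
    { toFun := fun a => ⟨(a.1.1, a.1.2, ⟨ω₁.q a.1.2, fun x => ω₁.p x.1, fun _ => rfl⟩), rfl, a.2⟩
      invFun := fun x => ⟨(x.1.1, x.1.2.1), by
        obtain ⟨h, h'⟩ := FinGSet.sub_prop x
        exact h'.trans (x.1.2.2.r_sec ⟨_, h⟩)⟩
      left_inv := fun _ => rfl
      right_inv := fun x => by
        obtain ⟨h, h'⟩ := FinGSet.sub_prop x
        refine Subtype.ext (Prod.ext rfl (Prod.ext rfl ?_))
        exact Bispan.PreSection.ext' h fun a _ hy => (x.1.2.2.r_sec ⟨a, hy⟩).symm }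
  α_smul g a := Subtype.ext (Prod.ext rfl (Prod.ext rfl
    (Bispan.PreSection.ext' (map_smul ω₁.q g a.1.2) fun x hx hy =>
      ((congrArg (g • ·) (map_smul ω₁.p g⁻¹ x)).trans (smul_inv_smul g _)).symm)))
  β_smul g z := Bispan.PreSection.ext' rfl fun x hx hy =>
    ((congrArg (g • ·) (map_smul ω₁.p g⁻¹ x)).trans (smul_inv_smul g _)).symm
  p_comm _ := rfl
  q_comm _ := rfl
  r_comm _ := rfl

end GSpan

namespace SpanCat

variable {G : Type u} [Group G]

/-- The functor from spans to bispans that is the identity on objects, with `T_f ↦ T_f` and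
`R_f ↦ R_f`. -/
def toBispanT (G : Type u) [Group G] : SpanCat G ⥤ BispanCat G where
  obj X := X
  map {X Y} f := Quotient.map (sa := GSpan.setoid (G := G) X Y)
    (sb := Bispan.setoid (G := G) X Y) GSpan.toBispanT
    (fun _ _ ⟨e⟩ => ⟨⟨e.α, e.α, e.α_smul, e.α_smul, e.p_comm, fun _ => rfl, e.q_comm⟩⟩) f
  map_id _ := rfl
  map_comp := by
    rintro X Y Z ⟨ω₀⟩ ⟨ω₁⟩
    exact Quotient.sound ⟨GSpan.toBispanTComp ω₀ ω₁⟩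

/-- The functor from spans to bispans that is the identity on objects, with `T_f ↦ N_f` and
`R_f ↦ R_f`. -/
def toBispanN (G : Type u) [Group G] : SpanCat G ⥤ BispanCat G where
  obj X := X
  map {X Y} f := Quotient.map (sa := GSpan.setoid (G := G) X Y)
    (sb := Bispan.setoid (G := G) X Y) GSpan.toBispanN
    (fun _ _ ⟨e⟩ => ⟨⟨e.α, .refl _, e.α_smul, fun _ _ => rfl, e.p_comm, e.q_comm,
      fun _ => rfl⟩⟩) f
  map_id _ := rfl
  map_comp := by
    rintro X Y Z ⟨ω₀⟩ ⟨ω₁⟩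
    exact Quotient.sound ⟨GSpan.toBispanNComp ω₀ ω₁⟩

end SpanCat

/-! ### Mackey functors -/

/-- A Mackey functor: a product-preserving functor from the category of spans to sets. -/
structure MackeyFunctor (G : Type u) [Group G] : Type (max (u + 1) (v + 1)) where
  toFunctor : SpanCat G ⥤ Type v
  preservesFiniteProducts : Limits.PreservesFiniteProducts toFunctor

namespace MackeyFunctor

open FinGSet

variable {G : Type u} [Group G] (M : MackeyFunctor.{u, v} G) {X Y Z : FinGSet G}

/-- The value of a Mackey functor at a finite `G`-set. -/
abbrev obj (X : FinGSet G) : Type v := M.toFunctor.obj (SpanCat.of X)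

/-- The transfer `T_f : M(X) → M(Y)`. -/
def T (f : X →[G] Y) : M.obj X → M.obj Y := fun a => M.toFunctor.map (SpanCat.T f) a

/-- The restriction `R_f : M(Y) → M(X)`. -/
def R (f : X →[G] Y) : M.obj Y → M.obj X := fun a => M.toFunctor.map (SpanCat.R f) a

theorem bijective_R_R (X Y : FinGSet G) : Function.Bijective fun z : M.obj (X.sum Y) =>
    (M.R (inl X Y) z, M.R (inr X Y) z) :=
  ((SpanCat.preservesFiniteProducts_iff _).1 M.preservesFiniteProducts).2 X Y

/-- The canonical bijection `M(X ⊔ Y) ≃ M(X) × M(Y)`. -/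
noncomputable def sumEquiv (X Y : FinGSet G) : M.obj (X.sum Y) ≃ M.obj X × M.obj Y :=
  Equiv.ofBijective _ (M.bijective_R_R X Y)

/-- The unique element of `M(∅)`. -/
noncomputable def point : M.obj (empty G) :=
  ((SpanCat.preservesFiniteProducts_iff _).1 M.preservesFiniteProducts).1.some.default

theorem eq_point (a : M.obj (empty G)) : a = M.point :=
  ((SpanCat.preservesFiniteProducts_iff _).1 M.preservesFiniteProducts).1.some.uniq a

/-- The sum `a + b = T_s(a, b)` in `M(X)`, for the fold map `s : X ⊔ X → X`. -/
noncomputable def add (a b : M.obj X) : M.obj X := M.T (fold X) ((M.sumEquiv X X).symm (a, b))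

/-- The zero element `T_z(*)` of `M(X)`, for the map `z : ∅ → X`. -/
noncomputable def zero (X : FinGSet G) : M.obj X := M.T (fromEmpty X) M.point

theorem R_inl_symm (a : M.obj X) (b : M.obj Y) :
    M.R (inl X Y) ((M.sumEquiv X Y).symm (a, b)) = a :=
  congrArg Prod.fst ((M.sumEquiv X Y).apply_symm_apply (a, b))

theorem R_inr_symm (a : M.obj X) (b : M.obj Y) :
    M.R (inr X Y) ((M.sumEquiv X Y).symm (a, b)) = b :=
  congrArg Prod.snd ((M.sumEquiv X Y).apply_symm_apply (a, b))

theorem sum_ext {x y : M.obj (X.sum Y)} (h : M.R (inl X Y) x = M.R (inl X Y) y)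
    (h' : M.R (inr X Y) x = M.R (inr X Y) y) : x = y :=
  (M.bijective_R_R X Y).1 (Prod.ext h h')

theorem T_T (f : X →[G] Y) (h : Y →[G] Z) (a : M.obj X) : M.T h (M.T f a) = M.T (h.comp f) a := by
  simp only [T, ← SpanCat.T_comp, M.toFunctor.map_comp]
  rfl

theorem R_R (f : X →[G] Y) (h : Y →[G] Z) (a : M.obj Z) : M.R f (M.R h a) = M.R (h.comp f) a := by
  simp only [R, ← SpanCat.R_comp, M.toFunctor.map_comp]
  rfl

theorem T_id (a : M.obj X) : M.T (.id G) a = a := by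
  simp only [T, SpanCat.T_id, M.toFunctor.map_id]
  rfl

theorem R_id (a : M.obj X) : M.R (.id G) a = a := by
  simp only [R, SpanCat.R_id, M.toFunctor.map_id]
  rfl

theorem R_T {W : FinGSet G} (f : W →[G] X) (g : W →[G] Y) (h : X →[G] Z) (k : Y →[G] Z)
    (comm : ∀ w, h (f w) = k (g w)) (cart : ∀ x y, h x = k y → ∃! w, f w = x ∧ g w = y)
    (a : M.obj X) : M.R k (M.T h a) = M.T g (M.R f a) := by
  have := ConcreteCategory.congr_hom
    (congrArg M.toFunctor.map (SpanCat.T_R_of_cartesian f g h k comm cart)) a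
  simp only [M.toFunctor.map_comp] at this
  exact this

theorem T_eq_R (f : X →[G] Y) (g : Y →[G] X) (h : ∀ x, g (f x) = x) (h' : ∀ y, f (g y) = y)
    (a : M.obj X) : M.T f a = M.R g a := by
  simp only [T, R, SpanCat.T_eq_R f g h h']

theorem zero_add (a : M.obj X) : M.add (M.zero X) a = a := by
  have key : (M.sumEquiv X X).symm (M.zero X, a) = M.T (inr X X) a := by
    apply M.sum_ext
    · rw [R_inl_symm, M.R_T (fromEmpty X) (fromEmpty X) (inr X X) (inl X X) (fun w => w.elim)
        (fun x y h => (Sum.inr_ne_inl h).elim), M.eq_point (M.R _ a)]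
      rfl
    · rw [R_inr_symm, M.R_T (.id G) (.id G) (inr X X) (inr X X) (fun w => rfl)
        (fun x y h => ⟨x, ⟨rfl, Sum.inr_injective h⟩, fun w hw => hw.1⟩), R_id, T_id]
  rw [add, key, T_T]
  exact M.T_id a

/-- The map exchanging the two summands of `X ⊔ X`. -/
def swap (X : FinGSet G) : X.sum X →[G] X.sum X := sumElim (inr X X) (inl X X)

theorem add_comm (a b : M.obj X) : M.add a b = M.add b a := by
  have hs : ∀ x, swap X (swap X x) = x := by rintro (x | x) <;> rfl
  have key : (M.sumEquiv X X).symm (a, b) = M.T (swap X) ((M.sumEquiv X X).symm (b, a)) := by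
    rw [M.T_eq_R (swap X) (swap X) hs hs]
    apply M.sum_ext
    · rw [R_R, R_inl_symm]
      exact (M.R_inr_symm b a).symm
    · rw [R_R, R_inr_symm]
      exact (M.R_inl_symm b a).symm
  rw [add, key, T_T, add]
  congr 1
  ext (x | x) <;> rfl

/-- The map `f ⊔ h` of disjoint unions. -/
def sumMap {X' Y' : FinGSet G} (f : X →[G] X') (h : Y →[G] Y') : X.sum Y →[G] X'.sum Y' :=
  sumElim ((inl X' Y').comp f) ((inr X' Y').comp h)

theorem T_sumMap {X' Y' : FinGSet G} (f : X →[G] X') (h : Y →[G] Y') (a : M.obj X) (b : M.obj Y) :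
    M.T (sumMap f h) ((M.sumEquiv X Y).symm (a, b)) =
      (M.sumEquiv X' Y').symm (M.T f a, M.T h b) := by
  apply M.sum_ext
  · rw [R_inl_symm, M.R_T (inl X Y) f (sumMap f h) (inl X' Y') (fun _ => rfl), R_inl_symm]
    rintro (x | x) y hxy
    · exact ⟨x, ⟨rfl, Sum.inl_injective hxy⟩, fun w hw => Sum.inl_injective hw.1⟩
    · exact (Sum.inr_ne_inl hxy).elim
  · rw [R_inr_symm, M.R_T (inr X Y) h (sumMap f h) (inr X' Y') (fun _ => rfl), R_inr_symm]
    rintro (x | x) y hxy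
    · exact (Sum.inl_ne_inr hxy).elim
    · exact ⟨x, ⟨rfl, Sum.inr_injective hxy⟩, fun w hw => Sum.inr_injective hw.1⟩

/-- The reassociation map `(X ⊔ X) ⊔ X → X ⊔ (X ⊔ X)`. -/
def sumAssoc (X : FinGSet G) : (X.sum X).sum X →[G] X.sum (X.sum X) :=
  sumElim (sumElim (inl _ _) ((inr X (X.sum X)).comp (inl _ _)))
    ((inr X (X.sum X)).comp (inr _ _))

/-- The inverse of `sumAssoc`. -/
def sumAssocInv (X : FinGSet G) : X.sum (X.sum X) →[G] (X.sum X).sum X :=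
  sumElim ((inl (X.sum X) X).comp (inl _ _))
    (sumElim ((inl (X.sum X) X).comp (inr _ _)) (inr _ _))

theorem add_assoc (a b c : M.obj X) : M.add (M.add a b) c = M.add a (M.add b c) := by
  have h₁ : M.add (M.add a b) c = M.T (fold X) (M.T (sumMap (fold X) (.id G))
      ((M.sumEquiv _ _).symm ((M.sumEquiv X X).symm (a, b), c))) := by
    rw [T_sumMap, T_id, add, add]
  have h₂ : M.add a (M.add b c) = M.T (fold X) (M.T (sumMap (.id G) (fold X))
      ((M.sumEquiv _ _).symm (a, (M.sumEquiv X X).symm (b, c)))) := by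
    rw [T_sumMap, T_id, add, add]
  have key : (M.sumEquiv _ _).symm (a, (M.sumEquiv X X).symm (b, c)) =
      M.T (sumAssoc X) ((M.sumEquiv _ _).symm ((M.sumEquiv X X).symm (a, b), c)) := by
    rw [M.T_eq_R (sumAssoc X) (sumAssocInv X) (by rintro ((x | x) | x) <;> rfl)
      (by rintro (x | (x | x)) <;> rfl)]
    apply M.sum_ext
    · rw [R_inl_symm, R_R, show (sumAssocInv X).comp (inl X (X.sum X)) =
        (inl (X.sum X) X).comp (inl X X) from rfl, ← R_R, R_inl_symm, R_inl_symm]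
    · rw [R_inr_symm]
      apply M.sum_ext
      · rw [R_inl_symm, R_R, R_R, show (sumAssocInv X).comp ((inr X (X.sum X)).comp (inl X X)) =
          (inl (X.sum X) X).comp (inr X X) from rfl, ← R_R, R_inl_symm, R_inr_symm]
      · rw [R_inr_symm, R_R, R_R, show (sumAssocInv X).comp ((inr X (X.sum X)).comp (inr X X)) =
          inr (X.sum X) X from rfl, R_inr_symm]
  rw [h₁, h₂, key, T_T, T_T, T_T]
  congr 1
  ext ((x | x) | x) <;> rfl

noncomputable instance (X : FinGSet G) : Add (M.obj X) := ⟨M.add⟩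

noncomputable instance (X : FinGSet G) : Zero (M.obj X) := ⟨M.zero X⟩

/-- The commutative monoid structure on `M(X)`. -/
noncomputable instance (X : FinGSet G) : AddCommMonoid (M.obj X) where
  nsmul := nsmulRec
  add_assoc := M.add_assoc
  zero_add := M.zero_add
  add_zero a := (M.add_comm a _).trans (M.zero_add a)
  add_comm := M.add_comm

end MackeyFunctor

/-! ### Tambara functors -/

/-- A Tambara functor: a product-preserving functor from the category of bispans to sets. -/
structure TambaraFunctor (G : Type u) [Group G] : Type (max (u + 1) (v + 1)) where
  toFunctor : BispanCat G ⥤ Type v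
  preservesFiniteProducts : Limits.PreservesFiniteProducts toFunctor

namespace TambaraFunctor

open FinGSet

variable {G : Type u} [Group G] (S : TambaraFunctor.{u, v} G) {X Y : FinGSet G}

/-- The value of a Tambara functor at a finite `G`-set. -/
abbrev obj (X : FinGSet G) : Type v := S.toFunctor.obj (BispanCat.of X)

/-- The transfer `T_f : S(X) → S(Y)`. -/
def T (f : X →[G] Y) : S.obj X → S.obj Y := fun a => S.toFunctor.map (BispanCat.T f) a

/-- The norm `N_f : S(X) → S(Y)`. -/
def N (f : X →[G] Y) : S.obj X → S.obj Y := fun a => S.toFunctor.map (BispanCat.N f) a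

/-- The restriction `R_f : S(Y) → S(X)`. -/
def R (f : X →[G] Y) : S.obj Y → S.obj X := fun a => S.toFunctor.map (BispanCat.R f) a

/-- The underlying additive Mackey functor, with the operations `T_f` and `R_f`. -/
def additive : MackeyFunctor.{u, v} G where
  toFunctor := SpanCat.toBispanT G ⋙ S.toFunctor
  preservesFiniteProducts := (SpanCat.preservesFiniteProducts_iff _).2
    ((BispanCat.preservesFiniteProducts_iff _).1 S.preservesFiniteProducts)

/-- The underlying multiplicative Mackey functor, with the operations `N_f` and `R_f`. -/
def multiplicative : MackeyFunctor.{u, v} G where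
  toFunctor := SpanCat.toBispanN G ⋙ S.toFunctor
  preservesFiniteProducts := (SpanCat.preservesFiniteProducts_iff _).2
    ((BispanCat.preservesFiniteProducts_iff _).1 S.preservesFiniteProducts)

/-- The commutative monoid `(S(X), +)`: here `a + b = T_s(a, b)` for the fold map
`s : X ⊔ X → X`, and `0 = T_z(*)` for `z : ∅ → X`. -/
noncomputable instance (X : FinGSet G) : AddCommMonoid (S.obj X) :=
  inferInstanceAs (AddCommMonoid (S.additive.obj X))

/-- The product `a * b = N_s(a, b)` on `S(X)`, for the fold map `s : X ⊔ X → X`. -/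
noncomputable instance (X : FinGSet G) : Mul (S.obj X) := ⟨S.multiplicative.add⟩

/-- The unit `1 = N_z(*)` of `S(X)`, for the map `z : ∅ → X`. -/
noncomputable instance (X : FinGSet G) : One (S.obj X) := ⟨S.multiplicative.zero X⟩

/-- A Tambara functor is additively complete if all its values have additive inverses. -/
def IsAdditivelyComplete : Prop := ∀ (X : FinGSet G) (a : S.obj X), ∃ b : S.obj X, a + b = 0

end TambaraFunctor

/-- Morphisms of Mackey functors are natural transformations. -/
abbrev MackeyFunctor.Hom {G : Type u} [Group G] (M M' : MackeyFunctor.{u, v} G) :=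
  M.toFunctor ⟶ M'.toFunctor

/-- Morphisms of Tambara functors are natural transformations. -/
abbrev TambaraFunctor.Hom {G : Type u} [Group G] (S S' : TambaraFunctor.{u, v} G) :=
  S.toFunctor ⟶ S'.toFunctor

/-! ### The convolution product -/

namespace FinGSet

variable {G : Type u} [Group G] {X Y : FinGSet G} (f : X →[G] Y)

/-- `V(f) = {(y, C) | C ⊆ f⁻¹{y}}`. -/
def V : FinGSet G :=
  (Y.prod X.powerset).sub (fun z => ∀ x ∈ z.2, f x = z.1) (by
    rintro g ⟨y, C⟩ h _ ⟨x, hx, rfl⟩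
    exact (map_smul f g x).trans (congrArg (g • ·) (h x hx)))

/-- `V²(f) = {(y, C₁, C₂) | C₁, C₂ ⊆ f⁻¹{y}, C₁ ∩ C₂ = ∅}`. -/
def V₂ : FinGSet G :=
  (Y.prod (X.powerset.prod X.powerset)).sub
    (fun z => (∀ x ∈ z.2.1, f x = z.1) ∧ (∀ x ∈ z.2.2, f x = z.1) ∧ z.2.1 ∩ z.2.2 = ∅) (by
    rintro g ⟨y, C, D⟩ ⟨h, h', hCD⟩
    refine ⟨?_, ?_, ?_⟩
    · rintro _ ⟨x, hx, rfl⟩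
      exact (map_smul f g x).trans (congrArg (g • ·) (h x hx))
    · rintro _ ⟨x, hx, rfl⟩
      exact (map_smul f g x).trans (congrArg (g • ·) (h' x hx))
    · exact Set.smul_set_inter.symm.trans ((congrArg (g • ·) hCD).trans Set.smul_set_empty))

/-- `U(f) = {(x, C) | x ∈ C ⊆ f⁻¹{f x}}`. -/
def U : FinGSet G :=
  (X.prod X.powerset).sub (fun z => z.1 ∈ z.2 ∧ ∀ x ∈ z.2, f x = f z.1) (by
    rintro g ⟨y, C⟩ ⟨hy, h⟩
    refine ⟨Set.smul_mem_smul_set hy, ?_⟩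
    rintro _ ⟨x, hx, rfl⟩
    exact (map_smul f g x).trans ((congrArg (g • ·) (h x hx)).trans (map_smul f g y).symm))

/-- `p₁(y, C₁, C₂) = (y, C₁)`. -/
def p₁ : V₂ f →[G] V f :=
  ⟨fun z => ⟨(z.1.1, z.1.2.1), (FinGSet.sub_prop z).1⟩, fun _ _ => rfl⟩

/-- `p₂(y, C₁, C₂) = (y, C₂)`. -/
def p₂ : V₂ f →[G] V f :=
  ⟨fun z => ⟨(z.1.1, z.1.2.2), (FinGSet.sub_prop z).2.1⟩, fun _ _ => rfl⟩

/-- `p₁₂(y, C₁, C₂) = (y, C₁ ∪ C₂)`. -/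
def p₁₂ : V₂ f →[G] V f :=
  ⟨fun z => ⟨(z.1.1, (z.1.2.1 : Set X) ∪ z.1.2.2), by
    rintro x (hx | hx)
    exacts [(FinGSet.sub_prop z).1 x hx, (FinGSet.sub_prop z).2.1 x hx]⟩,
   fun _ _ => Subtype.ext (Prod.ext rfl Set.smul_set_union.symm)⟩

/-- `k(y) = (y, ∅)`. -/
def k : Y →[G] V f :=
  ⟨fun y => ⟨(y, (∅ : Set X)), fun _ hx => hx.elim⟩,
   fun _ _ => Subtype.ext (Prod.ext rfl Set.smul_set_empty.symm)⟩

/-- `j(y) = (y, f⁻¹{y})`. -/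
def j : Y →[G] V f :=
  ⟨fun y => ⟨(y, {x : X | f x = y}), fun _ hx => hx⟩,
   fun g y => Subtype.ext (Prod.ext rfl (Set.ext fun x => by
    refine Iff.trans ?_ Set.mem_smul_set_iff_inv_smul_mem.symm
    change f x = g • y ↔ f (g⁻¹ • x) = y
    rw [map_smul, inv_smul_eq_iff]))⟩

/-- `r(x, C) = x`. -/
def r : U f →[G] X := ⟨fun z => z.1.1, fun _ _ => rfl⟩

/-- `t(x, C) = (f x, C)`. -/
def t : U f →[G] V f :=
  ⟨fun z => ⟨(f z.1.1, z.1.2), (FinGSet.sub_prop z).2⟩,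
   fun g z => Subtype.ext (Prod.ext (map_smul f g z.1.1) rfl)⟩

end FinGSet

namespace TambaraFunctor

variable {G : Type u} [Group G] (S : TambaraFunctor.{u, v} G) {X Y : FinGSet G} (f : X →[G] Y)

/-- The convolution product `a ∨ b = T_{p₁₂}(R_{p₁}(a) R_{p₂}(b))` on `S(V(f))`. -/
noncomputable def conv (a b : S.obj (FinGSet.V f)) : S.obj (FinGSet.V f) :=
  S.T (FinGSet.p₁₂ f) (S.R (FinGSet.p₁ f) a * S.R (FinGSet.p₂ f) b)

/-- The unit `e = T_k(1)` for the convolution product on `S(V(f))`. -/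
noncomputable def convUnit : S.obj (FinGSet.V f) := S.T (FinGSet.k f) 1

/-- The map `χ = N_t R_r : S(X) → S(V(f))`. -/
def chi (a : S.obj X) : S.obj (FinGSet.V f) := S.N (FinGSet.t f) (S.R (FinGSet.r f) a)

/-- Given a morphism `η : S → S'`, the map `c : S'(X) → S'(V(f))` is a homomorphism from
`(S'(X), +)` to the monoid `{a | R_k(a) = 1}` under convolution, which extends `χ` in the sense
that `c η = η χ`. -/
structure IsChiExtension {S S' : TambaraFunctor.{u, v} G} (η : S.Hom S')
    (c : S'.obj X → S'.obj (FinGSet.V f)) : Prop where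
  map_zero : c 0 = S'.convUnit f
  map_add : ∀ a b, c (a + b) = S'.conv f (c a) (c b)
  restrict : ∀ a, S'.R (FinGSet.k f) (c a) = 1
  extends_chi : ∀ a : S.obj X, c (η.app X a) = η.app (FinGSet.V f) (S.chi f a)

end TambaraFunctor

/-- A map `f : A → B` of abelian groups is polynomial of degree at most `d` if all its iterated
differences `δ[a₁] ⋯ δ[aₙ] f` with `n > d` vanish, where `(δ[a] f)(x) = f(x + a) - f(x)`. -/
def IsPolynomialOfDegreeLE {A B : Type*} [AddCommGroup A] [AddCommGroup B] (d : ℕ) (f : A → B) :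
    Prop :=
  ∀ l : List A, d < l.length → l.foldr fwdDiff f = 0

/-!
A map from a commutative monoid `A` to an abelian group is polynomial of degree less than `n` if its
`n`-fold iterated differences vanish (`DegreeLT`). Polynomial maps behave well with respect to the
group completion `A → A⁺`: each extends to a polynomial map on `A⁺`
(`Algebra.GrothendieckAddGroup.exists_degreeLT`), and two polynomial maps on `A⁺` that agree on `A`
are equal (`Algebra.GrothendieckAddGroup.eq_of_degreeLT`). Moreover composites of polynomial maps
between abelian groups are polynomial (`DegreeLT.comp`).

Every operation of a Tambara functor `S` is polynomial. Indeed transfers and restrictions are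
additive, and for a norm the distributive law gives `N_f(a + b)` as a transfer of a product
over `V(f)`, the set of subsets `C` of fibres of `f`, of a norm of `a` over the points of `C` and a
norm of `b` over the points outside `C`. The part with `C = ∅` is `N_f(b)`, so the difference
`N_f(a + b) - N_f(b)` is the composite of two additive maps and of a norm along a map with smaller
fibres (`TambaraFunctor.N_add_eq_N_add`). Induction on the size of the fibres bounds the
degree (`TambaraFunctor.degreeLT_N`).

So all operations of `S` extend uniquely to polynomial maps between the groups `S(X)⁺`, and the
uniqueness of extensions makes these into a functor `S⁺` (`TambaraFunctor.completion`). In the same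
way, the additive extension of a morphism `S → T` to `S⁺` commutes with all operations when `T`
is additively complete, since both sides of each naturality square are polynomial
(`TambaraFunctor.existsUnique_completion_hom`). For Mackey functors all operations are additive and
no polynomial maps are needed.

The map `χ⁺` is the operation `χ` of the Tambara functor `S⁺` itself: the equations `χ(0) = e`,
`χ(a + b) = χ(a) ∨ χ(b)`, `R_k χ = 1` and `N_f = R_j χ` hold in all Tambara functors. It is unique
because `∨` is an associative and commutative product with unit `e`, so that `χ(a)` is invertible
with inverse `χ(-a)` (`TambaraFunctor.IsChiExtension.unique`).
-/

/-! ### Polynomial maps -/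

/-- A map `f : A → B` from a commutative monoid to an abelian group has degree less than `n` if
all its `n`-fold iterated differences vanish. The recursion takes one difference at a time, so
that degree less than `0` means `f = 0`. -/
def DegreeLT {A B : Type*} [AddCommMonoid A] [AddCommGroup B] : ℕ → (A → B) → Prop
  | 0, f => f = 0
  | n + 1, f => ∀ a, DegreeLT n (fwdDiff a f)

namespace DegreeLT

variable {A B C : Type*} [AddCommMonoid A] [AddCommGroup B] [AddCommGroup C]

theorem zero (n : ℕ) : DegreeLT n (0 : A → B) := by
  induction n with
  | zero => rfl
  | succ n ih =>
    intro a
    have : fwdDiff a (0 : A → B) = 0 := by funext x; simp [fwdDiff]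
    rwa [this]

theorem succ {n : ℕ} {f : A → B} (h : DegreeLT n f) : DegreeLT (n + 1) f := by
  induction n generalizing f with
  | zero =>
    obtain rfl : f = 0 := h
    exact zero 1
  | succ n ih => exact fun a => ih (h a)

theorem mono {m n : ℕ} (hmn : m ≤ n) {f : A → B} (h : DegreeLT m f) : DegreeLT n f := by
  induction hmn with
  | refl => exact h
  | step _ ih => exact ih.succ

theorem add {n : ℕ} {f g : A → B} (hf : DegreeLT n f) (hg : DegreeLT n g) :
    DegreeLT n (f + g) := by
  induction n generalizing f g with
  | zero =>
    obtain rfl : f = 0 := hf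
    obtain rfl : g = 0 := hg
    exact add_zero _
  | succ n ih =>
    intro a
    rw [fwdDiff_add]
    exact ih (hf a) (hg a)

/-- Postcomposition with a homomorphism does not raise the degree. -/
theorem hom_comp {n : ℕ} {f : A → B} (hf : DegreeLT n f) (h : B →+ C) :
    DegreeLT n (fun x => h (f x)) := by
  induction n generalizing f with
  | zero =>
    obtain rfl : f = 0 := hf
    funext x
    exact map_zero h
  | succ n ih =>
    intro a
    have : fwdDiff a (fun x => h (f x)) = fun x => h (fwdDiff a f x) := by
      funext x
      simp [fwdDiff]
    rw [this]
    exact ih (hf a)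

theorem neg {n : ℕ} {f : A → B} (hf : DegreeLT n f) : DegreeLT n (-f) :=
  hf.hom_comp (negAddMonoidHom : B →+ B)

theorem sub {n : ℕ} {f g : A → B} (hf : DegreeLT n f) (hg : DegreeLT n g) :
    DegreeLT n (f - g) := by
  rw [sub_eq_add_neg]
  exact hf.add hg.neg

/-- Precomposition with a homomorphism does not raise the degree. -/
theorem comp_hom {A' : Type*} [AddCommMonoid A'] {n : ℕ} {f : A → B} (hf : DegreeLT n f)
    (h : A' →+ A) : DegreeLT n (fun x => f (h x)) := by
  induction n generalizing f with
  | zero =>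
    obtain rfl : f = 0 := hf
    rfl
  | succ n ih =>
    intro a
    have : fwdDiff a (fun x => f (h x)) = fun x => fwdDiff (h a) f (h x) := by
      funext x
      simp [fwdDiff]
    rw [this]
    exact ih (hf (h a))

theorem translate {n : ℕ} {f : A → B} (hf : DegreeLT n f) (b : A) :
    DegreeLT n (fun x => f (x + b)) := by
  induction n generalizing f with
  | zero =>
    obtain rfl : f = 0 := hf
    rfl
  | succ n ih =>
    intro a
    have : fwdDiff a (fun x => f (x + b)) = fun x => fwdDiff a f (x + b) := by
      funext x
      simp [fwdDiff, add_right_comm]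
    rw [this]
    exact ih (hf a)

/-- A polynomial map, as a family of maps indexed by translations. -/
theorem shift {n : ℕ} {f : A → B} (hf : DegreeLT n f) :
    DegreeLT n (fun a x : A => f (x + a)) := by
  induction n generalizing f with
  | zero =>
    obtain rfl : f = 0 := hf
    rfl
  | succ n ih =>
    intro a
    have : fwdDiff a (fun a x : A => f (x + a)) = fun b x : A => fwdDiff a f (x + b) := by
      funext b x
      simp [fwdDiff, add_assoc]
    rw [this]
    exact ih (hf a)

theorem of_hom (h : A →+ B) : DegreeLT 2 h := by
  intro a b
  funext x
  simp [fwdDiff]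

/-- If the values `Φ x` are maps of bounded degree depending polynomially on `x`, then
`x ↦ Φ x (f x)` is polynomial for every polynomial `f`, with a bound for the degree that
depends only on those of `f`, of the values of `Φ`, and of `Φ`. For constant `Φ` this is the
statement on composites. The induction needs variable `Φ`, since a difference of `g ∘ f` involves
the differences of `g` in the directions `δ[a]f(x)`, and it needs all targets `C`, since the
translates of `Φ x` form a family with values in `B → C`. -/
theorem exists_eval {A B : Type v} [AddCommMonoid A] [AddCommGroup B] (d m n : ℕ) :
    ∀ (C : Type v) [AddCommGroup C], ∃ N, ∀ (f : A → B) (Φ : A → B → C), DegreeLT d f →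
      (∀ x, DegreeLT m (Φ x)) → DegreeLT n Φ → DegreeLT N fun x => Φ x (f x) := by
  induction d generalizing m n with
  | zero =>
    intro C _
    refine ⟨n, fun f Φ hf _ hΦ => ?_⟩
    obtain rfl : f = 0 := hf
    exact hΦ.hom_comp (Pi.evalAddMonoidHom (fun _ : B => C) 0)
  | succ d ihd =>
    induction m generalizing n with
    | zero =>
      intro C _
      refine ⟨0, fun f Φ _ hm _ => ?_⟩
      funext x
      exact congrFun (hm x) (f x)
    | succ m ihm =>
      induction n with
      | zero =>
        intro C _
        refine ⟨0, fun f Φ _ _ hΦ => ?_⟩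
        funext x
        exact congrFun (congrFun hΦ x) (f x)
      | succ n ihn =>
        intro C _
        obtain ⟨N₁, h₁⟩ := ihn C
        obtain ⟨N₂, h₂⟩ := ihd (m + 1) (n + 1) (B → C)
        obtain ⟨N₃, h₃⟩ := ihm (max N₂ (n + 1)) C
        refine ⟨max N₁ N₃ + 1, fun f Φ hf hm hΦ a => ?_⟩
        -- The difference splits into a change of `Φ`, which lowers `n`, and a change of the
        -- argument, which lowers `m`.
        have key : fwdDiff a (fun x => Φ x (f x)) =
            (fun x => fwdDiff a Φ x (f x)) +
              fun x => (fwdDiff (fwdDiff a f x) (Φ (x + a))) (f x) := by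
          funext x
          simp [fwdDiff]
        rw [key]
        refine add (mono (le_max_left _ _) (h₁ f _ hf (fun x => ?_) (hΦ a)))
          (mono (le_max_right _ _) (h₃ f _ hf (fun x => hm (x + a) _) ?_))
        · exact (hm (x + a)).sub (hm x)
        · have hΦ' : DegreeLT (n + 1) fun x (v b : B) => Φ (x + a) (b + v) :=
            (hΦ.translate a).hom_comp (AddMonoidHom.mk' (fun (φ : B → C) (v b : B) => φ (b + v))
              fun _ _ => rfl)
          exact sub (mono (le_max_left _ _) (h₂ _ _ (hf a) (fun x => (hm (x + a)).shift) hΦ'))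
            (mono (le_max_right _ _) (hΦ.translate a))

/-- A composite of polynomial maps is polynomial. -/
theorem comp {A B C : Type v} [AddCommMonoid A] [AddCommGroup B] [AddCommGroup C] {d e : ℕ}
    {f : A → B} {g : B → C} (hg : DegreeLT e g) (hf : DegreeLT d f) :
    ∃ n, DegreeLT n fun x => g (f x) := by
  obtain ⟨N, h⟩ := exists_eval (A := A) (B := B) d e 1 C
  refine ⟨N, h f (fun _ => g) hf (fun _ => hg) fun a => ?_⟩
  funext x
  simp [fwdDiff]

theorem fwdDiff_comm (a b : A) (f : A → B) :
    fwdDiff a (fwdDiff b f) = fwdDiff b (fwdDiff a f) := by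
  funext x
  simp only [fwdDiff, add_right_comm x a b]
  abel

theorem foldr_fwdDiff (l : List A) (a : A) (f : A → B) :
    l.foldr fwdDiff (fwdDiff a f) = fwdDiff a (l.foldr fwdDiff f) := by
  induction l with
  | nil => rfl
  | cons b l ih => rw [List.foldr_cons, List.foldr_cons, ih, fwdDiff_comm]

/-- A list of differences is taken in the opposite order to the recursion of `DegreeLT`; this does
not matter since differences commute. -/
theorem isPolynomialOfDegreeLE {A B : Type*} [AddCommGroup A] [AddCommGroup B] {d : ℕ}
    {f : A → B} (hf : DegreeLT (d + 1) f) : IsPolynomialOfDegreeLE d f := by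
  suffices h : ∀ (n : ℕ) (f : A → B), DegreeLT n f → ∀ l : List A, n ≤ l.length →
      l.foldr fwdDiff f = 0 from h _ _ hf
  intro n f hf l hl
  induction l generalizing n f with
  | nil =>
    obtain rfl : n = 0 := by simpa using hl
    exact hf
  | cons a l ih =>
    rw [List.foldr_cons, ← foldr_fwdDiff]
    cases n with
    | zero => exact ih 0 _ (hf.succ a) (Nat.zero_le _)
    | succ n => exact ih n _ (hf a) (by simpa using hl)

end DegreeLT

/-! ### Polynomial maps on group completions -/

namespace Algebra.GrothendieckAddGroup

variable {A B : Type*} [AddCommMonoid A] [AddCommGroup B]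

theorem exists_add_of (x : GrothendieckAddGroup A) : ∃ a b : A, x + of b = of a := by
  obtain ⟨⟨a, b⟩, h⟩ := (AddLocalization.addMonoidOf (⊤ : AddSubmonoid A)).surj x
  exact ⟨a, b, h⟩

theorem of_eq_of {a b : A} (h : (of a : GrothendieckAddGroup A) = of b) :
    ∃ c, c + a = c + b := by
  obtain ⟨c, hc⟩ := (AddLocalization.addMonoidOf (⊤ : AddSubmonoid A)).eq_iff_exists.1 h
  exact ⟨c, hc⟩

theorem hom_ext {F F' : GrothendieckAddGroup A →+ B} (h : ∀ a, F (of a) = F' (of a)) : F = F' :=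
  lift.symm.injective (AddMonoidHom.ext h)

theorem lift_of (f : A →+ B) (a : A) : lift f (of a) = f a :=
  DFunLike.congr_fun (lift.symm_apply_apply f) a

section Map

variable {A₁ A₂ A₃ : Type*} [AddCommMonoid A₁] [AddCommMonoid A₂] [AddCommMonoid A₃]

/-- The homomorphism of group completions induced by a homomorphism of commutative monoids. -/
noncomputable def mapHom (f : A₁ →+ A₂) : GrothendieckAddGroup A₁ →+ GrothendieckAddGroup A₂ :=
  lift (of.comp f)

theorem mapHom_of (f : A₁ →+ A₂) (a : A₁) : mapHom f (of a) = of (f a) :=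
  lift_of _ a

theorem mapHom_id (x : GrothendieckAddGroup A₁) : mapHom (.id A₁) x = x :=
  DFunLike.congr_fun (hom_ext (F' := .id _) fun a => mapHom_of _ a) x

theorem mapHom_mapHom (g : A₂ →+ A₃) (f : A₁ →+ A₂) (x : GrothendieckAddGroup A₁) :
    mapHom g (mapHom f x) = mapHom (g.comp f) x :=
  DFunLike.congr_fun (hom_ext (F := (mapHom g).comp (mapHom f)) (F' := mapHom (g.comp f))
    fun a => by
    rw [AddMonoidHom.comp_apply, mapHom_of, mapHom_of, mapHom_of, AddMonoidHom.comp_apply]) x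

theorem mapHom_add_mapHom (f g : A₁ →+ A₂) (x : GrothendieckAddGroup A₁) :
    mapHom f x + mapHom g x = mapHom (f + g) x :=
  DFunLike.congr_fun (hom_ext (F := mapHom f + mapHom g) (F' := mapHom (f + g)) fun a => by
    rw [AddMonoidHom.add_apply, mapHom_of, mapHom_of, mapHom_of, AddMonoidHom.add_apply, map_add]) x

theorem mapHom_zero (x : GrothendieckAddGroup A₁) : mapHom (0 : A₁ →+ A₂) x = 0 :=
  DFunLike.congr_fun (hom_ext (F := mapHom 0) (F' := 0) fun a =>
    (mapHom_of _ a).trans (map_zero of)) x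

/-- Group completion preserves products of two commutative monoids. -/
theorem bijective_mapHom (f : A₁ →+ A₂) (g : A₁ →+ A₃)
    (h : Function.Bijective fun a => (f a, g a)) :
    Function.Bijective fun x => (mapHom f x, mapHom g x) := by
  let e : A₁ ≃+ A₂ × A₃ := AddEquiv.ofBijective (f.prod g) h
  have he : ∀ z, f (e.symm z) = z.1 ∧ g (e.symm z) = z.2 := fun z =>
    Prod.ext_iff.1 (e.apply_symm_apply z)
  let i : A₂ →+ A₁ := e.symm.toAddMonoidHom.comp (.inl A₂ A₃)
  let j : A₃ →+ A₁ := e.symm.toAddMonoidHom.comp (.inr A₂ A₃)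
  have hfi : f.comp i = .id A₂ := AddMonoidHom.ext fun a => (he (a, 0)).1
  have hgi : g.comp i = 0 := AddMonoidHom.ext fun a => (he (a, 0)).2
  have hfj : f.comp j = 0 := AddMonoidHom.ext fun a => (he (0, a)).1
  have hgj : g.comp j = .id A₃ := AddMonoidHom.ext fun a => (he (0, a)).2
  have hij : i.comp f + j.comp g = .id A₁ := AddMonoidHom.ext fun a => by
    change e.symm (f a, 0) + e.symm (0, g a) = a
    rw [← map_add, Prod.mk_add_mk, add_zero, zero_add]
    exact e.symm_apply_apply a
  refine Function.bijective_iff_has_inverse.2 ⟨fun z => mapHom i z.1 + mapHom j z.2, fun x => ?_,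
    fun z => Prod.ext ?_ ?_⟩
  · change mapHom i (mapHom f x) + mapHom j (mapHom g x) = x
    rw [mapHom_mapHom, mapHom_mapHom, mapHom_add_mapHom, hij, mapHom_id]
  · change mapHom f (mapHom i z.1 + mapHom j z.2) = z.1
    rw [map_add, mapHom_mapHom, mapHom_mapHom, hfi, hfj, mapHom_id, mapHom_zero, add_zero]
  · change mapHom g (mapHom i z.1 + mapHom j z.2) = z.2
    rw [map_add, mapHom_mapHom, mapHom_mapHom, hgi, hgj, mapHom_id, mapHom_zero, zero_add]

end Map

/-- A polynomial map on a group completion is determined by its values on the monoid. -/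
theorem eq_zero_of_degreeLT {n : ℕ} {F : GrothendieckAddGroup A → B} (hF : DegreeLT n F)
    (h : ∀ a, F (of a) = 0) : F = 0 := by
  induction n generalizing F with
  | zero => exact hF
  | succ n ih =>
    -- By induction `F` is invariant under translation by elements of the monoid.
    have key : ∀ a, fwdDiff (of a) F = 0 := fun a =>
      ih (hF (of a)) fun b => by rw [fwdDiff, ← map_add, h, h, sub_zero]
    funext x
    obtain ⟨a, b, hab⟩ := exists_add_of x
    have := congrFun (key b) x
    rw [fwdDiff, hab, h, zero_sub] at this
    exact neg_eq_zero.1 this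

theorem eq_of_degreeLT {m n : ℕ} {F F' : GrothendieckAddGroup A → B} (hF : DegreeLT m F)
    (hF' : DegreeLT n F') (h : ∀ a, F (of a) = F' (of a)) : F = F' :=
  sub_eq_zero.1 (eq_zero_of_degreeLT
    ((hF.mono (le_max_left m n)).sub (hF'.mono (le_max_right m n)))
    fun a => sub_eq_zero.2 (h a))

/-- A polynomial map extends to the group completion. For the inductive step let `F a` be the
extension of the difference `δ[a]f`. The extension of `f` is then forced to take the value
`f a - F b x` at any `x` with `x + b = a`, and this value does not depend on the choice
of `a` and `b`. -/
theorem exists_degreeLT {n : ℕ} {f : A → B} (hf : DegreeLT n f) :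
    ∃ F : GrothendieckAddGroup A → B, DegreeLT n F ∧ ∀ a, F (of a) = f a := by
  induction n generalizing f with
  | zero =>
    obtain rfl : f = 0 := hf
    exact ⟨0, rfl, fun _ => rfl⟩
  | succ n ih =>
    choose D hD hDf using fun a => ih (hf a)
    -- The cocycle relation for differences passes to the extensions, by uniqueness.
    have hDadd : ∀ b c x, D (b + c) x = D b x + D c (x + of b) := by
      intro b c x
      have := eq_of_degreeLT (hD (b + c)) ((hD b).add ((hD c).translate (of b))) fun a => by
        simp only [Pi.add_apply, ← map_add, hDf, fwdDiff, ← add_assoc]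
        abel
      exact congrFun this x
    -- The completion map need not be injective, but `f` factors through it.
    have hcongr : ∀ a b, (of a : GrothendieckAddGroup A) = of b → f a = f b := by
      intro a b h
      obtain ⟨c, hc⟩ := of_eq_of h
      have h₁ := (hDf c a).symm.trans ((congrArg (D c) h).trans (hDf c b))
      simp only [fwdDiff, add_comm _ c, hc] at h₁
      exact sub_right_injective h₁
    choose num den hnd using exists_add_of (A := A)
    have hF : ∀ x a b, x + of b = of a → f (num x) - D (den x) x = f a - D b x := by
      have key : ∀ x a b a' b', x + of b = of a → x + of b' = of a' →
          f a - D b x = f (a + b') - D (b + b') x := by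
        intro x a b a' b' h h'
        rw [hDadd, h, hDf, fwdDiff]
        abel
      intro x a b h
      rw [key x _ _ a b (hnd x) h, key x a b _ _ h (hnd x), add_comm (den x) b]
      congr 1
      apply hcongr
      rw [map_add, map_add, ← h, ← hnd x]
      abel
    refine ⟨fun x => f (num x) - D (den x) x, ?_, fun a => ?_⟩
    · have hof : ∀ c, fwdDiff (of c) (fun x => f (num x) - D (den x) x) = D c := by
        intro c
        funext x
        obtain ⟨a, b, h⟩ := exists_add_of x
        have h' : x + of c + of b = of (a + c) := by rw [map_add, ← h]; abel
        rw [fwdDiff, hF _ _ _ h, hF _ _ _ h']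
        have h₁ := hDadd b c x
        rw [add_comm b c, hDadd c b x, h, hDf, fwdDiff] at h₁
        rw [show f (a + c) = f a + (f (a + c) - f a) by abel,
          show f (a + c) - f a = D c x + D b (x + of c) - D b x by rw [h₁]; abel]
        abel
      intro y
      obtain ⟨a, b, h⟩ := exists_add_of y
      have key : fwdDiff y (fun x => f (num x) - D (den x) x) =
          fun x => (D a - D b) (x + -of b) := by
        funext x
        rw [Pi.sub_apply, ← hof a, ← hof b]
        simp only [fwdDiff]
        rw [show x + -of b + of b = x by abel, show x + -of b + of a = x + y by rw [← h]; abel]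
        abel
      rw [key]
      exact ((hD a).sub (hD b)).translate _
    · have h₁ : (of a : GrothendieckAddGroup A) + of 0 = of a := by rw [map_zero, add_zero]
      have h₂ : D 0 (of a) = 0 := by rw [hDf, fwdDiff, add_zero, sub_self]
      change f (num (of a)) - D (den (of a)) (of a) = f a
      rw [hF _ _ _ h₁, h₂, sub_zero]

end Algebra.GrothendieckAddGroup

/-! ### Additivity of transfers and restrictions -/

namespace MackeyFunctor

open FinGSet

variable {G : Type u} [Group G] (M : MackeyFunctor.{u, v} G) {X Y Z : FinGSet G}

theorem add_def (a b : M.obj X) : a + b = M.T (fold X) ((M.sumEquiv X X).symm (a, b)) := rfl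

theorem zero_def : (0 : M.obj X) = M.T (fromEmpty X) M.point := rfl

theorem symm_R_R (z : M.obj (X.sum Y)) :
    (M.sumEquiv X Y).symm (M.R (inl X Y) z, M.R (inr X Y) z) = z :=
  M.sum_ext (M.R_inl_symm _ _) (M.R_inr_symm _ _)

theorem T_sumElim (f : X →[G] Z) (h : Y →[G] Z) (a : M.obj X) (b : M.obj Y) :
    M.T (sumElim f h) ((M.sumEquiv X Y).symm (a, b)) = M.T f a + M.T h b := by
  rw [add_def, ← T_sumMap, T_T]
  congr 1
  ext (x | x) <;> rfl

theorem T_add (f : X →[G] Y) (a b : M.obj X) : M.T f (a + b) = M.T f a + M.T f b := by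
  rw [add_def, T_T, ← T_sumElim]
  congr 1
  ext (x | x) <;> rfl

theorem T_zero (f : X →[G] Y) : M.T f 0 = 0 := by
  rw [zero_def, T_T, zero_def]
  congr 1
  ext x
  exact x.elim

theorem R_sumMap {X' Y' : FinGSet G} (f : X →[G] X') (h : Y →[G] Y') (a : M.obj X')
    (b : M.obj Y') : M.R (sumMap f h) ((M.sumEquiv X' Y').symm (a, b)) =
      (M.sumEquiv X Y).symm (M.R f a, M.R h b) := by
  apply M.sum_ext
  · rw [R_inl_symm, R_R, show (sumMap f h).comp (inl X Y) = (inl X' Y').comp f from rfl, ← R_R,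
      R_inl_symm]
  · rw [R_inr_symm, R_R, show (sumMap f h).comp (inr X Y) = (inr X' Y').comp h from rfl, ← R_R,
      R_inr_symm]

theorem R_add (f : X →[G] Y) (a b : M.obj Y) : M.R f (a + b) = M.R f a + M.R f b := by
  rw [add_def, M.R_T (sumMap f f) (fold X) (fold Y) f (by rintro (x | x) <;> rfl), R_sumMap,
    ← add_def]
  rintro (y | y) x h
  · obtain rfl : y = f x := h
    refine ⟨Sum.inl x, ⟨rfl, rfl⟩, ?_⟩
    rintro (w | w) ⟨h₁, h₂⟩
    · exact congrArg Sum.inl h₂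
    · exact (Sum.inr_ne_inl h₁).elim
  · obtain rfl : y = f x := h
    refine ⟨Sum.inr x, ⟨rfl, rfl⟩, ?_⟩
    rintro (w | w) ⟨h₁, h₂⟩
    · exact (Sum.inl_ne_inr h₁).elim
    · exact congrArg Sum.inr h₂

/-- This covers `G`-sets without elements other than `empty G` itself. -/
theorem subsingleton_of_isEmpty (hX : IsEmpty X) (a b : M.obj X) : a = b := by
  have key : ∀ a : M.obj X, a = M.T (fromEmpty X) M.point := by
    intro a
    have := M.R_T (fromEmpty X) (fromEmpty X) (.id G) (.id G) (fun _ => rfl)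
      (fun x => (hX.false x).elim) a
    rwa [R_id, T_id, M.eq_point (M.R _ a)] at this
  rw [key a, key b]

/-- The transfer along a map with empty source is `0`. -/
theorem T_of_isEmpty (hX : IsEmpty X) (f : X →[G] Y) (a : M.obj X) : M.T f a = 0 := by
  rw [M.subsingleton_of_isEmpty hX a 0, T_zero]

theorem R_zero (f : X →[G] Y) : M.R f 0 = 0 := by
  rw [zero_def, M.R_T (fromEmpty (empty G)) (fromEmpty X) (fromEmpty Y) f (fun w => w.elim)
    (fun x => x.elim), M.eq_point (M.R _ _), zero_def]

/-- An element is the sum of its restrictions to complementary parts. -/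
theorem eq_T_R_add_T_R (f : X →[G] Z) (h : Y →[G] Z)
    (bij : Function.Bijective (sumElim f h)) (z : M.obj Z) :
    z = M.T f (M.R f z) + M.T h (M.R h z) := by
  have key : M.R (sumElim f h) z = (M.sumEquiv X Y).symm (M.R f z, M.R h z) := by
    rw [← M.symm_R_R (M.R _ z), R_R, R_R]
    rfl
  rw [← T_sumElim, ← key, ← M.R_T (sumElim f h) (sumElim f h) (.id G) (.id G) (fun _ => rfl), T_id,
    R_id]
  rintro x _ rfl
  obtain ⟨w, rfl⟩ := bij.2 x
  exact ⟨w, ⟨rfl, rfl⟩, fun w' hw => bij.1 hw.1⟩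

theorem map_mk (ω : GSpan X Y) (a : M.obj X) :
    M.toFunctor.map (SpanCat.mk ω) a = M.T ω.q (M.R ω.p a) := by
  rw [SpanCat.mk_eq_R_T, M.toFunctor.map_comp]
  rfl

/-- The map induced by a morphism of the span category as a homomorphism. -/
noncomputable def addHomMap (f : SpanCat.of X ⟶ SpanCat.of Y) : M.obj X →+ M.obj Y where
  toFun := M.toFunctor.map f
  map_zero' := by
    obtain ⟨ω, rfl⟩ := SpanCat.exists_mk f
    rw [map_mk, R_zero, T_zero]
  map_add' a b := by
    obtain ⟨ω, rfl⟩ := SpanCat.exists_mk f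
    rw [map_mk, R_add, T_add, map_mk, map_mk]

variable {M} {M' : MackeyFunctor.{u, v} G}

theorem hom_T (φ : M.Hom M') (f : X →[G] Y) (a : M.obj X) :
    φ.app Y (M.T f a) = M'.T f (φ.app X a) :=
  ConcreteCategory.congr_hom (φ.naturality (SpanCat.T f)) a

theorem hom_R (φ : M.Hom M') (f : X →[G] Y) (a : M.obj Y) :
    φ.app X (M.R f a) = M'.R f (φ.app Y a) :=
  ConcreteCategory.congr_hom (φ.naturality (SpanCat.R f)) a

theorem hom_add (φ : M.Hom M') (a b : M.obj X) :
    φ.app X (a + b) = φ.app X a + φ.app X b := by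
  rw [add_def, hom_T, add_def]
  congr 1
  apply M'.sum_ext
  · rw [← hom_R, R_inl_symm, R_inl_symm]
  · rw [← hom_R, R_inr_symm, R_inr_symm]

theorem hom_zero (φ : M.Hom M') : φ.app X (0 : M.obj X) = (0 : M'.obj X) := by
  rw [zero_def, hom_T, M'.eq_point (φ.app _ _), zero_def]

end MackeyFunctor

/-! ### Relations between transfers, norms and restrictions -/

namespace BispanCat

open FinGSet

variable {G : Type u} [Group G] {X Y Z : FinGSet G}

theorem mk_eq_R_N_T (ω : Bispan X Y) : mk ω = R ω.p ≫ N ω.q ≫ T ω.r := by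
  have h₁ : R ω.p ≫ N ω.q = mk ⟨ω.A, ω.B, ω.p, ω.q, .id G⟩ := by
    have := congrArg (SpanCat.toBispanN G).map (SpanCat.mk_eq_R_T ⟨ω.A, ω.p, ω.q⟩)
    rw [Functor.map_comp] at this
    exact this.symm
  rw [← Category.assoc, h₁]
  refine mk_eq (ω' := Bispan.comp ⟨ω.A, ω.B, ω.p, ω.q, .id G⟩ ⟨ω.B, ω.B, .id G, .id G, ω.r⟩)
    { β := ⟨fun b => ⟨b, fun b' => b'.1, fun _ => rfl⟩, fun x => x.base, fun _ => rfl, fun x =>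
        Bispan.PreSection.ext' rfl fun a _ hy => (x.r_sec ⟨a, hy⟩).symm⟩
      α := ⟨fun a => ⟨(a, ω.q a, ⟨ω.q a, fun b' => b'.1, fun _ => rfl⟩), rfl, rfl⟩,
        fun x => x.1.1, fun _ => rfl, fun x => ?_⟩
      α_smul := fun g a => ?_
      β_smul := fun g b => ?_
      p_comm := fun _ => rfl
      q_comm := fun _ => rfl
      r_comm := fun _ => rfl }
  · obtain ⟨h, h'⟩ := FinGSet.sub_prop x
    have key : ω.q x.1.1 = x.1.2.1 := h'.trans (x.1.2.2.r_sec ⟨_, h⟩)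
    exact Subtype.ext (Prod.ext rfl (Prod.ext key (Bispan.PreSection.ext' (key.trans h)
      fun a _ hy => (x.1.2.2.r_sec ⟨a, hy⟩).symm)))
  · exact Subtype.ext (Prod.ext rfl (Prod.ext (map_smul ω.q g a) (Bispan.PreSection.ext'
      (map_smul ω.q g a) fun b _ _ => (smul_inv_smul g b).symm)))
  · exact Bispan.PreSection.ext' rfl fun b _ _ => (smul_inv_smul g b).symm

/-- The distributive law for a norm after a transfer. Let `Z → X → Y` be maps `g` and `f`, and let
`Z ← A → B → Y` be a bispan such that `A` is the fibre product of `X` and `B` over `Y`. Each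
point `b` of `B` then gives a section of `g` over the fibre of `f` at `r b`, and the hypothesis
`sec` says that `B` parametrizes all such sections. -/
theorem T_N_of_sections {A B : FinGSet G} (g : Z →[G] X) (f : X →[G] Y) (p : A →[G] Z)
    (q : A →[G] B) (r : B →[G] Y) (comm : ∀ a, f (g (p a)) = r (q a))
    (cart : ∀ x b, f x = r b → ∃! a, g (p a) = x ∧ q a = b)
    (sec : ∀ (y : Y) (s : {x : X // f x = y} → Z), (∀ x, g (s x) = x.1) →
      ∃! b, r b = y ∧ ∀ a, q a = b → ∀ h : f (g (p a)) = y, p a = s ⟨g (p a), h⟩) :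
    T g ≫ N f = R p ≫ N q ≫ T r := by
  -- `F x b` is the point of `A` over `(x, b)`, so that `x ↦ p (F x b)` is the section given by `b`.
  choose F hF using fun x b h => (cart x b h).exists
  have hFu : ∀ a, F (g (p a)) (q a) (comm a) = a := fun a =>
    (cart _ _ (comm a)).unique (hF _ _ _) ⟨rfl, rfl⟩
  have hFu' : ∀ a x b h, g (p a) = x → q a = b → F x b h = a := by
    rintro a _ _ h rfl rfl
    exact hFu a
  let ω₀ : Bispan Z X := ⟨Z, Z, .id G, .id G, g⟩
  let ω₁ : Bispan X Y := ⟨X, Y, .id G, f, .id G⟩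
  let β : B → Bispan.PreSection ω₀ ω₁ := fun b =>
    ⟨r b, fun x => p (F x.1 b x.2), fun x => (hF x.1 b x.2).1⟩
  have hβ : Function.Bijective β := by
    constructor
    · intro b b' h
      obtain ⟨c, -, hc⟩ := sec (r b) (fun x => p (F x.1 b x.2)) fun x => (hF _ _ _).1
      refine (hc b ⟨rfl, ?_⟩).trans (hc b' ⟨(congrArg Bispan.PreSection.base h).symm, ?_⟩).symm
      · rintro a rfl _
        exact congrArg p (hFu a).symm
      · rintro a rfl h'
        refine Eq.trans ?_ (Bispan.PreSection.sec_congr h rfl h' (comm a)).symm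
        exact congrArg p (hFu a).symm
    · intro x
      obtain ⟨b, ⟨hb, hs⟩, -⟩ := sec x.base x.sec x.r_sec
      refine ⟨b, Bispan.PreSection.ext' hb fun a hx hy => ?_⟩
      obtain ⟨h₁, h₂⟩ := hF a b hx
      refine (hs _ h₂ ((congrArg f h₁).trans hy)).trans ?_
      exact Bispan.PreSection.sec_congr rfl h₁ _ _
  have hβs : ∀ (k : G) (b : B), β (k • b) = k • β b := by
    intro k b
    refine Bispan.PreSection.ext' (map_smul r k b) fun a hx hy => ?_
    have h' : f (k⁻¹ • a) = r b := by
      rw [map_smul, show f a = r (k • b) from hx, map_smul, inv_smul_smul]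
    obtain ⟨h₁, h₂⟩ := hF (k⁻¹ • a) b h'
    have : F a (k • b) hx = k • F (k⁻¹ • a) b h' :=
      hFu' _ _ _ _ (by rw [map_smul, map_smul, h₁, smul_inv_smul]) (by rw [map_smul, h₂])
    exact (congrArg p this).trans (map_smul p k _)
  let α : A → (ω₀.comp ω₁).A := fun a =>
    ⟨(p a, g (p a), β (q a)), comm a, congrArg p (hFu a).symm⟩
  have hα : Function.Bijective α := by
    constructor
    · intro a a' h
      have h₁ : g (p a) = g (p a') := congrArg (fun z => z.1.2.1) h
      have h₂ : q a = q a' := hβ.1 (congrArg (fun z => z.1.2.2) h)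
      rw [← hFu a', hFu' a _ _ _ h₁ h₂]
    · rintro ⟨⟨z, x, t⟩, h, h'⟩
      obtain ⟨b, rfl⟩ := hβ.2 t
      obtain ⟨h₁, h₂⟩ := hF x b h
      exact ⟨F x b h, Subtype.ext (Prod.ext h'.symm (Prod.ext h₁ (congrArg β h₂)))⟩
  rw [← mk_eq_R_N_T ⟨A, B, p, q, r⟩]
  exact (mk_eq (ω := ⟨A, B, p, q, r⟩) (ω' := ω₀.comp ω₁)
    { α := Equiv.ofBijective α hα
      β := Equiv.ofBijective β hβ
      α_smul := fun k a => Subtype.ext (Prod.ext (map_smul p k a) (Prod.ext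
        (map_smul (g.comp p) k a) ((congrArg β (map_smul q k a)).trans (hβs k (q a)))))
      β_smul := hβs
      p_comm := fun _ => rfl
      q_comm := fun _ => rfl
      r_comm := fun _ => rfl }).symm

end BispanCat

namespace TambaraFunctor

open FinGSet

variable {G : Type u} [Group G] (S : TambaraFunctor.{u, v} G) {X Y Z W : FinGSet G}

theorem T_T (f : X →[G] Y) (h : Y →[G] Z) (a : S.obj X) : S.T h (S.T f a) = S.T (h.comp f) a :=
  S.additive.T_T f h a

theorem R_R (f : X →[G] Y) (h : Y →[G] Z) (a : S.obj Z) : S.R f (S.R h a) = S.R (h.comp f) a :=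
  S.additive.R_R f h a

theorem T_id (a : S.obj X) : S.T (.id G) a = a := S.additive.T_id a

theorem N_id (a : S.obj X) : S.N (.id G) a = a := S.multiplicative.T_id a

theorem R_id (a : S.obj X) : S.R (.id G) a = a := S.additive.R_id a

/-- Base change for transfers along a cartesian square. -/
theorem R_T (f : W →[G] X) (g : W →[G] Y) (h : X →[G] Z) (k : Y →[G] Z)
    (comm : ∀ w, h (f w) = k (g w)) (cart : ∀ x y, h x = k y → ∃! w, f w = x ∧ g w = y)
    (a : S.obj X) : S.R k (S.T h a) = S.T g (S.R f a) :=
  S.additive.R_T f g h k comm cart a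

/-- Base change for norms along a cartesian square. -/
theorem R_N (f : W →[G] X) (g : W →[G] Y) (h : X →[G] Z) (k : Y →[G] Z)
    (comm : ∀ w, h (f w) = k (g w)) (cart : ∀ x y, h x = k y → ∃! w, f w = x ∧ g w = y)
    (a : S.obj X) : S.R k (S.N h a) = S.N g (S.R f a) :=
  S.multiplicative.R_T f g h k comm cart a

theorem T_add (f : X →[G] Y) (a b : S.obj X) : S.T f (a + b) = S.T f a + S.T f b :=
  S.additive.T_add f a b

theorem T_zero (f : X →[G] Y) : S.T f 0 = 0 := S.additive.T_zero f

theorem R_add (f : X →[G] Y) (a b : S.obj Y) : S.R f (a + b) = S.R f a + S.R f b :=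
  S.additive.R_add f a b

theorem R_zero (f : X →[G] Y) : S.R f 0 = 0 := S.additive.R_zero f

theorem R_mul (f : X →[G] Y) (a b : S.obj Y) : S.R f (a * b) = S.R f a * S.R f b :=
  S.multiplicative.R_add f a b

theorem R_one (f : X →[G] Y) : S.R f 1 = 1 := S.multiplicative.R_zero f

theorem mul_comm (a b : S.obj X) : a * b = b * a := S.multiplicative.add_comm a b

theorem mul_assoc (a b c : S.obj X) : a * b * c = a * (b * c) := S.multiplicative.add_assoc a b c

theorem one_mul (a : S.obj X) : 1 * a = a := S.multiplicative.zero_add a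

theorem N_of_isEmpty (hX : IsEmpty X) (f : X →[G] Y) (a : S.obj X) : S.N f a = 1 :=
  S.multiplicative.T_of_isEmpty hX f a

theorem subsingleton_of_isEmpty (hX : IsEmpty X) (a b : S.obj X) : a = b :=
  S.additive.subsingleton_of_isEmpty hX a b

/-- The canonical bijection `S(X ⊔ Y) ≃ S(X) × S(Y)`. -/
noncomputable def sumEquiv (X Y : FinGSet G) : S.obj (X.sum Y) ≃ S.obj X × S.obj Y :=
  S.additive.sumEquiv X Y

theorem R_inl_symm (a : S.obj X) (b : S.obj Y) :
    S.R (inl X Y) ((S.sumEquiv X Y).symm (a, b)) = a := S.additive.R_inl_symm a b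

theorem R_inr_symm (a : S.obj X) (b : S.obj Y) :
    S.R (inr X Y) ((S.sumEquiv X Y).symm (a, b)) = b := S.additive.R_inr_symm a b

theorem symm_R_R (z : S.obj (X.sum Y)) :
    (S.sumEquiv X Y).symm (S.R (inl X Y) z, S.R (inr X Y) z) = z := S.additive.symm_R_R z

theorem eq_symm {z : S.obj (X.sum Y)} {a : S.obj X} {b : S.obj Y} (h : S.R (inl X Y) z = a)
    (h' : S.R (inr X Y) z = b) : z = (S.sumEquiv X Y).symm (a, b) := by
  rw [← h, ← h', symm_R_R]

theorem N_sumElim (f : X →[G] Z) (h : Y →[G] Z) (a : S.obj X) (b : S.obj Y) :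
    S.N (sumElim f h) ((S.sumEquiv X Y).symm (a, b)) = S.N f a * S.N h b :=
  S.multiplicative.T_sumElim f h a b

theorem T_fold (a b : S.obj X) : S.T (fold X) ((S.sumEquiv X X).symm (a, b)) = a + b := rfl

theorem eq_T_R_add_T_R (f : X →[G] Z) (h : Y →[G] Z)
    (bij : Function.Bijective (sumElim f h)) (z : S.obj Z) :
    z = S.T f (S.R f z) + S.T h (S.R h z) := S.additive.eq_T_R_add_T_R f h bij z

theorem map_mk (ω : Bispan X Y) (a : S.obj X) :
    S.toFunctor.map (BispanCat.mk ω) a = S.T ω.r (S.N ω.q (S.R ω.p a)) := by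
  rw [BispanCat.mk_eq_R_N_T, S.toFunctor.map_comp, S.toFunctor.map_comp]
  rfl

theorem N_T {A B : FinGSet G} (g : Z →[G] X) (f : X →[G] Y) (p : A →[G] Z)
    (q : A →[G] B) (r : B →[G] Y) (comm : ∀ a, f (g (p a)) = r (q a))
    (cart : ∀ x b, f x = r b → ∃! a, g (p a) = x ∧ q a = b)
    (sec : ∀ (y : Y) (s : {x : X // f x = y} → Z), (∀ x, g (s x) = x.1) →
      ∃! b, r b = y ∧ ∀ a, q a = b → ∀ h : f (g (p a)) = y, p a = s ⟨g (p a), h⟩)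
    (z : S.obj Z) : S.N f (S.T g z) = S.T r (S.N q (S.R p z)) := by
  have := ConcreteCategory.congr_hom
    (congrArg S.toFunctor.map (BispanCat.T_N_of_sections g f p q r comm cart sec)) z
  simp only [S.toFunctor.map_comp] at this
  exact this

/-- Frobenius reciprocity. The product is the norm along the fold map, and the sections of
`Y ⊔ Z → Y ⊔ Y` over the fibres of the fold map amount to points of `Z`, so this is an instance of
the distributive law. -/
theorem mul_T (g : Z →[G] Y) (a : S.obj Y) (z : S.obj Z) :
    a * S.T g z = S.T g (S.R g a * z) := by
  have h₁ : a * S.T g z = S.N (fold Y) (S.T (sumElim (inl Y Y) ((inr Y Y).comp g))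
      ((S.sumEquiv Y Z).symm (a, z))) := by
    have : S.T (sumElim (inl Y Y) ((inr Y Y).comp g)) ((S.sumEquiv Y Z).symm (a, z)) =
        (S.sumEquiv Y Y).symm (a, S.T g z) :=
      (S.additive.T_sumMap (.id G) g a z).trans
        (congrArg (fun c => (S.sumEquiv Y Y).symm (c, S.T g z)) (S.T_id a))
    rw [this]
    rfl
  rw [h₁, S.N_T (sumElim (inl Y Y) ((inr Y Y).comp g)) (fold Y)
    (sumElim ((inl Y Z).comp g) (inr Y Z)) (fold Z) g,
    show fold Z = sumElim (.id G) (.id G) from rfl,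
    show S.R (sumElim ((inl Y Z).comp g) (inr Y Z)) ((S.sumEquiv Y Z).symm (a, z)) =
      (S.sumEquiv Z Z).symm (S.R g a, z) from S.eq_symm ?_ ?_, N_sumElim, N_id, N_id]
  · rw [R_R, show (sumElim ((inl Y Z).comp g) (inr Y Z)).comp (inl Z Z) = (inl Y Z).comp g from rfl,
      ← R_R, R_inl_symm]
  · rw [R_R]
    exact S.R_inr_symm a z
  · rintro (w | w) <;> rfl
  · rintro (y | y) b h
    · obtain rfl : y = g b := h
      refine ⟨Sum.inl b, ⟨rfl, rfl⟩, ?_⟩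
      rintro (w | w) ⟨h₁, h₂⟩
      · exact congrArg Sum.inl h₂
      · exact (Sum.inr_ne_inl h₁).elim
    · obtain rfl : y = g b := h
      refine ⟨Sum.inr b, ⟨rfl, rfl⟩, ?_⟩
      rintro (w | w) ⟨h₁, h₂⟩
      · exact (Sum.inl_ne_inr h₁).elim
      · exact congrArg Sum.inr h₂
  · intro y s hs
    have hr := hs ⟨Sum.inr y, rfl⟩
    have hl := hs ⟨Sum.inl y, rfl⟩
    rcases hl' : s ⟨Sum.inl y, rfl⟩ with y' | w'
    · rcases hr' : s ⟨Sum.inr y, rfl⟩ with y'' | w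
      · rw [hr'] at hr
        exact (Sum.inl_ne_inr hr).elim
      · rw [hr'] at hr
        rw [hl'] at hl
        obtain rfl : y' = y := Sum.inl_injective hl
        obtain rfl : g w = y' := Sum.inr_injective hr
        refine ⟨w, ⟨rfl, ?_⟩, ?_⟩
        · rintro (a | a) rfl h
          · exact hl'.symm
          · exact hr'.symm
        · rintro w'' ⟨h₁, h₂⟩
          refine Sum.inr_injective ((h₂ (Sum.inr w'') rfl h₁).trans (Eq.trans ?_ hr'))
          exact congrArg s (Subtype.ext (congrArg Sum.inr h₁))
    · rw [hl'] at hl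
      exact (Sum.inr_ne_inl hl).elim

theorem mul_add (a b c : S.obj X) : a * (b + c) = a * b + a * c := by
  rw [← T_fold, mul_T, ← S.T_fold (a * b)]
  congr 1
  refine S.eq_symm ?_ ?_
  · rw [R_mul, R_R, R_inl_symm]
    exact congrArg (· * b) (S.R_id a)
  · rw [R_mul, R_R, R_inr_symm]
    exact congrArg (· * c) (S.R_id a)

theorem mul_zero (a : S.obj X) : a * 0 = 0 := by
  rw [← S.T_zero (fromEmpty X), mul_T,
    S.subsingleton_of_isEmpty (X := empty G) inferInstance (S.R (fromEmpty X) a * 0) 0]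

/-- The transfer as an additive homomorphism. -/
noncomputable def addHomT (f : X →[G] Y) : S.obj X →+ S.obj Y where
  toFun := S.T f
  map_zero' := S.T_zero f
  map_add' := S.T_add f

/-- The restriction as an additive homomorphism. -/
noncomputable def addHomR (f : X →[G] Y) : S.obj Y →+ S.obj X where
  toFun := S.R f
  map_zero' := S.R_zero f
  map_add' := S.R_add f

/-- Multiplication by `a` as an additive homomorphism. -/
noncomputable def addHomMul (a : S.obj X) : S.obj X →+ S.obj X where
  toFun := (a * ·)
  map_zero' := S.mul_zero a
  map_add' := S.mul_add a

/-- The norm of a sum. Here `B` parametrizes the subsets of the fibres of `f : X → Y`, and `A₁`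
and `A₂` are the sets of pairs consisting of a point `b` of `B` and a point of the fibre of `f`
that belongs, respectively does not belong, to the subset given by `b`. -/
theorem N_add {A₁ A₂ B : FinGSet G} (f : X →[G] Y) (p₁ : A₁ →[G] X) (q₁ : A₁ →[G] B)
    (p₂ : A₂ →[G] X) (q₂ : A₂ →[G] B) (r : B →[G] Y) (comm₁ : ∀ a, f (p₁ a) = r (q₁ a))
    (comm₂ : ∀ a, f (p₂ a) = r (q₂ a)) (inj₁ : ∀ a a', p₁ a = p₁ a' → q₁ a = q₁ a' → a = a')
    (inj₂ : ∀ a a', p₂ a = p₂ a' → q₂ a = q₂ a' → a = a')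
    (disj : ∀ a a', p₁ a = p₂ a' → q₁ a = q₂ a' → False)
    (cover : ∀ x b, f x = r b → (∃ a, p₁ a = x ∧ q₁ a = b) ∨ ∃ a, p₂ a = x ∧ q₂ a = b)
    (subsets : ∀ (y : Y) (C : Set X), (∀ x ∈ C, f x = y) →
      ∃! b, r b = y ∧ ∀ x, x ∈ C ↔ ∃ a, p₁ a = x ∧ q₁ a = b)
    (u v : S.obj X) :
    S.N f (u + v) = S.T r (S.N q₁ (S.R p₁ u) * S.N q₂ (S.R p₂ v)) := by
  rw [← N_sumElim, ← T_fold,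
    ← show S.R (MackeyFunctor.sumMap p₁ p₂) ((S.sumEquiv X X).symm (u, v)) =
      (S.sumEquiv A₁ A₂).symm (S.R p₁ u, S.R p₂ v) from S.additive.R_sumMap p₁ p₂ u v]
  apply N_T
  · rintro (a | a)
    exacts [comm₁ a, comm₂ a]
  · intro x b h
    rcases cover x b h with ⟨a, rfl, rfl⟩ | ⟨a, rfl, rfl⟩
    · refine ⟨Sum.inl a, ⟨rfl, rfl⟩, ?_⟩
      rintro (a' | a') ⟨h₁, h₂⟩
      · exact congrArg Sum.inl (inj₁ _ _ h₁ h₂)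
      · exact (disj _ _ h₁.symm h₂.symm).elim
    · refine ⟨Sum.inr a, ⟨rfl, rfl⟩, ?_⟩
      rintro (a' | a') ⟨h₁, h₂⟩
      · exact (disj _ _ h₁ h₂).elim
      · exact congrArg Sum.inr (inj₂ _ _ h₁ h₂)
  · intro y s hs
    -- The section `s` of the fold map corresponds to the subset where it is in the first summand.
    have hs' : ∀ x, s x = Sum.inl x.1 ∨ s x = Sum.inr x.1 := by
      intro x
      have := hs x
      rcases h : s x with x' | x' <;> rw [h] at this
      · exact Or.inl (congrArg Sum.inl this)
      · exact Or.inr (congrArg Sum.inr this)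
    obtain ⟨b, ⟨hb, hC⟩, hu⟩ := subsets y {x | ∃ h, s ⟨x, h⟩ = Sum.inl x} fun x hx => hx.1
    refine ⟨b, ⟨hb, ?_⟩, ?_⟩
    · rintro (a | a) rfl h
      · exact ((hC (p₁ a)).2 ⟨a, rfl, rfl⟩).2.symm
      · refine ((hs' ⟨p₂ a, h⟩).resolve_left fun h' => ?_).symm
        obtain ⟨a', h₁, h₂⟩ := (hC (p₂ a)).1 ⟨h, h'⟩
        exact disj _ _ h₁ h₂
    · rintro b' ⟨rfl, h⟩
      refine hu b' ⟨rfl, fun x => ⟨?_, ?_⟩⟩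
      · rintro ⟨h₁, h₂⟩
        rcases cover x b' h₁ with h' | ⟨a, rfl, rfl⟩
        · exact h'
        · exact (Sum.inr_ne_inl ((h (Sum.inr a) rfl h₁).trans h₂)).elim
      · rintro ⟨a, rfl, rfl⟩
        exact ⟨comm₁ a, (h (Sum.inl a) rfl (comm₁ a)).symm⟩

variable {S} {S' : TambaraFunctor.{u, v} G}

theorem hom_N (φ : S.Hom S') (f : X →[G] Y) (a : S.obj X) :
    φ.app Y (S.N f a) = S'.N f (φ.app X a) :=
  ConcreteCategory.congr_hom (φ.naturality (BispanCat.N f)) a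

theorem hom_R (φ : S.Hom S') (f : X →[G] Y) (a : S.obj Y) :
    φ.app X (S.R f a) = S'.R f (φ.app Y a) :=
  ConcreteCategory.congr_hom (φ.naturality (BispanCat.R f)) a

theorem hom_add (φ : S.Hom S') (a b : S.obj X) :
    φ.app X (a + b) = φ.app X a + φ.app X b :=
  MackeyFunctor.hom_add (M := S.additive) (M' := S'.additive)
    (Functor.whiskerLeft (SpanCat.toBispanT G) φ) a b

theorem hom_zero (φ : S.Hom S') : φ.app X (0 : S.obj X) = (0 : S'.obj X) :=
  MackeyFunctor.hom_zero (M := S.additive) (M' := S'.additive)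
    (Functor.whiskerLeft (SpanCat.toBispanT G) φ)

/-- The components of a morphism of Tambara functors as additive homomorphisms. -/
noncomputable def addHomApp (φ : S.Hom S') (X : FinGSet G) : S.obj X →+ S'.obj X where
  toFun := φ.app X
  map_zero' := hom_zero φ
  map_add' := hom_add φ

end TambaraFunctor

/-! ### The degree of a norm map -/

namespace FinGSet

variable {G : Type u} [Group G] {X Y : FinGSet G} (f : X →[G] Y)

theorem V_ext {v w : V f} (h : v.1.1 = w.1.1) (h' : ∀ x : X, x ∈ v.1.2 ↔ x ∈ w.1.2) : v = w :=
  Subtype.ext (Prod.ext h (Set.ext h'))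

/-- The map `(y, C) ↦ y`. -/
def vBase : V f →[G] Y := ⟨fun v => v.1.1, fun _ _ => rfl⟩

/-- `{(x, C) | C ⊆ f⁻¹{f x}, x ∉ C}`, the complement of `U(f)` in `X ×_Y V(f)`; the point `(x, C)`
is recorded as `(x, (f x, C))`. -/
def UCompl : FinGSet G :=
  (X.prod (V f)).sub (fun z => f z.1 = z.2.1.1 ∧ z.1 ∉ z.2.1.2) (by
    rintro g ⟨x, v⟩ ⟨h, h'⟩
    refine ⟨(map_smul f g x).trans (congrArg (g • ·) h), fun hx => h' ?_⟩
    exact Set.smul_mem_smul_set_iff.1 hx)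

/-- The map `(x, C) ↦ x`. -/
def rCompl : UCompl f →[G] X := ⟨fun z => z.1.1, fun _ _ => rfl⟩

/-- The map `(x, C) ↦ (f x, C)`. -/
def tCompl : UCompl f →[G] V f := ⟨fun z => z.1.2, fun _ _ => rfl⟩

/-- The subset of `V(f)` of pairs `(y, C)` with `C` nonempty. -/
def VPos : FinGSet G :=
  (V f).sub (fun v => (v.1.2 : Set X).Nonempty) (by
    rintro g v h
    exact h.smul_set)

/-- The inclusion of `VPos f`. -/
def iPos : VPos f →[G] V f := ⟨fun v => v.1, fun _ _ => rfl⟩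

/-- The part of `UCompl f` over `VPos f`. -/
def UComplPos : FinGSet G :=
  (UCompl f).sub (fun z => (z.1.2.1.2 : Set X).Nonempty) (by
    rintro g z h
    exact h.smul_set)

/-- The inclusion of `UComplPos f`. -/
def iComplPos : UComplPos f →[G] UCompl f := ⟨fun z => z.1, fun _ _ => rfl⟩

/-- The restriction of `tCompl` to `UComplPos f`. -/
def tComplPos : UComplPos f →[G] VPos f := ⟨fun z => ⟨z.1.1.2, z.2⟩, fun _ _ => rfl⟩

/-- The map `x ↦ (x, ∅)`. -/
def kCompl : X →[G] UCompl f :=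
  ⟨fun x => ⟨(x, k f (f x)), rfl, fun h => h⟩,
   fun g x => Subtype.ext (Prod.ext rfl ((congrArg (k f) (map_smul f g x)).trans
    (map_smul (k f) g (f x))))⟩

theorem bijective_k_iPos : Function.Bijective (sumElim (k f) (iPos f)) := by
  constructor
  · rintro (y | ⟨v, x, hx⟩) (y' | ⟨v', x', hx'⟩) h
    · exact congrArg (fun v : V f => (Sum.inl v.1.1 : Y ⊕ VPos f)) h
    · obtain rfl : k f y = v' := h
      exact hx'.elim
    · obtain rfl : v = k f y' := h
      exact hx.elim
    · obtain rfl : v = v' := h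
      rfl
  · intro v
    rcases (v.1.2 : Set X).eq_empty_or_nonempty with h | h
    · exact ⟨Sum.inl v.1.1, Subtype.ext (Prod.ext rfl h.symm)⟩
    · exact ⟨Sum.inr ⟨v, h⟩, rfl⟩

/-- The fibre of `tComplPos f` over `(y, C)` is the complement of `C` in the fibre of `f`. -/
theorem card_fiber_tComplPos {d : ℕ} (hd : ∀ y : Y, Nat.card {x : X // f x = y} ≤ d + 1)
    (v : VPos f) : Nat.card {z : UComplPos f // tComplPos f z = v} ≤ d := by
  obtain ⟨v, c, hc⟩ := v
  have hfc : f c = v.1.1 := (FinGSet.sub_prop v) c hc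
  refine Nat.le_of_lt_succ (lt_of_lt_of_le ?_ (hd v.1.1))
  have hz : ∀ z : {z : UComplPos f // tComplPos f z = ⟨v, c, hc⟩}, z.1.1.1.2 = v := fun z =>
    congrArg Subtype.val z.2
  have := Fintype.ofFinite {z : UComplPos f // tComplPos f z = ⟨v, c, hc⟩}
  have := Fintype.ofFinite {x : X // f x = v.1.1}
  rw [Nat.card_eq_fintype_card, Nat.card_eq_fintype_card]
  refine Fintype.card_lt_of_injective_of_notMem
    ( fun z => (⟨z.1.1.1.1, (FinGSet.sub_prop z.1.1).1.trans
      (congrArg (fun v : V f => v.1.1) (hz z))⟩ : {x : X // f x = v.1.1}))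
    ?_ (b := ⟨c, hfc⟩) ?_
  · intro z z' h
    refine Subtype.ext (Subtype.ext (Subtype.ext (Prod.ext (congrArg Subtype.val h) ?_)))
    exact (hz z).trans (hz z').symm
  · rintro ⟨z, h⟩
    have h₁ : z.1.1.1.1 = c := congrArg Subtype.val h
    refine (FinGSet.sub_prop z.1.1).2 ?_
    rw [h₁, hz z]
    exact hc

end FinGSet

namespace TambaraFunctor

open FinGSet

variable {G : Type u} [Group G] (S : TambaraFunctor.{u, v} G) {X Y : FinGSet G} (f : X →[G] Y)

/-- The norm of a sum, with the subsets of the fibres of `f` parametrized by `V(f)`. -/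
theorem N_add_eq_T_chi (a b : S.obj X) :
    S.N f (a + b) = S.T (vBase f) (S.chi f a * S.N (tCompl f) (S.R (rCompl f) b)) := by
  refine S.N_add f (r f) (t f) (rCompl f) (tCompl f) (vBase f) (fun _ => rfl)
    (fun z => (FinGSet.sub_prop z).1) ?_ ?_ ?_ ?_ ?_ a b
  · intro z z' h h'
    exact Subtype.ext (Prod.ext h (congrArg (fun v : V f => v.1.2) h'))
  · intro z z' h h'
    exact Subtype.ext (Prod.ext h h')
  · intro z z' h h'
    refine (FinGSet.sub_prop z').2 ?_
    rw [show z'.1.1 = z.1.1 from h.symm, show z'.1.2 = t f z from h'.symm]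
    exact (FinGSet.sub_prop z).1
  · intro x v h
    by_cases hx : x ∈ (v.1.2 : Set X)
    · refine Or.inl ⟨⟨(x, v.1.2), hx, fun x' hx' => ((FinGSet.sub_prop v) x' hx').trans h.symm⟩,
        rfl, ?_⟩
      exact Subtype.ext (Prod.ext h rfl)
    · exact Or.inr ⟨⟨(x, v), h, hx⟩, rfl, rfl⟩
  · intro y C hC
    refine ⟨⟨(y, C), hC⟩, ⟨rfl, fun x => ⟨fun hx => ?_, ?_⟩⟩, ?_⟩
    · refine ⟨⟨(x, C), hx, fun x' hx' => (hC x' hx').trans (hC x hx).symm⟩, rfl, ?_⟩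
      exact Subtype.ext (Prod.ext (hC x hx) rfl)
    · rintro ⟨z, rfl, h⟩
      have h' : z.1.2 = C := congrArg (fun v : V f => v.1.2) h
      exact h' ▸ (FinGSet.sub_prop z).1
    · rintro v ⟨rfl, h⟩
      refine V_ext f rfl fun x => Iff.trans ⟨fun hx => ?_, ?_⟩ (h x).symm
      · have hfx : f x = v.1.1 := (FinGSet.sub_prop v) x hx
        refine ⟨⟨(x, v.1.2), hx, fun x' hx' => ?_⟩, rfl, ?_⟩
        · exact ((FinGSet.sub_prop v) x' hx').trans hfx.symm
        · exact Subtype.ext (Prod.ext hfx rfl)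
      · rintro ⟨z, rfl, rfl⟩
        exact (FinGSet.sub_prop z).1

theorem R_k_chi (a : S.obj X) : S.R (k f) (S.chi f a) = 1 := by
  rw [chi, S.R_N (fromEmpty (U f)) (fromEmpty Y) (t f) (k f) (fun w => w.elim)]
  · exact S.N_of_isEmpty (X := empty G) inferInstance _ _
  · intro z y h
    have h' : z.1.2 = (∅ : Set X) := congrArg (fun v : V f => v.1.2) h
    have := (FinGSet.sub_prop z).1
    rw [h'] at this
    exact this.elim

/-- The part of the formula for `N_f(a + b)` indexed by the empty subsets is `N_f(b)`, and the
other part involves the norm along a map with smaller fibres. -/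
theorem N_add_eq_N_add (a b : S.obj X) :
    S.N f (a + b) = S.N f b + S.T ((vBase f).comp (iPos f)) (S.R (iPos f) (S.chi f a) *
      S.N (tComplPos f) (S.R ((rCompl f).comp (iComplPos f)) b)) := by
  rw [N_add_eq_T_chi, S.eq_T_R_add_T_R (k f) (iPos f) (bijective_k_iPos f) (_ * _), T_add, R_mul,
    R_mul, R_k_chi, one_mul, T_T, T_T, S.R_N (kCompl f) f (tCompl f) (k f),
    S.R_N (iComplPos f) (tComplPos f) (tCompl f) (iPos f), R_R, R_R]
  · congr 1
    exact (S.T_id _).trans (congrArg (S.N f) (S.R_id b))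
  · exact fun _ => rfl
  · intro z v h
    obtain ⟨v, hv⟩ := v
    obtain rfl : z.1.2 = v := h
    exact ⟨⟨z, hv⟩, ⟨rfl, rfl⟩, fun w hw => Subtype.ext hw.1⟩
  · exact fun _ => rfl
  · intro z y h
    have hz : f z.1.1 = z.1.2.1.1 := (FinGSet.sub_prop z).1
    have hy : f z.1.1 = y := hz.trans (congrArg (fun v : V f => v.1.1) h)
    refine ⟨z.1.1, ⟨Subtype.ext (Prod.ext rfl ?_), hy⟩, ?_⟩
    · exact (congrArg (k f) hy).trans h.symm
    · rintro w ⟨rfl, -⟩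
      rfl

/-- If the fibres of `f` have at most `d` points, then `N_f` is polynomial of degree at most `d`. As
the values of `S` need not be groups, this is stated after a homomorphism `h` to a group. -/
theorem degreeLT_N (d : ℕ) {X Y : FinGSet G} (f : X →[G] Y)
    (hf : ∀ y : Y, Nat.card {x : X // f x = y} ≤ d) {B : Type*} [AddCommGroup B]
    (h : S.obj Y →+ B) : DegreeLT (d + 1) fun a => h (S.N f a) := by
  induction d generalizing X Y with
  | zero =>
    have hX : IsEmpty X := by
      refine ⟨fun x => ?_⟩
      have := Finite.card_eq_zero_iff.1 (Nat.le_zero.1 (hf (f x)))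
      exact this.false ⟨x, rfl⟩
    intro a
    funext x
    rw [fwdDiff, S.subsingleton_of_isEmpty hX (x + a) x, sub_self]
    rfl
  | succ d ih =>
    intro a
    -- This is the norm along `tComplPos f` between two additive maps.
    have key : fwdDiff a (fun a => h (S.N f a)) = fun b =>
        (h.comp ((S.addHomT ((vBase f).comp (iPos f))).comp
          (S.addHomMul (S.R (iPos f) (S.chi f a)))))
        (S.N (tComplPos f) (S.addHomR ((rCompl f).comp (iComplPos f)) b)) := by
      funext b
      rw [fwdDiff, add_comm b a, N_add_eq_N_add, map_add, add_sub_cancel_left]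
      rfl
    rw [key]
    exact (ih (tComplPos f) (card_fiber_tComplPos f hf) _).comp_hom _

/-- All operations of a Tambara functor are polynomial, after a homomorphism to a group. -/
theorem exists_degreeLT_map (ω : BispanCat.of X ⟶ BispanCat.of Y) {B : Type*} [AddCommGroup B]
    (h : S.obj Y →+ B) : ∃ n, DegreeLT n fun a : S.obj X => h (S.toFunctor.map ω a) := by
  obtain ⟨ω, rfl⟩ := BispanCat.exists_mk ω
  refine ⟨Nat.card ω.A + 1, ?_⟩
  have := (S.degreeLT_N (Nat.card ω.A) ω.q (fun b => Finite.card_subtype_le _)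
    (h.comp (S.addHomT ω.r))).comp_hom (S.addHomR ω.p)
  simp only [map_mk]
  exact this

end TambaraFunctor

/-! ### The convolution product -/

namespace FinGSet

variable {G : Type u} [Group G] {X Y : FinGSet G} (f : X →[G] Y)

theorem V₂_ext {v w : V₂ f} (h : v.1.1 = w.1.1) (h₁ : v.1.2.1 = w.1.2.1)
    (h₂ : v.1.2.2 = w.1.2.2) : v = w :=
  Subtype.ext (Prod.ext h (Prod.ext h₁ h₂))

/-- The map `(y, C₁, C₂) ↦ (y, C₂, C₁)`. -/
def swapV₂ : V₂ f →[G] V₂ f :=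
  ⟨fun v => ⟨(v.1.1, v.1.2.2, v.1.2.1), (FinGSet.sub_prop v).2.1, (FinGSet.sub_prop v).1,
    (Set.inter_comm _ _).trans (FinGSet.sub_prop v).2.2⟩, fun _ _ => rfl⟩

/-- The map `(y, C) ↦ (y, ∅, C)`. -/
def emptyV₂ : V f →[G] V₂ f :=
  ⟨fun v => ⟨(v.1.1, (∅ : Set X), v.1.2), fun _ hx => hx.elim, FinGSet.sub_prop v,
    Set.empty_inter _⟩, fun _ _ => V₂_ext f rfl Set.smul_set_empty.symm rfl⟩

/-- `{(x, (y, C₁, C₂)) | x ∈ C₁}`. -/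
def U₁ : FinGSet G :=
  (X.prod (V₂ f)).sub (fun z => z.1 ∈ z.2.1.2.1) fun _ _ h => Set.smul_mem_smul_set h

/-- `{(x, (y, C₁, C₂)) | x ∈ C₂}`. -/
def U₂ : FinGSet G :=
  (X.prod (V₂ f)).sub (fun z => z.1 ∈ z.2.1.2.2) fun _ _ h => Set.smul_mem_smul_set h

/-- The projection `U₁(f) → V²(f)`. -/
def t₁ : U₁ f →[G] V₂ f := ⟨fun z => z.1.2, fun _ _ => rfl⟩

/-- The projection `U₂(f) → V²(f)`. -/
def t₂ : U₂ f →[G] V₂ f := ⟨fun z => z.1.2, fun _ _ => rfl⟩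

/-- The map `(x, (y, C₁, C₂)) ↦ (x, C₁)`. -/
def s₁ : U₁ f →[G] U f :=
  ⟨fun z => ⟨(z.1.1, z.1.2.1.2.1), FinGSet.sub_prop z, fun x hx =>
    ((FinGSet.sub_prop z.1.2).1 x hx).trans ((FinGSet.sub_prop z.1.2).1 _ z.2).symm⟩,
    fun _ _ => rfl⟩

/-- The map `(x, (y, C₁, C₂)) ↦ (x, C₂)`. -/
def s₂ : U₂ f →[G] U f :=
  ⟨fun z => ⟨(z.1.1, z.1.2.1.2.2), FinGSet.sub_prop z, fun x hx =>
    ((FinGSet.sub_prop z.1.2).2.1 x hx).trans ((FinGSet.sub_prop z.1.2).2.1 _ z.2).symm⟩,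
    fun _ _ => rfl⟩

/-- The map `(x, (y, C₁, C₂)) ↦ (x, C₁ ∪ C₂)` on `U₁(f)`. -/
def m₁ : U₁ f →[G] U f :=
  ⟨fun z => ⟨(z.1.1, (p₁₂ f z.1.2).1.2), Or.inl z.2, fun x hx =>
    (FinGSet.sub_prop (p₁₂ f z.1.2) x hx).trans ((FinGSet.sub_prop z.1.2).1 _ z.2).symm⟩,
    fun _ _ => Subtype.ext (Prod.ext rfl Set.smul_set_union.symm)⟩

/-- The map `(x, (y, C₁, C₂)) ↦ (x, C₁ ∪ C₂)` on `U₂(f)`. -/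
def m₂ : U₂ f →[G] U f :=
  ⟨fun z => ⟨(z.1.1, (p₁₂ f z.1.2).1.2), Or.inr z.2, fun x hx =>
    (FinGSet.sub_prop (p₁₂ f z.1.2) x hx).trans ((FinGSet.sub_prop z.1.2).2.1 _ z.2).symm⟩,
    fun _ _ => Subtype.ext (Prod.ext rfl Set.smul_set_union.symm)⟩

/-- `V³(f) = {(y, C₁, C₂, C₃)}` with pairwise disjoint `C₁, C₂, C₃ ⊆ f⁻¹{y}`; it is encoded by
`(y, C₁, C₂)` together with `C₃`. -/
def V₃ : FinGSet G :=
  ((V₂ f).prod X.powerset).sub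
    (fun z => (∀ x ∈ z.2, f x = z.1.1.1) ∧ z.1.1.2.1 ∩ z.2 = ∅ ∧ z.1.1.2.2 ∩ z.2 = ∅) (by
    rintro g ⟨v, C⟩ ⟨h, h₁, h₂⟩
    refine ⟨?_, ?_, ?_⟩
    · rintro _ ⟨x, hx, rfl⟩
      exact (map_smul f g x).trans (congrArg (g • ·) (h x hx))
    · exact Set.smul_set_inter.symm.trans ((congrArg (g • ·) h₁).trans Set.smul_set_empty)
    · exact Set.smul_set_inter.symm.trans ((congrArg (g • ·) h₂).trans Set.smul_set_empty))

/-- The map `(y, C₁, C₂, C₃) ↦ (y, C₁, C₂)`. -/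
def q₁₂ : V₃ f →[G] V₂ f := ⟨fun z => z.1.1, fun _ _ => rfl⟩

/-- The map `(y, C₁, C₂, C₃) ↦ (y, C₂, C₃)`. -/
def q₂₃ : V₃ f →[G] V₂ f :=
  ⟨fun z => ⟨(z.1.1.1.1, z.1.1.1.2.2, z.1.2), (FinGSet.sub_prop z.1.1).2.1,
    (FinGSet.sub_prop z).1, (FinGSet.sub_prop z).2.2⟩, fun _ _ => rfl⟩

/-- The map `(y, C₁, C₂, C₃) ↦ (y, C₁ ∪ C₂, C₃)`. -/
def merge₁₂ : V₃ f →[G] V₂ f :=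
  ⟨fun z => ⟨(z.1.1.1.1, (p₁₂ f z.1.1).1.2, z.1.2), FinGSet.sub_prop (p₁₂ f z.1.1),
    (FinGSet.sub_prop z).1, (Set.union_inter_distrib_right _ _ _).trans
      (Set.union_empty_iff.2 (FinGSet.sub_prop z).2)⟩,
    fun _ _ => V₂_ext f rfl Set.smul_set_union.symm rfl⟩

/-- The map `(y, C₁, C₂, C₃) ↦ (y, C₁, C₂ ∪ C₃)`. -/
def merge₂₃ : V₃ f →[G] V₂ f :=
  ⟨fun z => ⟨(z.1.1.1.1, z.1.1.1.2.1, (p₁₂ f (q₂₃ f z)).1.2), (FinGSet.sub_prop z.1.1).1,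
    FinGSet.sub_prop (p₁₂ f (q₂₃ f z)), (Set.inter_union_distrib_left _ _ _).trans
      (Set.union_empty_iff.2 ⟨(FinGSet.sub_prop z.1.1).2.2, (FinGSet.sub_prop z).2.1⟩)⟩,
    fun _ _ => V₂_ext f rfl rfl Set.smul_set_union.symm⟩

end FinGSet

namespace TambaraFunctor

open FinGSet

variable {G : Type u} [Group G] (S : TambaraFunctor.{u, v} G) {X Y : FinGSet G} (f : X →[G] Y)

theorem conv_comm (a b : S.obj (V f)) : S.conv f a b = S.conv f b a := by
  have h : S.R (p₁ f) a * S.R (p₂ f) b =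
      S.T (swapV₂ f) (S.R (p₁ f) b * S.R (p₂ f) a) := by
    refine Eq.trans ?_ (S.additive.T_eq_R (swapV₂ f) (swapV₂ f) (fun _ => rfl)
      (fun _ => rfl) _).symm
    refine Eq.trans ?_ (S.R_mul (swapV₂ f) _ _).symm
    rw [R_R, R_R, mul_comm]
    rfl
  rw [conv, h, T_T, conv]
  congr 1
  ext v
  exact Subtype.ext (Prod.ext rfl (Set.union_comm _ _))

theorem convUnit_conv (a : S.obj (V f)) : S.conv f (S.convUnit f) a = a := by
  rw [conv, convUnit, S.R_T (vBase f) (emptyV₂ f) (k f) (p₁ f), R_one, mul_comm, mul_T, T_T,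
    mul_comm, one_mul, R_R]
  · refine (congrArg₂ (fun i j => S.T i (S.R j a)) ?_ rfl).trans ((S.T_id _).trans (S.R_id a))
    ext v
    exact Subtype.ext (Prod.ext rfl (Set.empty_union _))
  · exact fun _ => rfl
  · intro y v h
    have hy : y = v.1.1 := congrArg (fun v : V f => v.1.1) h
    have hv : (∅ : Set X) = v.1.2.1 := congrArg (fun v : V f => v.1.2) h
    refine ⟨p₂ f v, ⟨hy.symm, V₂_ext f rfl hv rfl⟩, ?_⟩
    rintro w ⟨-, rfl⟩
    rfl

/-- Both sides are the transfer of `R(a) R(b) R(c)` along the map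
`(y, C₁, C₂, C₃) ↦ (y, C₁ ∪ C₂ ∪ C₃)` on `V³(f)`. -/
theorem conv_assoc (a b c : S.obj (V f)) :
    S.conv f (S.conv f a b) c = S.conv f a (S.conv f b c) := by
  have h₁ : S.R (p₁ f) (S.conv f a b) =
      S.T (merge₁₂ f) (S.R (q₁₂ f) (S.R (p₁ f) a * S.R (p₂ f) b)) := by
    refine S.R_T (q₁₂ f) (merge₁₂ f) (p₁₂ f) (p₁ f) (fun _ => rfl) ?_ _
    intro v w h
    have hy : v.1.1 = w.1.1 := congrArg (fun v : V f => v.1.1) h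
    have hC : (v.1.2.1 : Set X) ∪ v.1.2.2 = w.1.2.1 := congrArg (fun v : V f => v.1.2) h
    have hw := (FinGSet.sub_prop w).2.2
    rw [← hC] at hw
    have hw' := (Set.union_inter_distrib_right _ _ _).symm.trans hw
    rw [Set.union_empty_iff] at hw'
    refine ⟨⟨(v, w.1.2.2), fun x hx => ((FinGSet.sub_prop w).2.1 x hx).trans hy.symm,
      hw'.1, hw'.2⟩, ⟨rfl, V₂_ext f hy hC rfl⟩, ?_⟩
    rintro z ⟨rfl, rfl⟩
    rfl
  have h₂ : S.R (p₂ f) (S.conv f b c) =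
      S.T (merge₂₃ f) (S.R (q₂₃ f) (S.R (p₁ f) b * S.R (p₂ f) c)) := by
    refine S.R_T (q₂₃ f) (merge₂₃ f) (p₁₂ f) (p₂ f) (fun _ => rfl) ?_ _
    intro v w h
    have hy : v.1.1 = w.1.1 := congrArg (fun v : V f => v.1.1) h
    have hC : (v.1.2.1 : Set X) ∪ v.1.2.2 = w.1.2.2 := congrArg (fun v : V f => v.1.2) h
    have hw := (FinGSet.sub_prop w).2.2
    rw [← hC] at hw
    have hw' := (Set.inter_union_distrib_left _ _ _).symm.trans hw
    rw [Set.union_empty_iff] at hw'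
    refine ⟨⟨(⟨(w.1.1, w.1.2.1, v.1.2.1), (FinGSet.sub_prop w).1,
      fun x hx => ((FinGSet.sub_prop v).1 x hx).trans hy, hw'.1⟩, v.1.2.2),
      fun x hx => ((FinGSet.sub_prop v).2.1 x hx).trans hy, hw'.2, (FinGSet.sub_prop v).2.2⟩,
      ⟨V₂_ext f hy.symm rfl rfl, V₂_ext f rfl rfl hC⟩, ?_⟩
    rintro z ⟨rfl, rfl⟩
    rfl
  have h₁' : S.conv f (S.conv f a b) c =
      S.T (p₁₂ f) (S.R (p₁ f) (S.conv f a b) * S.R (p₂ f) c) := rfl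
  have h₂' : S.conv f a (S.conv f b c) =
      S.T (p₁₂ f) (S.R (p₁ f) a * S.R (p₂ f) (S.conv f b c)) := rfl
  rw [h₁', h₂', h₁, h₂, mul_comm, mul_T, mul_T, T_T, T_T, mul_comm, R_mul, R_mul, mul_assoc, R_R,
    R_R, R_R, R_R, R_R, R_R]
  refine congrArg (fun i => S.T i _) ?_
  ext v
  exact Subtype.ext (Prod.ext rfl (Set.union_assoc _ _ _))

/-- As `0` is a transfer from the empty set, the distributive law expresses this norm as a transfer
from the set of points over which the fibre of `t` is empty, which are those of the form `k y`. -/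
theorem chi_zero : S.chi f 0 = S.convUnit f := by
  rw [chi, R_zero, ← S.T_zero (fromEmpty (U f)),
    S.N_T (fromEmpty (U f)) (t f) (.id G) (fromEmpty Y) (k f) (fun a => a.elim),
    S.N_of_isEmpty (X := empty G) inferInstance, convUnit]
  · intro z y h
    have hz : z.1.2 = (∅ : Set X) := congrArg (fun v : V f => v.1.2) h
    have := (FinGSet.sub_prop z).1
    rw [hz] at this
    exact this.elim
  · intro v s hs
    refine ⟨v.1.1, ⟨V_ext f rfl fun x => ⟨fun hx => hx.elim, fun hx => ?_⟩, fun a => a.elim⟩, ?_⟩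
    · have hfx : f x = v.1.1 := (FinGSet.sub_prop v) x hx
      exact (s ⟨⟨(x, v.1.2), hx, fun x' hx' => ((FinGSet.sub_prop v) x' hx').trans hfx.symm⟩,
        Subtype.ext (Prod.ext hfx rfl)⟩).elim
    · rintro y ⟨rfl, -⟩
      rfl

/-- This is the norm of a sum along `t : U(f) → V(f)`. A subset of the fibre of `t` over `(y, C)`
amounts to a decomposition of `C` into two parts, that is to a point of `V²(f)`. -/
theorem chi_add (a b : S.obj X) : S.chi f (a + b) = S.conv f (S.chi f a) (S.chi f b) := by
  have h₁ : S.R (p₁ f) (S.chi f a) = S.N (t₁ f) (S.R (m₁ f) (S.R (r f) a)) := by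
    rw [chi, S.R_N (s₁ f) (t₁ f) (t f) (p₁ f), R_R, R_R]
    · rfl
    · exact fun z => Subtype.ext (Prod.ext ((FinGSet.sub_prop z.1.2).1 _ z.2) rfl)
    · intro z v h
      have hC : z.1.2 = v.1.2.1 := congrArg (fun v : V f => v.1.2) h
      refine ⟨⟨(z.1.1, v), hC.subset (FinGSet.sub_prop z).1⟩,
        ⟨Subtype.ext (Prod.ext rfl hC.symm), rfl⟩, ?_⟩
      rintro w ⟨rfl, rfl⟩
      rfl
  have h₂ : S.R (p₂ f) (S.chi f b) = S.N (t₂ f) (S.R (m₂ f) (S.R (r f) b)) := by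
    rw [chi, S.R_N (s₂ f) (t₂ f) (t f) (p₂ f), R_R, R_R]
    · rfl
    · exact fun z => Subtype.ext (Prod.ext ((FinGSet.sub_prop z.1.2).2.1 _ z.2) rfl)
    · intro z v h
      have hC : z.1.2 = v.1.2.2 := congrArg (fun v : V f => v.1.2) h
      refine ⟨⟨(z.1.1, v), hC.subset (FinGSet.sub_prop z).1⟩,
        ⟨Subtype.ext (Prod.ext rfl hC.symm), rfl⟩, ?_⟩
      rintro w ⟨rfl, rfl⟩
      rfl
  rw [conv, h₁, h₂, chi, R_add]
  apply S.N_add (t f) (m₁ f) (t₁ f) (m₂ f) (t₂ f) (p₁₂ f)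
  · exact fun z => Subtype.ext (Prod.ext ((FinGSet.sub_prop z.1.2).1 _ z.2) rfl)
  · exact fun z => Subtype.ext (Prod.ext ((FinGSet.sub_prop z.1.2).2.1 _ z.2) rfl)
  · intro z z' h h'
    exact Subtype.ext (Prod.ext (congrArg (fun w : U f => w.1.1) h) h')
  · intro z z' h h'
    exact Subtype.ext (Prod.ext (congrArg (fun w : U f => w.1.1) h) h')
  · intro z z' h h'
    have hx : z.1.1 = z'.1.1 := congrArg (fun w : U f => w.1.1) h
    have hv : z.1.2 = z'.1.2 := h'
    have hz := FinGSet.sub_prop z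
    rw [hx, hv] at hz
    exact (FinGSet.sub_prop z'.1.2).2.2.subset ⟨hz, FinGSet.sub_prop z'⟩
  · intro z v h
    have hC : z.1.2 = (v.1.2.1 : Set X) ∪ v.1.2.2 := congrArg (fun v : V f => v.1.2) h
    have hz := (FinGSet.sub_prop z).1
    rw [hC] at hz
    rcases hz with hz | hz
    · exact Or.inl ⟨⟨(z.1.1, v), hz⟩, Subtype.ext (Prod.ext rfl hC.symm), rfl⟩
    · exact Or.inr ⟨⟨(z.1.1, v), hz⟩, Subtype.ext (Prod.ext rfl hC.symm), rfl⟩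
  · -- The subset of the fibre `C` of `t` over `(y, C)` given by `(y, C₁, C₂)` is `C₁`.
    intro v D hD
    have hD' : ∀ z ∈ D, f z.1.1 = v.1.1 ∧ z.1.2 = v.1.2 := fun z hz =>
      ⟨congrArg (fun v : V f => v.1.1) (hD z hz), congrArg (fun v : V f => v.1.2) (hD z hz)⟩
    let C : Set X := {x | ∃ z ∈ D, z.1.1 = x}
    have hCv : C ⊆ v.1.2 := by
      rintro _ ⟨z, hz, rfl⟩
      exact (hD' z hz).2.subset (FinGSet.sub_prop z).1
    let w : V₂ f := ⟨(v.1.1, C, v.1.2 \ C), fun x hx => (FinGSet.sub_prop v) x (hCv hx),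
      fun x hx => (FinGSet.sub_prop v) x hx.1, Set.inter_sdiff_self _ _⟩
    have hw : p₁₂ f w = v := Subtype.ext (Prod.ext rfl (Set.union_sdiff_cancel hCv))
    have hw' : (p₁₂ f w).1.2 = v.1.2 := congrArg (fun v : V f => v.1.2) hw
    refine ⟨w, ⟨hw, fun z => ⟨fun hz => ?_, ?_⟩⟩, ?_⟩
    · exact ⟨⟨(z.1.1, w), z, hz, rfl⟩,
        Subtype.ext (Prod.ext rfl (hw'.trans (hD' z hz).2.symm)), rfl⟩
    · rintro ⟨a, rfl, h⟩
      have ha : a.1.2 = w := h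
      have hx := FinGSet.sub_prop a
      rw [ha] at hx
      obtain ⟨z, hz, hzx⟩ := hx
      have : m₁ f a = z := Subtype.ext (Prod.ext hzx.symm
        ((congrArg (fun w => (p₁₂ f w).1.2) ha).trans (hw'.trans (hD' z hz).2.symm)))
      rwa [this]
    · rintro w' ⟨h, h'⟩
      have hy : w'.1.1 = v.1.1 := congrArg (fun v : V f => v.1.1) h
      have hu : (w'.1.2.1 : Set X) ∪ w'.1.2.2 = v.1.2 := congrArg (fun v : V f => v.1.2) h
      have hC : w'.1.2.1 = C := by
        ext x
        constructor
        · exact fun hx => ⟨m₁ f ⟨(x, w'), hx⟩, (h' _).2 ⟨_, rfl, rfl⟩, rfl⟩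
        · rintro ⟨z, hz, rfl⟩
          obtain ⟨a, rfl, rfl⟩ := (h' z).1 hz
          exact FinGSet.sub_prop a
      refine V₂_ext f hy hC ?_
      change w'.1.2.2 = (v.1.2 \ C : Set X)
      rw [← hu, ← hC, Set.union_sdiff_left]
      exact (Disjoint.sdiff_eq_left
        (Set.disjoint_iff_inter_eq_empty.2 (FinGSet.sub_prop w').2.2).symm).symm

/-- The pullback of `t : U(f) → V(f)` along `j` is `f`. -/
theorem N_eq_R_j_chi (a : S.obj X) : S.N f a = S.R (j f) (S.chi f a) := by
  have hj : ∀ x : X, x ∈ (j f (f x)).1.2 := fun _ => rfl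
  let i : X →[G] U f := ⟨fun x => ⟨(x, (j f (f x)).1.2), rfl, fun _ hx => hx⟩, fun g x =>
    Subtype.ext (Prod.ext rfl (congrArg (fun v : V f => v.1.2)
      ((congrArg (j f) (map_smul f g x)).trans (map_smul (j f) g (f x)))))⟩
  rw [chi, S.R_N i f (t f) (j f), R_R]
  · exact congrArg (S.N f) (S.R_id a).symm
  · exact fun _ => rfl
  · intro z y h
    have hy : f z.1.1 = y := congrArg (fun v : V f => v.1.1) h
    have hC : z.1.2 = (j f y).1.2 := congrArg (fun v : V f => v.1.2) h
    refine ⟨z.1.1, ⟨Subtype.ext (Prod.ext rfl ?_), hy⟩, ?_⟩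
    · exact (congrArg (fun y => (j f y).1.2) hy).trans hC.symm
    · rintro w ⟨rfl, -⟩
      rfl

/-- The operation `χ` of a Tambara functor `S'` extends that of `S` along any morphism `S → S'`. -/
theorem isChiExtension_chi {S S' : TambaraFunctor.{u, v} G} (η : S.Hom S') :
    IsChiExtension f η (S'.chi f) where
  map_zero := S'.chi_zero f
  map_add := S'.chi_add f
  restrict := S'.R_k_chi f
  extends_chi a := by rw [chi, chi, hom_N, hom_R]

end TambaraFunctor

/-! ### Group completion of Mackey functors -/

namespace MackeyFunctor

open FinGSet Algebra GrothendieckAddGroup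

variable {G : Type u} [Group G] (M : MackeyFunctor.{u, v} G)

theorem unique_completion_empty :
    Nonempty (Unique (GrothendieckAddGroup (M.obj (empty G)))) := by
  refine ⟨⟨⟨0⟩, fun x => ?_⟩⟩
  obtain ⟨a, b, h⟩ := exists_add_of x
  rw [M.eq_point a, M.eq_point b] at h
  exact add_eq_right.1 h

/-- The Mackey functor `M⁺` with `M⁺(X) = M(X)⁺`. -/
noncomputable def completion : MackeyFunctor.{u, v} G where
  toFunctor :=
    { obj := fun X : FinGSet G => GrothendieckAddGroup (M.obj X)
      map := fun {X Y : FinGSet G} (f : SpanCat.of X ⟶ SpanCat.of Y) => ↾(mapHom (M.addHomMap f))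
      map_id := fun X : FinGSet G => by
        ext x
        refine Eq.trans (congrArg (fun h => mapHom h x) ?_) (mapHom_id x)
        exact AddMonoidHom.ext fun a => ConcreteCategory.congr_hom (M.toFunctor.map_id X) a
      map_comp := fun {X Y Z : FinGSet G} (f : SpanCat.of X ⟶ SpanCat.of Y)
          (g : SpanCat.of Y ⟶ SpanCat.of Z) => by
        ext x
        refine Eq.trans (congrArg (fun h => mapHom h x) ?_)
          (mapHom_mapHom (M.addHomMap g) (M.addHomMap f) x).symm
        exact AddMonoidHom.ext fun a => ConcreteCategory.congr_hom (M.toFunctor.map_comp f g) a }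
  preservesFiniteProducts := (SpanCat.preservesFiniteProducts_iff _).2
    ⟨M.unique_completion_empty, fun X Y => bijective_mapHom (M.addHomMap (SpanCat.R (inl X Y)))
      (M.addHomMap (SpanCat.R (inr X Y))) (M.bijective_R_R X Y)⟩

/-- If the values of `M'` are group completions of those of `M`, and fold maps and
inclusions of summands act on `M'` by the additive extensions of their action on `M`, then the
sum that `M'` defines on its values is the sum of the group completion. -/
theorem equiv_add {M M' : MackeyFunctor.{u, v} G}
    (E : ∀ X : FinGSet G, M'.obj X ≃ GrothendieckAddGroup (M.obj X))
    (hT : ∀ X a, E X (M'.T (fold X) a) = mapHom (M.addHomMap (SpanCat.T (fold X))) (E _ a))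
    (hl : ∀ X a, E X (M'.R (inl X X) a) = mapHom (M.addHomMap (SpanCat.R (inl X X))) (E _ a))
    (hr : ∀ X a, E X (M'.R (inr X X) a) = mapHom (M.addHomMap (SpanCat.R (inr X X))) (E _ a))
    (X : FinGSet G) (a b : M'.obj X) : E X (a + b) = E X a + E X b := by
  have key : ∀ w, mapHom (M.addHomMap (SpanCat.T (fold X))) w =
      mapHom (M.addHomMap (SpanCat.R (inl X X))) w +
        mapHom (M.addHomMap (SpanCat.R (inr X X))) w := by
    intro w
    rw [mapHom_add_mapHom]
    refine congrArg (fun h => mapHom h w) (AddMonoidHom.ext fun z => ?_)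
    exact congrArg (M.T (fold X)) (M.symm_R_R z).symm
  rw [add_def, hT, key, ← hl, ← hr, R_inl_symm, R_inr_symm]

/-- The canonical morphism `M → M⁺`. -/
noncomputable def toCompletion : M.Hom M.completion where
  app := fun X : FinGSet G => ↾(of (M := M.obj X))
  naturality := fun (X Y : FinGSet G) (f : SpanCat.of X ⟶ SpanCat.of Y) => by
    ext a
    exact (mapHom_of (M.addHomMap f) a).symm

/-- The identification of the monoid `M⁺(X)` with the group completion of `M(X)`. -/
noncomputable def completionEquiv (X : FinGSet G) :
    M.completion.obj X ≃+ GrothendieckAddGroup (M.obj X) where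
  __ := Equiv.refl _
  map_add' := equiv_add (M := M) (M' := M.completion) (fun _ => Equiv.refl _) (fun _ _ => rfl)
    (fun _ _ => rfl) (fun _ _ => rfl) X

end MackeyFunctor

/-! ### Group completion of Tambara functors -/

namespace TambaraFunctor

open FinGSet Algebra GrothendieckAddGroup

variable {G : Type u} [Group G] (S : TambaraFunctor.{u, v} G) {X Y Z : FinGSet G}

theorem exists_completionMap (ω : BispanCat.of X ⟶ BispanCat.of Y) :
    ∃ F : GrothendieckAddGroup (S.obj X) → GrothendieckAddGroup (S.obj Y),
      (∃ n, DegreeLT n F) ∧ ∀ a, F (of a) = of (S.toFunctor.map ω a) := by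
  obtain ⟨n, hn⟩ := S.exists_degreeLT_map ω (of (M := S.obj Y))
  obtain ⟨F, hF, h⟩ := exists_degreeLT hn
  exact ⟨F, ⟨n, hF⟩, h⟩

/-- The unique polynomial extension of an operation of `S` to the group completions. -/
noncomputable def completionMap (ω : BispanCat.of X ⟶ BispanCat.of Y) :
    GrothendieckAddGroup (S.obj X) → GrothendieckAddGroup (S.obj Y) :=
  (S.exists_completionMap ω).choose

theorem exists_degreeLT_completionMap (ω : BispanCat.of X ⟶ BispanCat.of Y) :
    ∃ n, DegreeLT n (S.completionMap ω) :=
  (S.exists_completionMap ω).choose_spec.1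

theorem completionMap_of (ω : BispanCat.of X ⟶ BispanCat.of Y) (a : S.obj X) :
    S.completionMap ω (of a) = of (S.toFunctor.map ω a) :=
  (S.exists_completionMap ω).choose_spec.2 a

theorem completionMap_eq {ω : BispanCat.of X ⟶ BispanCat.of Y} {n : ℕ}
    {F : GrothendieckAddGroup (S.obj X) → GrothendieckAddGroup (S.obj Y)} (hF : DegreeLT n F)
    (h : ∀ a, F (of a) = of (S.toFunctor.map ω a)) : S.completionMap ω = F := by
  obtain ⟨m, hm⟩ := S.exists_degreeLT_completionMap ω
  exact eq_of_degreeLT hm hF fun a => (S.completionMap_of ω a).trans (h a).symm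

theorem completionMap_eq_map {ω : BispanCat.of X ⟶ BispanCat.of Y} (h : S.obj X →+ S.obj Y)
    (hω : ∀ a, S.toFunctor.map ω a = h a) : S.completionMap ω = mapHom h :=
  S.completionMap_eq (.of_hom (mapHom h)) fun a => by rw [mapHom_of, hω]

/-- The Tambara functor `S⁺` with `S⁺(X) = S(X)⁺`. It is a functor since composites of
polynomial maps are polynomial, and polynomial extensions are unique. -/
noncomputable def completion : TambaraFunctor.{u, v} G where
  toFunctor :=
    { obj := fun X : FinGSet G => GrothendieckAddGroup (S.obj X)
      map := fun {X Y : FinGSet G} (ω : BispanCat.of X ⟶ BispanCat.of Y) => ↾(S.completionMap ω)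
      map_id := fun X : FinGSet G => by
        ext x
        refine congrFun (S.completionMap_eq
          (.of_hom (AddMonoidHom.id (GrothendieckAddGroup (S.obj X)))) fun a => ?_) x
        have ha : S.toFunctor.map (𝟙 (BispanCat.of X)) a = a := by
          rw [S.toFunctor.map_id]
          rfl
        exact congrArg of ha.symm
      map_comp := fun {X Y Z : FinGSet G} (ω : BispanCat.of X ⟶ BispanCat.of Y)
          (ω' : BispanCat.of Y ⟶ BispanCat.of Z) => by
        ext x
        obtain ⟨m, hm⟩ := S.exists_degreeLT_completionMap ω
        obtain ⟨n, hn⟩ := S.exists_degreeLT_completionMap ω'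
        obtain ⟨k, hk⟩ := hn.comp hm
        refine congrFun (S.completionMap_eq hk fun a => ?_) x
        rw [completionMap_of, completionMap_of]
        exact congrArg of (ConcreteCategory.congr_hom (S.toFunctor.map_comp ω ω') a).symm }
  preservesFiniteProducts := (BispanCat.preservesFiniteProducts_iff _).2 (by
    refine ⟨S.additive.unique_completion_empty, fun X Y => ?_⟩
    have h := bijective_mapHom (S.addHomR (inl X Y)) (S.addHomR (inr X Y))
      (S.additive.bijective_R_R X Y)
    rw [← S.completionMap_eq_map (ω := BispanCat.R (inl X Y)) _ fun _ => rfl,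
      ← S.completionMap_eq_map (ω := BispanCat.R (inr X Y)) _ fun _ => rfl] at h
    exact h)

/-- The canonical morphism `S → S⁺`. -/
noncomputable def toCompletion : S.Hom S.completion where
  app := fun X : FinGSet G => ↾(of (M := S.obj X))
  naturality := fun (X Y : FinGSet G) (ω : BispanCat.of X ⟶ BispanCat.of Y) => by
    ext a
    exact (S.completionMap_of ω a).symm

/-- The identification of the monoid `S⁺(X)` with the group completion of `S(X)`. -/
noncomputable def completionEquiv (X : FinGSet G) :
    S.completion.obj X ≃+ GrothendieckAddGroup (S.obj X) where
  __ := Equiv.refl _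
  map_add' := MackeyFunctor.equiv_add (M := S.additive) (M' := S.completion.additive)
    (fun _ => Equiv.refl _)
    (fun X => congrFun (S.completionMap_eq_map (ω := BispanCat.T (fold X)) _ fun _ => rfl))
    (fun X => congrFun (S.completionMap_eq_map (ω := BispanCat.R (inl X X)) _ fun _ => rfl))
    (fun X => congrFun (S.completionMap_eq_map (ω := BispanCat.R (inr X X)) _ fun _ => rfl)) X

theorem isAdditivelyComplete_completion : S.completion.IsAdditivelyComplete := fun X a =>
  ⟨(S.completionEquiv X).symm (-S.completionEquiv X a),
    (S.completionEquiv X).injective (by simp)⟩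

variable {S} {S' : TambaraFunctor.{u, v} G}

/-- Every value of an extension of `χ` at the image of `S(X)` is invertible for the convolution
product, and this determines the extension. -/
theorem IsChiExtension.unique {η : S.Hom S'} {f : X →[G] Y}
    (hη : ∀ x : S'.obj X, ∃ a b : S.obj X, x + η.app X b = η.app X a)
    (hS' : S'.IsAdditivelyComplete) {c c' : S'.obj X → S'.obj (V f)}
    (hc : IsChiExtension f η c) (hc' : IsChiExtension f η c') : c = c' := by
  funext x
  obtain ⟨a, b, h⟩ := hη x
  obtain ⟨y, hy⟩ := hS' X (η.app X b)
  have key : S'.conv f (c x) (c (η.app X b)) = S'.conv f (c' x) (c (η.app X b)) := by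
    rw [← hc.map_add, hc.extends_chi b, ← hc'.extends_chi b, ← hc'.map_add, h, hc.extends_chi,
      hc'.extends_chi]
  have inv : ∀ z, S'.conv f (S'.conv f z (c (η.app X b))) (c y) = z := fun z => by
    rw [conv_assoc, ← hc.map_add, hy, hc.map_zero, conv_comm, convUnit_conv]
  rw [← inv (c x), key, inv]

/-- The additive group of a value of an additively complete Tambara functor. Its underlying monoid
is the given one, and negatives are chosen. -/
@[reducible] noncomputable def addCommGroup {T : TambaraFunctor.{u, v} G}
    (hT : T.IsAdditivelyComplete) (X : FinGSet G) : AddCommGroup (T.obj X) :=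
  letI : Neg (T.obj X) := ⟨fun a => (hT X a).choose⟩
  { zsmul := zsmulRec
    neg_add_cancel := fun a => (add_comm _ _).trans (hT X a).choose_spec }

/-- The extension of a morphism to an additively complete Tambara functor is natural because
both sides of the naturality squares are polynomial. -/
theorem existsUnique_completion_hom {T : TambaraFunctor.{u, v} G} (hT : T.IsAdditivelyComplete)
    (φ : S.Hom T) : ∃! φ' : S.completion.Hom T, S.toCompletion ≫ φ' = φ := by
  let _ := addCommGroup hT
  let L : ∀ X : FinGSet G, GrothendieckAddGroup (S.obj X) →+ T.obj X := fun X =>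
    lift (addHomApp φ X)
  have hL : ∀ X a, L X (of a) = φ.app X a := fun X a => lift_of _ a
  refine ⟨{ app := fun X => ↾(L X), naturality :=
    fun (X Y : FinGSet G) (ω : BispanCat.of X ⟶ BispanCat.of Y) => ?_ }, ?_, ?_⟩
  · ext x
    obtain ⟨m, hm⟩ := S.exists_degreeLT_completionMap ω
    obtain ⟨n, hn⟩ := T.exists_degreeLT_map ω
      { toFun := fun a => a, map_zero' := rfl, map_add' := fun _ _ => rfl }
    refine congrFun (eq_of_degreeLT (hm.hom_comp (L Y)) (hn.comp_hom (L X)) fun a => ?_) x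
    rw [completionMap_of, hL, hL]
    exact ConcreteCategory.congr_hom (φ.naturality ω) a
  · ext X a
    exact hL X a
  · -- Any such morphism is additive, hence determined by its values on the image of `S`.
    rintro ψ rfl
    refine NatTrans.ext (funext fun X : FinGSet G => ?_)
    ext x
    exact DFunLike.congr_fun (hom_ext (F := (addHomApp ψ X).comp
      (S.completionEquiv X).symm.toAddMonoidHom) (F' := L X) fun a => (hL X a).symm) x

end TambaraFunctor

theorem mainTheorem5 {G : Type u} [Group G] [Finite G] :
    (∀ M : MackeyFunctor.{u, v} G,
      ∃ (M' : MackeyFunctor.{u, v} G) (η : M.Hom M')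
        (e : ∀ X : FinGSet G, M'.obj X ≃+ Algebra.GrothendieckAddGroup (M.obj X)),
        ∀ (X : FinGSet G) (a : M.obj X),
          e X (η.app X a) = Algebra.GrothendieckAddGroup.of a) ∧
    (∀ S : TambaraFunctor.{u, v} G,
      ∃ (S' : TambaraFunctor.{u, v} G) (η : S.Hom S')
        (e : ∀ X : FinGSet G, S'.obj X ≃+ Algebra.GrothendieckAddGroup (S.obj X)),
        (∀ (X : FinGSet G) (a : S.obj X),
          e X (η.app X a) = Algebra.GrothendieckAddGroup.of a) ∧
        S'.IsAdditivelyComplete ∧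
        (∀ (X Y : FinGSet G) (f : X →[G] Y),
          (∃! c : S'.obj X → S'.obj (FinGSet.V f), TambaraFunctor.IsChiExtension f η c) ∧
          (∀ c : S'.obj X → S'.obj (FinGSet.V f), TambaraFunctor.IsChiExtension f η c →
            ∀ a : S'.obj X, S'.N f a = S'.R (FinGSet.j f) (c a)) ∧
          (∀ d : ℕ, (∀ y : Y, Nat.card {x : X // f x = y} ≤ d) →
            IsPolynomialOfDegreeLE d
              (fun a : Algebra.GrothendieckAddGroup (S.obj X) =>
                e Y (S'.N f ((e X).symm a))))) ∧
        (∀ T : TambaraFunctor.{u, v} G, T.IsAdditivelyComplete → ∀ φ : S.Hom T,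
          ∃! φ' : S'.Hom T, η ≫ φ' = φ)) := by
  refine ⟨fun M => ⟨M.completion, M.toCompletion, M.completionEquiv, fun _ _ => rfl⟩, fun S =>
    ⟨S.completion, S.toCompletion, S.completionEquiv, fun _ _ => rfl,
      S.isAdditivelyComplete_completion, fun X Y f => ?_,
      fun T hT φ => TambaraFunctor.existsUnique_completion_hom hT φ⟩⟩
  have hη : ∀ x : S.completion.obj X, ∃ a b : S.obj X,
      x + S.toCompletion.app X b = S.toCompletion.app X a := by
    intro x
    obtain ⟨a, b, h⟩ := Algebra.GrothendieckAddGroup.exists_add_of (S.completionEquiv X x)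
    refine ⟨a, b, (S.completionEquiv X).injective ?_⟩
    rw [map_add]
    exact h
  have huniq : ∀ c, TambaraFunctor.IsChiExtension f S.toCompletion c → c = S.completion.chi f :=
    fun c hc => hc.unique hη S.isAdditivelyComplete_completion
      (TambaraFunctor.isChiExtension_chi f S.toCompletion)
  refine ⟨⟨_, TambaraFunctor.isChiExtension_chi f _, huniq⟩, fun c hc a => ?_, fun d hd => ?_⟩
  · rw [huniq c hc]
    exact S.completion.N_eq_R_j_chi f a
  · exact ((S.completion.degreeLT_N d f hd (S.completionEquiv Y).toAddMonoidHom).comp_hom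
      (S.completionEquiv X).symm.toAddMonoidHom).isPolynomialOfDegreeLE
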